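/- Notation. Let $t\in\mathbb N$, $z=x+iy$ with $y>0$, and $q=e^{2\pi i z}$. For a partition $\lambda$ let $\mathcal H_t(\lambda)$ be the multiset of its hook numbers that are multiples of $t$, and for $a\in\mathbb C$ put $f_{a,t}(\lambda):=t^{a-1}\sum_{h\in\mathcal H_t(\lambda)}h^{-a}$. The $q$-bracket of $f$ is $$\langle f\rangle_q:=\frac{\sum_\lambda f(\lambda)q^{|\lambda|}}{\sum_\lambda q^{|\lambda|}}.$$ Put $\sigma_\ell(n):=\sum_{d\mid n}d^\ell$ and $\Gamma^*(s,x):=\frac1{\Gamma(s)}\int_x^\infty e^{-u}u^{s-1}\,du$, let $\gamma$ be Euler's constant and $B_n$ the Bernoulli numbers. With $\xi_k:=2iy^k\,\overline{\partial/\partial\bar z}$, a harmonic (resp. sesquiharmonic) Maass form of integer weight $k$ on a congruence subgroup $\Gamma\le \mathrm{SL}_2(\mathbb Z)$ is a real-analytic function on the upper half-plane that is modular of weight $k$ on $\Gamma$, grows at most linear exponentially towards every cusp, and is annihilated by $\Delta_k:=-\xi_{2-k}\circ\xi_k$ (resp. by $\Delta_{k,2}:=-\xi_k\circ\xi_{2-k}\circ\xi_k$).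 Theorem. (1) The function $$\mathbb E_0(tz):=ty+\frac6\pi\left(\gamma-\log 2-\frac{\log(ty)}2-\frac{6\zeta'(2)}{\pi^2}+\langle f_{2,t}\rangle_q+\sum_{n\ge1}\sigma_{-1}(n)\,\overline q^{\,tn}\right)$$ is a sesquiharmonic Maass form of weight $0$ on $\Gamma_0(t)$. Moreover it is the constant term at $s=1$ of the Eisenstein series $E(tz,s)$, where $E(z,s):=\frac12\sum_{\gcd(c,d)=1}\frac{y^s}{|cz+d|^{2s}}$ for $\operatorname{Re}(s)>1$: the function $E(tz,s)-\frac{3}{\pi(s-1)}$ extends analytically to a neighbourhood of $s=1$, with value $\mathbb E_0(tz)$ at $s=1$. (2) If $k\ge2$ is an integer, then the function $$\mathbb E_{2-2k}(tz):=(ty)^{2k-1}+\frac{2\cdot(2k)!}{B_{2k}(4\pi)^{2k-1}}\left(\zeta(2k-1)+\langle f_{2k,t}\rangle_q+\sum_{n\ge1}\sigma_{1-2k}(n)\,\Gamma^*(2k-1,4\pi tny)\,q^{-tn}\right)$$ is a harmonic Maass form of weight $2-2k$ on $\Gamma_0(t)$. In both parts the notation is consistent: the displayed expression for $(t,z)$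 equals the one for $(1,tz)$. -/

import Mathlib

open scoped UpperHalfPlane MatrixGroups ModularForm

noncomputable section

namespace HookMaass

/-! ### Partitions, hook numbers and `q`-brackets -/

/-- The parts `λ₁ ≥ λ₂ ≥ … ≥ λ_m` of a partition, as a nonincreasing list. -/
def rows {n : ℕ} (p : n.Partition) : List ℕ :=
  p.parts.sort (· ≥ ·)

/-- The number of nodes in row `i` (counted from `0`) of the Ferrers-Young diagram. -/
def rowLen {n : ℕ} (p : n.Partition) (i : ℕ) : ℕ :=
  (rows p).getD i 0

/-- The number of nodes in column `j` (counted from `0`) of the Ferrers-Young diagram, that is, the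
number of parts exceeding `j`. -/
def colLen {n : ℕ} (p : n.Partition) (j : ℕ) : ℕ :=
  (p.parts.filter (fun m => j < m)).card

/-- The nodes of the Ferrers-Young diagram, as pairs (row, column) counted from `0`. -/
def nodes {n : ℕ} (p : n.Partition) : Finset (Σ _ : ℕ, ℕ) :=
  (Finset.range p.parts.card).sigma (fun i => Finset.range (rowLen p i))

/-- The hook number of the node in row `i` and column `j`, both counted from `0`. With `ℓ = i + 1`
and `j + 1` as the row and column numbers counted from `1` this is
`λ_ℓ - ℓ + λ'_{j+1} - (j + 1) + 1`. On a node, `j < λ_ℓ` and `i < λ'_{j+1}`, so no subtraction is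
truncated. -/
def hookNumber {n : ℕ} (p : n.Partition) (i j : ℕ) : ℕ :=
  (rowLen p i - j) + (colLen p j - i) - 1

/-- The multiset of hook numbers of a partition. -/
def hooks {n : ℕ} (p : n.Partition) : Multiset ℕ :=
  (nodes p).val.map (fun c => hookNumber p c.1 c.2)

/-- The multiset of hook numbers that are multiples of `t`. -/
def tHooks (t : ℕ) {n : ℕ} (p : n.Partition) : Multiset ℕ :=
  (hooks p).filter (fun h => t ∣ h)

/-- The weighted `t`-hook function `f_{a,t}(λ) = t^{a-1} ∑_{h ∈ H_t(λ)} h^{-a}`. -/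
def hookWeight (a : ℂ) (t n : ℕ) (p : n.Partition) : ℂ :=
  (t : ℂ) ^ (a - 1) * ((tHooks t p).map (fun h => 1 / (h : ℂ) ^ a)).sum

/-- The `q`-bracket of a function on partitions, a formal power series:
`(∑_λ f(λ) q^|λ|) / (∑_λ q^|λ|)`. The denominator has constant term `1`, so it is invertible. -/
def qBracket (f : (n : ℕ) → n.Partition → ℂ) : PowerSeries ℂ :=
  PowerSeries.mk (fun n => ∑ p : n.Partition, f n p) *
    (PowerSeries.mk (fun n => ∑ _p : n.Partition, (1 : ℂ)))⁻¹

/-- `q = exp(2πiz)`. -/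
def qParam (z : ℍ) : ℂ :=
  Complex.exp (2 * Real.pi * Complex.I * (z : ℂ))

/-- The value at `q = exp(2πiz)` of the power series `⟨f_{a,t}⟩_q`. -/
def hookBracket (a : ℂ) (t : ℕ) (z : ℍ) : ℂ :=
  ∑' n : ℕ, PowerSeries.coeff n (qBracket (hookWeight a t)) * qParam z ^ n

/-! ### Maass forms -/

/-- The Wirtinger derivative `∂f/∂z̄ = (∂f/∂x + i ∂f/∂y) / 2`. -/
def dbar (f : ℍ → ℂ) (z : ℍ) : ℂ :=
  (fderiv ℝ (f ∘ UpperHalfPlane.ofComplex) (z : ℂ) 1 +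
    Complex.I * fderiv ℝ (f ∘ UpperHalfPlane.ofComplex) (z : ℂ) Complex.I) / 2

/-- The operator `ξ_k f = 2 i y^k · conj(∂f/∂z̄)`. -/
def xi (k : ℤ) (f : ℍ → ℂ) (z : ℍ) : ℂ :=
  2 * Complex.I * (z.im : ℂ) ^ k * (starRingEnd ℂ) (dbar f z)

/-- The weight `k` hyperbolic Laplacian `Δ_k = -ξ_{2-k} ∘ ξ_k`. -/
def laplacian (k : ℤ) (f : ℍ → ℂ) : ℍ → ℂ :=
  -xi (2 - k) (xi k f)

/-- The operator `Δ_{k,2} = -ξ_k ∘ ξ_{2-k} ∘ ξ_k`. -/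
def laplacian₂ (k : ℤ) (f : ℍ → ℂ) : ℍ → ℂ :=
  -xi k (xi (2 - k) (xi k f))

/-- A real-analytic function on the upper half-plane that is modular of weight `k` on
`Γ` and grows at most linear exponentially towards every cusp. -/
structure IsRealAnalyticModular (k : ℤ) (Γ : Subgroup SL(2, ℤ)) (f : ℍ → ℂ) : Prop where
  analytic : AnalyticOnNhd ℝ (f ∘ UpperHalfPlane.ofComplex) {z : ℂ | 0 < z.im}
  modular : ∀ γ ∈ Γ, f ∣[k] γ = f
  growth : ∀ γ : SL(2, ℤ), ∃ C : ℝ,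
    (f ∣[k] γ) =O[UpperHalfPlane.atImInfty] fun z : ℍ => Real.exp (C * z.im)

/-- A harmonic Maass form of weight `k` on `Γ`. -/
structure IsHarmonicMaassForm (k : ℤ) (Γ : Subgroup SL(2, ℤ)) (f : ℍ → ℂ) : Prop
    extends IsRealAnalyticModular k Γ f where
  harmonic : laplacian k f = 0

/-- A sesquiharmonic Maass form of weight `k` on `Γ`. -/
structure IsSesquiharmonicMaassForm (k : ℤ) (Γ : Subgroup SL(2, ℤ)) (f : ℍ → ℂ) : Prop
    extends IsRealAnalyticModular k Γ f where
  sesquiharmonic : laplacian₂ k f = 0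

/-! ### The functions -/

/-- The divisor sum `σ_ℓ(n) = ∑_{d ∣ n} d^ℓ` for an integer `ℓ`, possibly negative. -/
def sigma (l : ℤ) (n : ℕ) : ℂ :=
  ∑ d ∈ n.divisors, (d : ℂ) ^ l

/-- The incomplete Gamma function `Γ(s, x) = ∫_x^∞ e^{-u} u^{s-1} du`, for real arguments. -/
def incGamma (s x : ℝ) : ℝ :=
  ∫ u in Set.Ioi x, Real.exp (-u) * u ^ (s - 1)

/-- The normalized incomplete Gamma function `Γ*(s, x) = Γ(s, x) / Γ(s)`. -/
def incGammaStar (s x : ℝ) : ℝ :=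
  incGamma s x / Real.Gamma s

/-- `𝔼₀(tz)`, as a function of `t` and `z`. -/
def EE₀ (t : ℕ) (z : ℍ) : ℂ :=
  ((t * z.im : ℝ) : ℂ) + 6 / (Real.pi : ℂ) *
    ((Real.eulerMascheroniConstant : ℂ) - (Real.log 2 : ℂ) - (Real.log (t * z.im) : ℂ) / 2
      - 6 * deriv riemannZeta 2 / (Real.pi : ℂ) ^ 2
      + hookBracket 2 t z
      + ∑' n : ℕ+, sigma (-1) n * (starRingEnd ℂ) (qParam z) ^ (t * n : ℕ))

/-- `𝔼_{2-2k}(tz)` for `k ≥ 2`, as a function of `k`, `t` and `z`. -/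
def EE (k t : ℕ) (z : ℍ) : ℂ :=
  ((t * z.im : ℝ) : ℂ) ^ (2 * k - 1) +
    2 * ((2 * k).factorial : ℂ) /
        (((bernoulli (2 * k) : ℚ) : ℂ) * (4 * (Real.pi : ℂ)) ^ (2 * k - 1)) *
      (riemannZeta (2 * k - 1) + hookBracket (2 * k) t z
        + ∑' n : ℕ+, sigma (1 - 2 * k) n *
            (incGammaStar (2 * k - 1) (4 * Real.pi * t * n * z.im) : ℂ) *
            qParam z ^ (-(t * n : ℤ)))

/-- The real-analytic Eisenstein series
`E(z, s) = (1/2) ∑_{gcd(c,d) = 1} y^s / |cz + d|^{2s}`, absolutely convergent for `Re s > 1`. -/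
def eisenstein (z : ℍ) (s : ℂ) : ℂ :=
  1 / 2 * ∑' p : {p : ℤ × ℤ // IsCoprime p.1 p.2},
    (z.im : ℂ) ^ s / ((‖(p.1.1 : ℂ) * (z : ℂ) + (p.1.2 : ℂ)‖ : ℝ) : ℂ) ^ (2 * s)

end HookMaass

end

/-! The bracket is a divisor sum series. In the beta-set model of partitions a hook of length k is a
bead that can move down k places, and removing it is a bijection onto pairs of a partition of n - k
and a bead that can move up (`hookCount_eq_sum_addable`). There are always exactly k more beads that
can move up than down (`card_addable`), so the number of k-hooks in all partitions of n is k (p(n-k)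
+ p(n-2k) + ...). Dividing by the generating function of p leaves ∑ σ_{1-m}(n) q^{tn} for
⟨f_{m,t}⟩_q (`hookBracket_eq`). Both functions of the theorem are thereby level one functions
evaluated at tz (`EE_eq`, `EE₀_eq`).

For k ≥ 2 that function is, up to the factor 2ζ(2k), the lattice sum y^(2k-1) ∑ 1/((cz+d)
conj(cz+d)^(2k-1)), which is visibly of weight 2 - 2k (`latticeSum_slash`). Its Fourier expansion
comes from the cotangent and Lipschitz formulas by partial fractions (`rowSum_eq`, `latticeSum_eq`).
It matches because Γ*(2k-1, x) is exp(-x) times a truncated exponential series.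

For weight 0 the lattice sum no longer converges, and the Kronecker limit formula takes its place.
Each row sum of |cz+d|^(-2s) is compared with the integral over the line. The differences sum to a
function analytic near s = 1 (`analyticAt_remainder`), evaluated there by the cotangent formula
(`remainder_one`); the integrals sum to a multiple of ζ(2s-1), which carries the pole. Modularity of
the constant term follows by letting s tend to 1 from the right, since the polar part does not
depend on z (`kroneckerExt_one_smul`).

The passage from z to tz uses conjugation by diag(t, 1) for modularity on Γ₀(t), and a Hermite
normal form for the growth at the other cusps (`exists_scale_smul_eq`). The differential equations
follow from the expansions: ξ_{2-2k} gives a holomorphic function, and ξ_0 gives a holomorphic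
function plus a multiple of 1/y, which ξ_2 sends to a constant. -/

namespace HookMaass

/-! ### Rows and columns of a partition -/

/-- In a nonincreasing list the entries exceeding j form an initial segment, whose length is the
count. -/
lemma lt_countP_iff_lt_getD {l : List ℕ} (hl : l.Pairwise (· ≥ ·)) (i j : ℕ) :
    i < l.countP (fun m => j < m) ↔ j < l.getD i 0 := by
  induction l generalizing i with
  | nil => simp
  | cons a l ih =>
    rw [List.pairwise_cons] at hl
    rw [List.countP_cons]
    by_cases h : j < a
    · cases i with
      | zero => simp [h]
      | succ i => simpa [h] using ih hl.2 i
    · have h0 : l.countP (fun m => j < m) = 0 := by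
        rw [List.countP_eq_zero]
        intro b hb
        have := hl.1 b hb
        simp only [decide_eq_true_eq]
        omega
      have h1 : (a :: l).getD i 0 ≤ a := by
        cases i with
        | zero => simp
        | succ i =>
          by_cases hi : i < l.length
          · simpa [hi] using hl.1 _ (List.getElem_mem hi)
          · simp [List.getD_eq_getElem?_getD, List.getElem?_eq_none (not_lt.mp hi)]
      rw [h0]
      simp only [h, decide_false]
      constructor
      · intro h'; simp at h'
      · intro h'; omega

/-- The zeros of a nonincreasing list stand at its end, where the default value 0 replaces them. -/
lemma getD_filter_pos {l : List ℕ} (hl : l.Pairwise (· ≥ ·)) (i : ℕ) :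
    (l.filter (fun m => 0 < m)).getD i 0 = l.getD i 0 := by
  induction l generalizing i with
  | nil => simp
  | cons a l ih =>
    rw [List.pairwise_cons] at hl
    by_cases h : 0 < a
    · rw [List.filter_cons_of_pos (by simpa using h)]
      cases i with
      | zero => simp
      | succ i => simpa using ih hl.2 i
    · have h0 : a = 0 := by omega
      subst h0
      have hz : ∀ b ∈ l, b = 0 := fun b hb => by have := hl.1 b hb; omega
      rw [List.filter_cons_of_neg (by simp)]
      have : l.filter (fun m => 0 < m) = [] := by
        rw [List.filter_eq_nil_iff]
        intro b hb
        simp [hz b hb]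
      rw [this]
      cases i with
      | zero => simp
      | succ i =>
        by_cases hi : i < l.length
        · simpa [hi] using (hz _ (List.getElem_mem hi)).symm
        · simp [List.getD_eq_getElem?_getD, List.getElem?_eq_none (not_lt.mp hi)]

section Partition

variable {n : ℕ} (p : n.Partition)

lemma pairwise_rows : (rows p).Pairwise (· ≥ ·) :=
  Multiset.pairwise_sort _ _

lemma coe_rows : (rows p : Multiset ℕ) = p.parts :=
  Multiset.sort_eq _ _

lemma length_rows : (rows p).length = p.parts.card :=
  Multiset.length_sort _

/-- Both sides say that (i, j) is a node. This duality takes the place of the conjugate partition in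
all that follows. -/
lemma lt_colLen_iff (i j : ℕ) : i < colLen p j ↔ j < rowLen p i := by
  rw [rowLen, ← lt_countP_iff_lt_getD (pairwise_rows p), colLen, ← coe_rows p,
    Multiset.filter_coe, Multiset.coe_card, List.countP_eq_length_filter]

lemma antitone_rowLen : Antitone (rowLen p) := by
  intro i i' h
  by_contra! h'
  exact absurd (h.trans_lt ((lt_colLen_iff p _ _).2 h')) (by
    rw [lt_colLen_iff]; exact lt_irrefl _)

lemma card_parts_le : p.parts.card ≤ n := by
  conv_rhs => rw [← p.parts_sum]
  simpa using Multiset.card_nsmul_le_sum (s := p.parts) (a := 1) (fun x hx => p.parts_pos hx)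

lemma rowLen_eq_zero {i : ℕ} (hi : p.parts.card ≤ i) : rowLen p i = 0 := by
  rw [rowLen, List.getD_eq_getElem?_getD, List.getElem?_eq_none (by rwa [length_rows])]
  rfl

lemma map_getD_range {l : List ℕ} {N : ℕ} (hN : l.length ≤ N) :
    (List.range N).map (fun i => l.getD i 0) = l ++ List.replicate (N - l.length) 0 := by
  apply List.ext_getElem
  · simp; omega
  · intro i h1 h2
    by_cases hi : i < l.length
    · simp [hi, List.getElem_append_left]
    · rw [List.getElem_append_right (by omega)]
      simp [List.getD_eq_getElem?_getD, List.getElem?_eq_none (not_lt.mp hi)]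

lemma parts_eq_filter {N : ℕ} (hN : p.parts.card ≤ N) :
    p.parts = ((Multiset.range N).map (rowLen p)).filter (fun m => 0 < m) := by
  have h := map_getD_range (l := rows p) (N := N) (by rwa [length_rows])
  rw [← Multiset.coe_range, Multiset.map_coe]
  change _ = Multiset.filter _ (((List.range N).map (fun i => (rows p).getD i 0) : List ℕ) : Multiset ℕ)
  rw [h, Multiset.filter_coe, List.filter_append, ← coe_rows p]
  have h1 : (rows p).filter (fun m => 0 < m) = rows p := by
    rw [List.filter_eq_self]
    intro a ha
    have : a ∈ p.parts := by rw [← coe_rows p]; exact ha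
    simpa using p.parts_pos this
  rw [h1]
  simp

lemma sum_rowLen {N : ℕ} (hN : p.parts.card ≤ N) : ∑ i ∈ Finset.range N, rowLen p i = n := by
  have h := map_getD_range (l := rows p) (N := N) (by rwa [length_rows])
  have h2 : ((List.range N).map (rowLen p)).sum = (rows p).sum := by
    change ((List.range N).map (fun i => (rows p).getD i 0)).sum = _
    rw [h]; simp
  have h3 : (rows p).sum = n := by
    rw [← Multiset.sum_coe, coe_rows, p.parts_sum]
  refine Eq.trans ?_ (h2.trans h3)
  simp [Finset.sum, ← Multiset.coe_range]

/-! ### Beta-sets -/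

/-- The first-column hook lengths of a partition, padded with empty rows to `N` rows. -/
def bead (N i : ℕ) : ℕ := rowLen p i + (N - 1 - i)

/-- The set of beads of a partition with `N` rows, some of which may be empty. -/
def betaSet (N : ℕ) : Finset ℕ := (Finset.range N).image (bead p N)

lemma bead_strictAnti {N i i' : ℕ} (h : i < i') (h' : i' < N) : bead p N i' < bead p N i := by
  have := antitone_rowLen p h.le
  unfold bead
  omega

lemma bead_injOn (N : ℕ) : Set.InjOn (bead p N) (Finset.range N) := by
  intro i hi i' hi' h
  simp only [Finset.coe_range, Set.mem_Iio] at hi hi'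
  rcases lt_trichotomy i i' with h1 | h1 | h1
  · exact absurd h (bead_strictAnti p h1 hi').ne'
  · exact h1
  · exact absurd h (bead_strictAnti p h1 hi).ne

lemma card_betaSet (N : ℕ) : (betaSet p N).card = N := by
  rw [betaSet, Finset.card_image_of_injOn (bead_injOn p N), Finset.card_range]

lemma sum_betaSet_eq {M : Type*} [AddCommMonoid M] (N : ℕ) (g : ℕ → M) :
    ∑ x ∈ betaSet p N, g x = ∑ i ∈ Finset.range N, g (bead p N i) := by
  rw [betaSet, Finset.sum_image (bead_injOn p N)]

lemma sum_betaSet {N : ℕ} (hN : n ≤ N) :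
    ∑ x ∈ betaSet p N, x = n + ∑ i ∈ Finset.range N, i := by
  rw [sum_betaSet_eq]
  simp only [bead]
  rw [Finset.sum_add_distrib, sum_rowLen p ((card_parts_le p).trans hN),
    Finset.sum_range_reflect (fun i => i) N]

/-- Beads decrease with the row, so reading the rows backwards gives the increasing enumeration of
the beta-set, which is unique; the row lengths, and with them the parts, can then be read off. -/
lemma betaSet_injective {N : ℕ} (hN : n ≤ N) :
    Function.Injective (fun p : n.Partition => betaSet p N) := by
  intro p p' h
  have key : ∀ q : n.Partition, (fun i : Fin N => bead q N (N - 1 - i)) =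
      (betaSet q N).orderEmbOfFin (card_betaSet q N) := by
    intro q
    apply Finset.orderEmbOfFin_unique
    · intro i
      exact Finset.mem_image_of_mem _ (by simp; omega)
    · intro i j hij
      exact bead_strictAnti q (by omega) (by omega)
  have h1 : (fun i : Fin N => bead p N (N - 1 - i)) = fun i : Fin N => bead p' N (N - 1 - i) := by
    rw [key p, key p']
    simp only at h
    congr! 2
  have h2 : ∀ i < N, rowLen p i = rowLen p' i := by
    intro i hi
    have := congrFun h1 ⟨N - 1 - i, by omega⟩
    simp only [bead] at this
    rw [show N - 1 - (N - 1 - i) = i by omega] at this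
    omega
  apply Nat.Partition.ext
  rw [parts_eq_filter p ((card_parts_le p).trans hN),
    parts_eq_filter p' ((card_parts_le p').trans hN)]
  congr 1
  apply Multiset.map_congr rfl
  intro i hi
  exact h2 i (by simpa using hi)

/-- If f enumerates X increasingly, then f i ≥ i, and row i must have length f(N-1-i) - (N-1-i).
Strict monotonicity of f makes these lengths nonincreasing, and the condition on the sum makes them
add up to n. -/
lemma exists_betaSet_eq {N : ℕ} (n : ℕ) {X : Finset ℕ} (hX : X.card = N)
    (hs : ∑ x ∈ X, x = n + ∑ i ∈ Finset.range N, i) :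
    ∃ p : n.Partition, betaSet p N = X := by
  classical
  set e := X.orderEmbOfFin hX with he
  let f : ℕ → ℕ := fun i => if h : i < N then e ⟨i, h⟩ else 0
  have hf : ∀ i j, i < j → j < N → f i < f j := by
    intro i j hij hj
    simp only [f, hj, hij.trans hj, dif_pos]
    exact e.strictMono hij
  have hfi : ∀ i < N, i ≤ f i := by
    intro i
    induction i with
    | zero => simp
    | succ i ih =>
      intro hi
      have := ih (by omega)
      have := hf i (i + 1) (by omega) hi
      omega
  have hfX : (Finset.range N).image f = X := by
    apply Finset.eq_of_subset_of_card_le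
    · intro x hx
      obtain ⟨i, hi, rfl⟩ := Finset.mem_image.1 hx
      simp only [Finset.mem_range] at hi
      simp only [f, hi, dif_pos]
      exact Finset.orderEmbOfFin_mem _ _ _
    · rw [Finset.card_image_of_injOn, hX, Finset.card_range]
      intro i hi j hj h
      simp only [Finset.coe_range, Set.mem_Iio] at hi hj
      rcases lt_trichotomy i j with h1 | h1 | h1
      · exact absurd h (hf _ _ h1 hj).ne
      · exact h1
      · exact absurd h (hf _ _ h1 hi).ne'
  let μ : ℕ → ℕ := fun i => f (N - 1 - i) - (N - 1 - i)
  have hμ : ∀ i, i < N → μ i + (N - 1 - i) = f (N - 1 - i) := by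
    intro i hi
    have := hfi (N - 1 - i) (by omega)
    simp only [μ]; omega
  have hμanti : ∀ i j, i < j → j < N → μ j ≤ μ i := by
    intro i j hij hj
    have h1 := hμ i (by omega)
    have h2 := hμ j hj
    have key : ∀ d a, a + d < N → f a + d ≤ f (a + d) := by
      intro d a
      induction d with
      | zero => simp
      | succ d ih =>
        intro h
        have := ih (by omega)
        have := hf (a + d) (a + (d + 1)) (by omega) h
        omega
    have h3 := key (j - i) (N - 1 - j) (by omega)
    rw [show N - 1 - j + (j - i) = N - 1 - i by omega] at h3
    omega
  let l := (List.range N).map μ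
  have hl : l.Pairwise (· ≥ ·) := by
    rw [List.pairwise_map]
    refine List.Pairwise.imp_of_mem (R := (· < ·)) ?_ List.pairwise_lt_range
    intro a b ha hb hab
    exact hμanti a b hab (by simpa using hb)
  have hsum : ∑ i ∈ Finset.range N, μ i = n := by
    have h1 : ∑ x ∈ X, x = ∑ i ∈ Finset.range N, f i := by
      rw [← hfX, Finset.sum_image]
      intro i hi j hj h
      simp only [Finset.coe_range, Set.mem_Iio] at hi hj
      rcases lt_trichotomy i j with h1 | h1 | h1
      · exact absurd h (hf _ _ h1 hj).ne
      · exact h1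
      · exact absurd h (hf _ _ h1 hi).ne'
    have h2 : ∑ i ∈ Finset.range N, (μ i + (N - 1 - i)) = ∑ i ∈ Finset.range N, f i := by
      rw [← Finset.sum_range_reflect f N]
      exact Finset.sum_congr rfl (fun i hi => hμ i (by simpa using hi))
    rw [Finset.sum_add_distrib, Finset.sum_range_reflect (fun i => i) N] at h2
    omega
  let p : n.Partition :=
    { parts := (l.filter (fun m => 0 < m) : Multiset ℕ)
      parts_pos := by
        intro i hi
        have := (List.mem_filter.1 (Multiset.mem_coe.1 hi)).2
        simpa using this
      parts_sum := by
        have h4 : ∀ l : List ℕ, (l.filter (fun m => 0 < m)).sum = l.sum := by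
          intro l
          induction l with
          | nil => simp
          | cons a l ih =>
            by_cases h : 0 < a
            · simp [h, ih]
            · simp [show a = 0 by omega, ih]
        rw [Multiset.sum_coe, h4, ← hsum]
        simp [l, Finset.sum, ← Multiset.coe_range] }
  have hrows : rows p = l.filter (fun m => 0 < m) := by
    refine List.Perm.eq_of_pairwise (le := (· ≥ ·)) (fun a b _ _ h1 h2 => le_antisymm h2 h1)
      (pairwise_rows p)
      (hl.filter _) ?_
    rw [← Multiset.coe_eq_coe, coe_rows]
  have hrow : ∀ i < N, rowLen p i = μ i := by
    intro i hi
    rw [rowLen, hrows, getD_filter_pos hl]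
    simp [l, hi]
  refine ⟨p, ?_⟩
  rw [betaSet, ← hfX]
  ext x
  simp only [Finset.mem_image, Finset.mem_range]
  constructor
  · rintro ⟨i, hi, rfl⟩
    exact ⟨N - 1 - i, by omega, by rw [bead, hrow i hi, hμ i hi]⟩
  · rintro ⟨i, hi, rfl⟩
    refine ⟨N - 1 - i, by omega, ?_⟩
    rw [bead, hrow _ (by omega), hμ _ (by omega), show N - 1 - (N - 1 - i) = i by omega]

/-- The gap in the beta-set corresponding to a column. -/
def gap (N j : ℕ) : ℕ := j + N - colLen p j

lemma colLen_le_card (j : ℕ) : colLen p j ≤ p.parts.card :=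
  Multiset.card_le_card (Multiset.filter_le _ _)

lemma antitone_colLen : Antitone (colLen p) := by
  intro j j' h
  by_contra! h'
  have h1 := (lt_colLen_iff p (colLen p j) j').1 h'
  exact absurd ((lt_colLen_iff p _ _).2 (h.trans_lt h1)) (lt_irrefl _)

/-- By `lt_colLen_iff` no gap coincides with a bead, which gives one inclusion. Equality is a count:
exactly N - 1 - i beads lie below `bead p N i`, which leaves `rowLen p i` free places. The bound on
N keeps the subtraction in `gap` from being truncated. -/
lemma range_sdiff_betaSet {N i : ℕ} (hN : n ≤ N) (hi : i < N) :
    Finset.range (bead p N i) \ betaSet p N = (Finset.range (rowLen p i)).image (gap p N) := by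
  have hc : ∀ j, colLen p j ≤ N := fun j =>
    (colLen_le_card p j).trans ((card_parts_le p).trans hN)
  have hmono : ∀ j j', j < j' → gap p N j < gap p N j' := by
    intro j j' h
    have := antitone_colLen p h.le
    have := hc j
    unfold gap
    omega
  symm
  apply Finset.eq_of_subset_of_card_le
  · intro y hy
    obtain ⟨j, hj, rfl⟩ := Finset.mem_image.1 hy
    simp only [Finset.mem_range] at hj
    have h1 := (lt_colLen_iff p _ _).2 hj
    have h2 := hc j
    simp only [Finset.mem_sdiff, Finset.mem_range, betaSet, Finset.mem_image, not_exists, not_and]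
    refine ⟨by unfold gap bead; omega, fun i' hi' h => ?_⟩
    unfold gap bead at h
    by_cases h3 : i' < colLen p j
    · have := (lt_colLen_iff p _ _).1 h3
      omega
    · have : ¬ j < rowLen p i' := fun h4 => h3 ((lt_colLen_iff p _ _).2 h4)
      omega
  · rw [Finset.card_image_of_injOn, Finset.card_range, Finset.card_sdiff, Finset.card_range]
    · have h1 : betaSet p N ∩ Finset.range (bead p N i) =
          (Finset.Ioo i N).image (bead p N) := by
        ext x
        simp only [betaSet, Finset.mem_inter, Finset.mem_image, Finset.mem_range, Finset.mem_Ioo]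
        constructor
        · rintro ⟨⟨i', hi', rfl⟩, h⟩
          refine ⟨i', ⟨?_, hi'⟩, rfl⟩
          by_contra! h3
          rcases h3.eq_or_lt with rfl | h3
          · exact lt_irrefl _ h
          · exact lt_asymm h (bead_strictAnti p h3 hi)
        · rintro ⟨i', ⟨h1, h2⟩, rfl⟩
          exact ⟨⟨i', h2, rfl⟩, bead_strictAnti p h1 h2⟩
      rw [h1, Finset.card_image_of_injOn, Nat.card_Ioo]
      · unfold bead; omega
      · refine (bead_injOn p N).mono ?_
        intro x hx
        simp only [Finset.coe_Ioo, Set.mem_Ioo] at hx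
        simpa using hx.2
    · intro j _ j' _ h
      rcases lt_trichotomy j j' with h1 | h1 | h1
      · exact absurd h (hmono _ _ h1).ne
      · exact h1
      · exact absurd h (hmono _ _ h1).ne'

/-- The hook numbers of a partition are the differences between beads and smaller gaps. -/
lemma sum_hooks_eq {M : Type*} [AddCommMonoid M] {N : ℕ} (hN : n ≤ N) (g : ℕ → M) :
    ((hooks p).map g).sum =
      ∑ x ∈ betaSet p N, ∑ y ∈ Finset.range x \ betaSet p N, g (x - y) := by
  have hc : ∀ j, colLen p j ≤ N := fun j =>
    (colLen_le_card p j).trans ((card_parts_le p).trans hN)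
  rw [hooks, Multiset.map_map]
  change ∑ c ∈ nodes p, g (hookNumber p c.1 c.2) = _
  rw [nodes, Finset.sum_sigma, sum_betaSet_eq]
  rw [Finset.sum_subset (s₂ := Finset.range N)
    (Finset.range_subset_range.2 ((card_parts_le p).trans hN))]
  · refine Finset.sum_congr rfl (fun i hi => ?_)
    rw [range_sdiff_betaSet p hN (by simpa using hi), Finset.sum_image]
    · refine Finset.sum_congr rfl (fun j hj => ?_)
      have hj' : j < rowLen p i := by simpa using hj
      have h1 := (lt_colLen_iff p _ _).2 hj'
      have := hc j
      congr 1
      simp only [hookNumber, bead, gap]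
      omega
    · intro j _ j' _ h
      have h1 := hc j
      have h2 := hc j'
      simp only [gap] at h
      rcases le_total j j' with h3 | h3 <;>
      · have := antitone_colLen p h3
        omega
  · intro i _ hi
    rw [rowLen_eq_zero p (by simpa using hi)]
    simp

/-- The last k rows are empty, so their beads occupy the lowest k places. This is the padding that
`card_addable` needs. -/
lemma range_subset_betaSet {N k : ℕ} (h : n + k ≤ N) : Finset.range k ⊆ betaSet p N := by
  intro x hx
  simp only [Finset.mem_range] at hx
  refine Finset.mem_image.2 ⟨N - 1 - x, by simp; omega, ?_⟩
  rw [bead, rowLen_eq_zero p ((card_parts_le p).trans (by omega))]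
  omega

end Partition

/-! ### Counting hooks of a given length -/

/-- The beta-sets with `N` beads of the partitions of `n`. -/
def betaSets (N n : ℕ) : Finset (Finset ℕ) :=
  (Finset.univ : Finset n.Partition).image (fun p => betaSet p N)

lemma mem_betaSets {N n : ℕ} (hN : n ≤ N) {X : Finset ℕ} :
    X ∈ betaSets N n ↔ X.card = N ∧ ∑ x ∈ X, x = n + ∑ i ∈ Finset.range N, i := by
  constructor
  · intro h
    obtain ⟨p, -, rfl⟩ := Finset.mem_image.1 h
    exact ⟨card_betaSet p N, sum_betaSet p hN⟩
  · rintro ⟨h1, h2⟩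
    obtain ⟨p, rfl⟩ := exists_betaSet_eq n h1 h2
    exact Finset.mem_image_of_mem _ (Finset.mem_univ _)

lemma sum_betaSets {M : Type*} [AddCommMonoid M] {N n : ℕ} (hN : n ≤ N) (g : Finset ℕ → M) :
    ∑ X ∈ betaSets N n, g X = ∑ p : n.Partition, g (betaSet p N) := by
  rw [betaSets, Finset.sum_image]
  exact fun p _ p' _ h => betaSet_injective hN h

/-- The beads that can be moved down by `k`. -/
def removable (k : ℕ) (X : Finset ℕ) : Finset ℕ := X.filter (fun x => k ≤ x ∧ x - k ∉ X)

/-- The beads that can be moved up by `k`. -/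
def addable (k : ℕ) (X : Finset ℕ) : Finset ℕ := X.filter (fun x => x + k ∉ X)

/-- Pairs of beads at distance k can be counted by their lower or by their upper member. The first
count is the number of beads that cannot move up; the second is the number of beads at places ≥ k
that cannot move down. The beads below k, which cannot move down either, account for the excess k.
-/
lemma card_addable {k : ℕ} {X : Finset ℕ} (h : Finset.range k ⊆ X) :
    (addable k X).card = (removable k X).card + k := by
  have h1 : (addable k X).card + (X.filter (fun x => x + k ∈ X)).card = X.card := by
    rw [addable, add_comm, Finset.card_filter_add_card_filter_not (fun x => x + k ∈ X)]
  have h2 : (removable k X).card + (X.filter (fun x => k ≤ x ∧ x - k ∈ X)).card + k = X.card := by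
    have e1 : Finset.range k = X.filter (fun x => ¬ k ≤ x) := by
      ext x
      simp only [Finset.mem_range, Finset.mem_filter, not_le]
      exact ⟨fun hx => ⟨h (Finset.mem_range.2 hx), hx⟩, fun hx => hx.2⟩
    have e2 := Finset.card_filter_add_card_filter_not (s := X) (fun x => k ≤ x)
    have e3 := Finset.card_filter_add_card_filter_not (s := X.filter (fun x => k ≤ x))
      (fun x => x - k ∈ X)
    rw [Finset.filter_filter, Finset.filter_filter] at e3
    rw [← e1, Finset.card_range] at e2
    rw [removable]
    omega
  have h3 : (X.filter (fun x => x + k ∈ X)).card =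
      (X.filter (fun x => k ≤ x ∧ x - k ∈ X)).card := by
    refine Finset.card_bij (fun x _ => x + k) ?_ ?_ ?_
    · intro x hx
      simp only [Finset.mem_filter] at hx ⊢
      exact ⟨hx.2, by omega, by simpa using hx.1⟩
    · intro x _ y _ hxy
      omega
    · intro x hx
      simp only [Finset.mem_filter] at hx
      exact ⟨x - k, by simp [hx.2.2, Nat.sub_add_cancel hx.2.1, hx.1], Nat.sub_add_cancel hx.2.1⟩
  omega

/-- The number of pairs of a partition of `n` and a hook of length `k` in it. -/
def hookCount (N k n : ℕ) : ℕ := ∑ X ∈ betaSets N n, (removable k X).card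

lemma moveBead_mem {N n m a b : ℕ} (hn : n ≤ N) (hm : m ≤ N) {X : Finset ℕ}
    (hX : X ∈ betaSets N n) (ha : a ∈ X) (hb : b ∉ X) (hab : n + b = m + a) :
    insert b (X.erase a) ∈ betaSets N m := by
  rw [mem_betaSets hn] at hX
  rw [mem_betaSets hm]
  have hb' : b ∉ X.erase a := fun h => hb (Finset.mem_of_mem_erase h)
  constructor
  · rw [Finset.card_insert_of_notMem hb', Finset.card_erase_add_one ha, hX.1]
  · rw [Finset.sum_insert hb']
    have := Finset.add_sum_erase X (fun x => x) ha
    omega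

/-- Moving a bead down by k removes a hook of length k and is undone by moving it back up. -/
lemma hookCount_eq_sum_addable {N k n : ℕ} (hk : 0 < k) (hkn : k ≤ n) (hN : n ≤ N) :
    hookCount N k n = ∑ Y ∈ betaSets N (n - k), (addable k Y).card := by
  rw [hookCount, ← Finset.card_sigma, ← Finset.card_sigma]
  refine Finset.card_bij'
    (fun c _ => ⟨insert (c.2 - k) (c.1.erase c.2), c.2 - k⟩)
    (fun c _ => ⟨insert (c.2 + k) (c.1.erase c.2), c.2 + k⟩) ?_ ?_ ?_ ?_
  · rintro ⟨X, x⟩ h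
    simp only [Finset.mem_sigma, removable, addable, Finset.mem_filter] at h ⊢
    obtain ⟨hX, hx, hkx, hxk⟩ := h
    refine ⟨moveBead_mem hN (by omega) hX hx hxk (by omega), Finset.mem_insert_self _ _, ?_⟩
    rw [Nat.sub_add_cancel hkx]
    simp only [Finset.mem_insert, Finset.mem_erase, not_or]
    exact ⟨by omega, by simp⟩
  · rintro ⟨X, x⟩ h
    simp only [Finset.mem_sigma, removable, addable, Finset.mem_filter] at h ⊢
    obtain ⟨hX, hx, hxk⟩ := h
    refine ⟨moveBead_mem (by omega) hN hX hx hxk (by omega), Finset.mem_insert_self _ _, by omega, ?_⟩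
    rw [Nat.add_sub_cancel]
    simp only [Finset.mem_insert, Finset.mem_erase, not_or]
    exact ⟨by omega, by simp⟩
  · rintro ⟨X, x⟩ h
    simp only [Finset.mem_sigma, removable, Finset.mem_filter] at h
    obtain ⟨hX, hx, hkx, hxk⟩ := h
    simp only [Nat.sub_add_cancel hkx]
    rw [Finset.erase_insert (fun h => hxk (Finset.mem_of_mem_erase h)), Finset.insert_erase hx]
  · rintro ⟨X, x⟩ h
    simp only [Finset.mem_sigma, addable, Finset.mem_filter] at h
    obtain ⟨hX, hx, hxk⟩ := h
    simp only [Nat.add_sub_cancel]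
    rw [Finset.erase_insert (fun h => hxk (Finset.mem_of_mem_erase h)), Finset.insert_erase hx]

/-- On the partitions of n - k, with N ≥ n beads, the k lowest places are filled, so `card_addable`
turns the previous count into a recursion. -/
lemma hookCount_of_le {N k n : ℕ} (hk : 0 < k) (hkn : k ≤ n) (hN : n ≤ N) :
    hookCount N k n = hookCount N k (n - k) + k * Fintype.card (n - k).Partition := by
  rw [hookCount_eq_sum_addable hk hkn hN, sum_betaSets (by omega), hookCount,
    sum_betaSets (by omega)]
  rw [Finset.sum_congr rfl (fun p _ => card_addable (range_subset_betaSet p (by omega))),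
    Finset.sum_add_distrib]
  simp [mul_comm]

lemma sum_range_le_sum_of_card {N : ℕ} {X : Finset ℕ} (hX : X.card = N) :
    ∑ i ∈ Finset.range N, i ≤ ∑ x ∈ X, x := by
  induction N generalizing X with
  | zero => simp
  | succ N ih =>
    have hne : X.Nonempty := Finset.card_pos.1 (by omega)
    have h1 := Finset.card_le_card (fun x hx => Finset.mem_range.2
      (Nat.lt_succ_of_le (Finset.le_max' X x hx)) : X ⊆ Finset.range (X.max' hne + 1))
    rw [hX, Finset.card_range] at h1
    have h2 := ih (X := X.erase (X.max' hne)) (by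
      rw [Finset.card_erase_of_mem (Finset.max'_mem X hne), hX]; rfl)
    have h3 := Finset.add_sum_erase X (fun x => x) (Finset.max'_mem X hne)
    rw [Finset.sum_range_succ]
    omega

/-- Moving a bead down by more than n would produce N distinct natural numbers with a sum below the
minimum 0 + 1 + ... + (N-1). -/
lemma hookCount_of_lt {N k n : ℕ} (hkn : n < k) (hN : n ≤ N) : hookCount N k n = 0 := by
  rw [hookCount, Finset.sum_eq_zero]
  intro X hX
  rw [Finset.card_eq_zero, Finset.eq_empty_iff_forall_notMem]
  intro x hx
  simp only [removable, Finset.mem_filter] at hx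
  obtain ⟨hx, hkx, hxk⟩ := hx
  rw [mem_betaSets hN] at hX
  have hb' : x - k ∉ X.erase x := fun h => hxk (Finset.mem_of_mem_erase h)
  have h1 : (insert (x - k) (X.erase x)).card = N := by
    rw [Finset.card_insert_of_notMem hb', Finset.card_erase_add_one hx, hX.1]
  have h2 := sum_range_le_sum_of_card h1
  rw [Finset.sum_insert hb'] at h2
  have := Finset.add_sum_erase X (fun x => x) hx
  omega

/-- The recursion of `hookCount_of_le` unrolled; the index m runs through the positive multiples of
k. -/
lemma hookCount_eq {N k : ℕ} (hk : 0 < k) : ∀ n ≤ N, hookCount N k n =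
    ∑ m ∈ Finset.range (n + 1),
      if m ≠ 0 ∧ k ∣ m then k * Fintype.card (n - m).Partition else 0 := by
  intro n
  induction n using Nat.strong_induction_on with
  | _ n ih =>
    intro hN
    rcases lt_or_ge n k with h | h
    · rw [hookCount_of_lt h hN, Finset.sum_eq_zero]
      intro m hm
      rw [if_neg]
      rintro ⟨h1, h2⟩
      have := Nat.le_of_dvd (by omega) h2
      simp at hm
      omega
    · rw [hookCount_of_le hk h hN, ih (n - k) (by omega) (by omega)]
      rw [Finset.range_eq_Ico, Finset.range_eq_Ico, ← Finset.sum_Ico_consecutive _ (Nat.zero_le k) (show k ≤ n + 1 by omega)]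
      rw [Finset.sum_eq_zero (s := Finset.Ico 0 k), zero_add,
        Finset.sum_eq_sum_Ico_succ_bot (by omega : k < n + 1), if_pos ⟨by omega, dvd_rfl⟩, add_comm]
      · congr 1
        rw [Finset.sum_eq_sum_Ico_succ_bot (by omega : 0 < n - k + 1), if_neg (by simp), zero_add]
        have : Finset.Ico (k + 1) (n + 1) = Finset.Ico (0 + 1 + k) (n - k + 1 + k) := by
          congr 1 <;> omega
        rw [this, ← Finset.sum_Ico_add' (fun m => if m ≠ 0 ∧ k ∣ m then
          k * Fintype.card (n - m).Partition else 0)]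
        refine Finset.sum_congr rfl (fun m hm => ?_)
        simp only [Finset.mem_Ico] at hm
        rw [show n - (m + k) = n - k - m by omega]
        congr 1
        simp only [ne_eq, Nat.dvd_add_self_right, eq_iff_iff]
        constructor <;> rintro ⟨h1, h2⟩ <;> exact ⟨by omega, h2⟩
      · intro m hm
        simp only [Finset.mem_Ico] at hm
        rw [if_neg]
        rintro ⟨h1, h2⟩
        have := Nat.le_of_dvd (by omega) h2
        omega

/-- The sum over all hooks of all partitions of `n`, in terms of the numbers of partitions. -/
lemma sum_sum_hooks (g : ℕ → ℂ) (n : ℕ) :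
    ∑ p : n.Partition, ((hooks p).map g).sum =
      ∑ m ∈ Finset.range (n + 1), (∑ d ∈ m.divisors, d * g d) * Fintype.card (n - m).Partition := by
  have h1 : ∀ X ∈ betaSets n n,
      ∑ x ∈ X, ∑ y ∈ Finset.range x \ X, g (x - y) =
      ∑ k ∈ Finset.Icc 1 n, (removable k X).card * g k := by
    intro X hX
    -- Hooks are no longer than n, because the total count of longer ones vanishes; so k may be
    -- confined to 1, ..., n.
    have hle : ∀ x ∈ X, ∀ k, k ≤ x → x - k ∉ X → k ≤ n := by
      intro x hx k hk hxk
      by_contra! hlt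
      have h0 := hookCount_of_lt hlt le_rfl (N := n)
      rw [hookCount, Finset.sum_eq_zero_iff] at h0
      have := h0 X hX
      rw [Finset.card_eq_zero] at this
      have h2 : x ∈ removable k X := by simp [removable, hx, hk, hxk]
      rw [this] at h2
      simp at h2
    have h2 : ∀ x ∈ X, ∑ y ∈ Finset.range x \ X, g (x - y) =
        ∑ k ∈ Finset.Icc 1 n, if k ≤ x ∧ x - k ∉ X then g k else 0 := by
      intro x hx
      rw [← Finset.sum_filter]
      refine Finset.sum_bij' (fun y _ => x - y) (fun k _ => x - k) ?_ ?_ ?_ ?_ ?_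
      · intro y hy
        simp only [Finset.mem_sdiff, Finset.mem_range] at hy
        simp only [Finset.mem_filter, Finset.mem_Icc]
        have e : x - (x - y) = y := by omega
        refine ⟨⟨by omega, hle x hx _ (by omega) (by rw [e]; exact hy.2)⟩, by omega,
          by rw [e]; exact hy.2⟩
      · intro k hk
        simp only [Finset.mem_filter, Finset.mem_Icc] at hk
        simp only [Finset.mem_sdiff, Finset.mem_range]
        exact ⟨by omega, hk.2.2⟩
      · intro y hy
        simp only [Finset.mem_sdiff, Finset.mem_range] at hy
        omega
      · intro k hk
        simp only [Finset.mem_filter, Finset.mem_Icc] at hk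
        omega
      · intro y _; rfl
    rw [Finset.sum_congr rfl h2, Finset.sum_comm]
    refine Finset.sum_congr rfl (fun k _ => ?_)
    rw [← Finset.sum_filter, removable, Finset.sum_const, nsmul_eq_mul]
  rw [Finset.sum_congr rfl (fun p _ => sum_hooks_eq p le_rfl g),
    ← sum_betaSets le_rfl (fun X => ∑ x ∈ X, ∑ y ∈ Finset.range x \ X, g (x - y)),
    Finset.sum_congr rfl h1, Finset.sum_comm]
  have h3 : ∀ k ∈ Finset.Icc 1 n, ∑ X ∈ betaSets n n, ((removable k X).card : ℂ) * g k =
      ∑ m ∈ Finset.range (n + 1),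
        if m ≠ 0 ∧ k ∣ m then k * g k * Fintype.card (n - m).Partition else 0 := by
    intro k hk
    rw [← Finset.sum_mul, ← Nat.cast_sum]
    change (hookCount n k n : ℂ) * g k = _
    rw [hookCount_eq (by simp at hk; omega) n le_rfl, Nat.cast_sum, Finset.sum_mul]
    refine Finset.sum_congr rfl (fun m _ => ?_)
    split_ifs
    · push_cast; ring
    · simp
  rw [Finset.sum_congr rfl h3, Finset.sum_comm]
  refine Finset.sum_congr rfl (fun m hm => ?_)
  rw [Finset.sum_mul, ← Finset.sum_filter]
  refine Finset.sum_congr ?_ (fun _ _ => rfl)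
  ext k
  simp only [Finset.mem_filter, Finset.mem_Icc, Nat.mem_divisors]
  simp only [Finset.mem_range] at hm
  constructor
  · rintro ⟨_, h1, h2⟩; exact ⟨h2, h1⟩
  · rintro ⟨h1, h2⟩
    have := Nat.le_of_dvd (by omega) h1
    exact ⟨⟨Nat.pos_of_dvd_of_pos h1 (by omega), by omega⟩, h2, h1⟩

/-- `sum_sum_hooks` is a Cauchy product whose second factor is the generating function of the
partition numbers, so the division by it is exact. -/
lemma qBracket_hooks (g : ℕ → ℂ) (f : (n : ℕ) → n.Partition → ℂ)
    (hf : ∀ n p, f n p = ((hooks p).map g).sum) :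
    qBracket f = PowerSeries.mk (fun m => ∑ d ∈ m.divisors, d * g d) := by
  rw [qBracket, eq_comm, PowerSeries.eq_mul_inv_iff_mul_eq]
  · ext n
    rw [PowerSeries.coeff_mul, Finset.Nat.sum_antidiagonal_eq_sum_range_succ_mk]
    simp only [PowerSeries.coeff_mk, hf, sum_sum_hooks]
    simp
  · rw [← PowerSeries.coeff_zero_eq_constantCoeff_apply, PowerSeries.coeff_mk]
    simp

end HookMaass

/-! ### Divisor sum series and the value of the bracket -/

namespace HookMaass

open Complex

/-! ### Divisor sum series -/

/-- The exponential `e(nw) = exp(2πi n w)`. -/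
noncomputable def expN (n : ℕ) (w : ℂ) : ℂ := cexp (2 * Real.pi * I * (n * w))

lemma norm_expN (n : ℕ) (w : ℂ) : ‖expN n w‖ = Real.exp (-(2 * Real.pi * w.im)) ^ n := by
  rw [expN, norm_exp, ← Real.exp_nat_mul]
  congr 1
  simp
  ring

lemma expN_mul (c r : ℕ) (w : ℂ) : expN (c * r) w = expN r (c * w) := by
  simp only [expN]
  congr 1
  push_cast
  ring

lemma expN_eq_pow (n : ℕ) (w : ℂ) : expN n w = cexp (2 * Real.pi * I * w) ^ n := by
  rw [expN, ← Complex.exp_nat_mul]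
  congr 1
  ring

/-- The series `∑ σ_l(n) n^j e(nw)`. -/
noncomputable def sigmaSeries (l : ℤ) (j : ℕ) (w : ℂ) : ℂ :=
  ∑' n : ℕ, sigma l n * (n : ℂ) ^ j * expN n w

@[simp] lemma sigma_zero_right (l : ℤ) : sigma l 0 = 0 := by simp [sigma]

lemma norm_natCast_zpow_le_one {l : ℤ} (hl : l ≤ 0) (d : ℕ) : ‖(d : ℂ) ^ l‖ ≤ 1 := by
  rw [norm_zpow, norm_natCast]
  rcases Nat.eq_zero_or_pos d with rfl | hd
  · rcases hl.eq_or_lt with rfl | hl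
    · simp
    · rw [Nat.cast_zero, zero_zpow _ hl.ne]; exact zero_le_one
  · exact zpow_le_one_of_nonpos₀ (by exact_mod_cast hd) hl

lemma norm_sigma_le {l : ℤ} (hl : l ≤ 0) (n : ℕ) : ‖sigma l n‖ ≤ n := by
  calc ‖sigma l n‖ ≤ ∑ d ∈ n.divisors, (1 : ℝ) :=
        norm_sum_le_of_le _ (fun d _ => norm_natCast_zpow_le_one hl d)
    _ = n.divisors.card := by simp
    _ ≤ n := by exact_mod_cast Nat.card_divisors_le_self n

lemma exp_neg_two_pi_mul_lt_one {y : ℝ} (hy : 0 < y) : Real.exp (-(2 * Real.pi * y)) < 1 := by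
  rw [Real.exp_lt_one_iff]
  have := Real.pi_pos
  nlinarith [mul_pos this hy]

lemma summable_pow_mul_exp_pow (k : ℕ) {y : ℝ} (hy : 0 < y) :
    Summable fun n : ℕ => (n : ℝ) ^ k * Real.exp (-(2 * Real.pi * y)) ^ n := by
  refine summable_pow_mul_geometric_of_norm_lt_one k ?_
  rw [Real.norm_of_nonneg (Real.exp_pos _).le]
  exact exp_neg_two_pi_mul_lt_one hy

lemma norm_sigmaSeries_term_le {l : ℤ} (hl : l ≤ 0) (j n : ℕ) {y : ℝ} {w : ℂ} (hw : y ≤ w.im) :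
    ‖sigma l n * (n : ℂ) ^ j * expN n w‖ ≤
      (n : ℝ) ^ (j + 1) * Real.exp (-(2 * Real.pi * y)) ^ n := by
  rw [norm_mul, norm_mul, norm_pow, norm_natCast, norm_expN, pow_succ']
  have := Real.pi_pos
  gcongr
  exact norm_sigma_le hl n

lemma summable_sigmaSeries {l : ℤ} (hl : l ≤ 0) (j : ℕ) {w : ℂ} (hw : 0 < w.im) :
    Summable fun n : ℕ => sigma l n * (n : ℂ) ^ j * expN n w :=
  Summable.of_norm_bounded (summable_pow_mul_exp_pow (j + 1) hw)
    (fun n => norm_sigmaSeries_term_le hl j n le_rfl)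

lemma exists_norm_sigmaSeries_le {l : ℤ} (hl : l ≤ 0) (j : ℕ) :
    ∃ C : ℝ, ∀ w : ℂ, 1 ≤ w.im → ‖sigmaSeries l j w‖ ≤ C :=
  ⟨_, fun _ hw => tsum_of_norm_bounded (summable_pow_mul_exp_pow (j + 1) one_pos).hasSum
    (fun n => norm_sigmaSeries_term_le hl j n hw)⟩

lemma hasDerivAt_expN (n : ℕ) (w : ℂ) :
    HasDerivAt (expN n) (2 * Real.pi * I * n * expN n w) w := by
  have h1 : HasDerivAt (fun w : ℂ => 2 * Real.pi * I * (n * w)) (2 * Real.pi * I * (n * 1)) w :=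
    ((hasDerivAt_id w).const_mul (n : ℂ)).const_mul _
  exact h1.cexp.congr_deriv (by simp only [expN]; ring)

/-- Termwise differentiation on the half-plane above Im w / 2, where the derived series has a
convergent majorant independent of the point. -/
lemma hasDerivAt_sigmaSeries {l : ℤ} (hl : l ≤ 0) (j : ℕ) {w : ℂ} (hw : 0 < w.im) :
    HasDerivAt (sigmaSeries l j) (2 * Real.pi * I * sigmaSeries l (j + 1) w) w := by
  have hy : 0 < w.im / 2 := by positivity
  have hopen : IsOpen {z : ℂ | w.im / 2 < z.im} := isOpen_lt continuous_const continuous_im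
  have hconv : Convex ℝ {z : ℂ | w.im / 2 < z.im} := convex_halfSpace_im_gt _
  have h := hasDerivAt_tsum_of_isPreconnected
    (g := fun (n : ℕ) z => sigma l n * (n : ℂ) ^ j * expN n z)
    (g' := fun (n : ℕ) z => sigma l n * (n : ℂ) ^ j * (2 * Real.pi * I * n * expN n z))
    ((summable_pow_mul_exp_pow (j + 2) hy).mul_left (2 * Real.pi)) hopen
    hconv.isPreconnected
    (fun n z _ => (hasDerivAt_expN n z).const_mul _)
    (fun n z hz => ?_) (y₀ := w) (by simp only [Set.mem_ofPred_eq]; linarith)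
    (summable_sigmaSeries hl j hw)
    (y := w) (by simp only [Set.mem_ofPred_eq]; linarith)
  · convert! h using 1
    rw [sigmaSeries, ← tsum_mul_left]
    exact tsum_congr (fun n => by ring)
  · have h1 := norm_sigmaSeries_term_le hl (j + 1) n (le_of_lt hz)
    calc _ = ‖(2 * Real.pi * I : ℂ)‖ * ‖sigma l n * (n : ℂ) ^ (j + 1) * expN n z‖ := by
          rw [← norm_mul]; congr 1; ring
      _ = 2 * Real.pi * ‖sigma l n * (n : ℂ) ^ (j + 1) * expN n z‖ := by
          congr 1; simp [abs_of_pos Real.pi_pos]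
      _ ≤ _ := by gcongr

/-- The Lambert series form of `sigmaSeries`. -/
lemma hasSum_lambert {l : ℤ} (hl : l ≤ 0) (j : ℕ) {w : ℂ} (hw : 0 < w.im) :
    HasSum (fun x : ℕ+ × ℕ+ => ((x.1 : ℕ) : ℂ) ^ l * (((x.1 * x.2 : ℕ+) : ℕ) : ℂ) ^ j *
      expN (x.1 * x.2 : ℕ+) w) (sigmaSeries l j w) := by
  rw [← sigmaAntidiagonalEquivProd.hasSum_iff]
  have hterm : ∀ x : (Σ n : ℕ+, Nat.divisorsAntidiagonal n),
      ((fun x : ℕ+ × ℕ+ => ((x.1 : ℕ) : ℂ) ^ l * (((x.1 * x.2 : ℕ+) : ℕ) : ℂ) ^ j *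
      expN (x.1 * x.2 : ℕ+) w) ∘ sigmaAntidiagonalEquivProd) x =
      ((x.2 : ℕ × ℕ).1 : ℂ) ^ l * ((x.1 : ℕ) : ℂ) ^ j * expN x.1 w := by
    rintro ⟨n, ⟨⟨a, b⟩, hab⟩⟩
    have hab' := Nat.mem_divisorsAntidiagonal.1 hab
    simp [sigmaAntidiagonalEquivProd, divisorsAntidiagonalFactors, PNat.mul_coe, ← hab'.1]
  have hfib : ∀ (f : ℕ → ℂ) (n : ℕ+), ∑ x : Nat.divisorsAntidiagonal n,
      f (x : ℕ × ℕ).1 = ∑ d ∈ (n : ℕ).divisors, f d := by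
    intro f n
    rw [Finset.univ_eq_attach,
      (n : ℕ).divisorsAntidiagonal.sum_attach (fun x : ℕ × ℕ => f x.1),
      Nat.sum_divisorsAntidiagonal (fun x _ => f x)]
  have hS : HasSum (fun n : ℕ+ => sigma l n * ((n : ℕ) : ℂ) ^ j * expN n w)
      (sigmaSeries l j w) := by
    have := (summable_sigmaSeries hl j hw).hasSum
    rw [← PNat.coe_injective.hasSum_iff] at this
    · exact this
    · intro n hn
      have : n = 0 := by
        by_contra h
        exact hn ⟨⟨n, Nat.pos_of_ne_zero h⟩, rfl⟩
      simp [this]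
  have hsum : Summable ((fun x : ℕ+ × ℕ+ => ((x.1 : ℕ) : ℂ) ^ l *
      (((x.1 * x.2 : ℕ+) : ℕ) : ℂ) ^ j * expN (x.1 * x.2 : ℕ+) w) ∘ sigmaAntidiagonalEquivProd) := by
    apply Summable.of_norm
    rw [summable_sigma_of_nonneg (fun _ => norm_nonneg _)]
    -- The fibre over n has as many terms as n has divisors, hence at most n, each of norm at most
    -- n^j exp(-2πny).
    refine ⟨fun n => (hasSum_fintype _).summable, ?_⟩
    refine Summable.of_nonneg_of_le (fun n => tsum_nonneg (fun _ => norm_nonneg _)) (fun n => ?_)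
      ((summable_pow_mul_exp_pow (j + 1) hw).comp_injective PNat.coe_injective)
    rw [tsum_fintype]
    calc _ ≤ ∑ x : Nat.divisorsAntidiagonal (n : ℕ),
          ((n : ℕ) : ℝ) ^ j * Real.exp (-(2 * Real.pi * w.im)) ^ (n : ℕ) := by
          refine Finset.sum_le_sum (fun x _ => ?_)
          rw [hterm, norm_mul, norm_mul, norm_pow, norm_natCast, norm_expN]
          have h1 := norm_natCast_zpow_le_one hl (x : ℕ × ℕ).1
          have h2 : (0 : ℝ) ≤ ((n : ℕ) : ℝ) ^ j := by positivity
          calc _ ≤ 1 * ((n : ℕ) : ℝ) ^ j * Real.exp (-(2 * Real.pi * w.im)) ^ (n : ℕ) := by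
                gcongr
            _ = _ := by rw [one_mul]
      _ ≤ _ := by
          rw [Finset.sum_const, nsmul_eq_mul, Finset.card_univ, Fintype.card_coe]
          have h3 : (((n : ℕ).divisorsAntidiagonal.card : ℕ) : ℝ) ≤ (n : ℕ) := by
            rw [← Nat.map_div_right_divisors, Finset.card_map]
            exact_mod_cast Nat.card_divisors_le_self n
          simp only [Function.comp_apply, pow_succ', mul_assoc]
          gcongr
  have h2 := hsum.hasSum.sigma (fun n => hasSum_fintype _)
  have h3 : ∀ n : ℕ+, ∑ c : Nat.divisorsAntidiagonal (n : ℕ),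
      ((fun x : ℕ+ × ℕ+ => ((x.1 : ℕ) : ℂ) ^ l *
      (((x.1 * x.2 : ℕ+) : ℕ) : ℂ) ^ j * expN (x.1 * x.2 : ℕ+) w) ∘
        sigmaAntidiagonalEquivProd) ⟨n, c⟩ = sigma l n * ((n : ℕ) : ℂ) ^ j * expN n w := by
    intro n
    rw [Finset.sum_congr rfl (fun c _ => hterm ⟨n, c⟩)]
    simp only [mul_assoc]
    rw [hfib (fun d => (d : ℂ) ^ l * (((n : ℕ) : ℂ) ^ j * expN n w)), ← Finset.sum_mul, sigma]
  simp only [h3] at h2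
  rw [hS.unique h2]
  exact hsum.hasSum

/-! ### The bracket of the hook function -/

lemma hookWeight_eq (a : ℂ) (t n : ℕ) (p : n.Partition) :
    hookWeight a t n p = ((hooks p).map
      (fun h => if t ∣ h then (t : ℂ) ^ (a - 1) * (1 / (h : ℂ) ^ a) else 0)).sum := by
  -- In `hookWeight` the multiset itself is cast from ℕ to ℂ, and this cast elaborates to a monadic
  -- bind; it is the image under the coercion.
  have h0 : (tHooks t p >>= fun h => pure (h : ℂ)) = (tHooks t p).map (fun h : ℕ => (h : ℂ)) := by
    simp only [Multiset.bind_def, Multiset.pure_def]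
    exact Multiset.bind_singleton _ _
  rw [hookWeight, h0, Multiset.map_map, tHooks, ← Multiset.sum_map_mul_left]
  simp only [Function.comp_apply]
  induction hooks p using Multiset.induction_on with
  | empty => simp
  | cons b s ih =>
    by_cases h : t ∣ b
    · simp only [Multiset.filter_cons_of_pos _ h, Multiset.map_cons, Multiset.sum_cons, h, if_true,
        ← ih]
    · simp only [Multiset.filter_cons_of_neg _ h, Multiset.map_cons, Multiset.sum_cons, h, if_false,
        ← ih, zero_add]

/-- The divisors of te that are multiples of t are the td with d ∣ e, and td · t^(m-1) · (td)^(-m) =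
d^(1-m). -/
lemma sum_divisors_hookWeight {t : ℕ} (ht : 0 < t) (m n : ℕ) :
    ∑ d ∈ n.divisors, (d : ℂ) * (if t ∣ d then (t : ℂ) ^ ((m : ℂ) - 1) * (1 / (d : ℂ) ^ (m : ℂ))
      else 0) = if t ∣ n then sigma (1 - m) (n / t) else 0 := by
  have ht' : (t : ℂ) ≠ 0 := by exact_mod_cast ht.ne'
  split_ifs with h
  · obtain ⟨e, rfl⟩ := h
    rw [Nat.mul_div_cancel_left _ ht, sigma]
    rcases Nat.eq_zero_or_pos e with rfl | he
    · simp
    simp only [mul_ite, mul_zero]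
    rw [← Finset.sum_filter]
    symm
    refine Finset.sum_bij (fun d _ => t * d) ?_ ?_ ?_ ?_
    · intro d hd
      simp only [Finset.mem_filter, Nat.mem_divisors] at hd ⊢
      exact ⟨⟨Nat.mul_dvd_mul_left t hd.1, by positivity⟩, dvd_mul_right _ _⟩
    · intro a _ b _ hab
      exact Nat.eq_of_mul_eq_mul_left ht hab
    · intro b hb
      simp only [Finset.mem_filter, Nat.mem_divisors] at hb
      obtain ⟨⟨h1, h2⟩, c, rfl⟩ := hb
      exact ⟨c, by
        rw [Nat.mem_divisors]; exact ⟨Nat.dvd_of_mul_dvd_mul_left ht h1, he.ne'⟩, rfl⟩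
    · intro d hd
      have hd0 : (d : ℂ) ≠ 0 := by
        exact_mod_cast (Nat.pos_of_mem_divisors hd).ne'
      rw [cpow_sub _ _ ht', cpow_natCast, cpow_natCast, cpow_one, zpow_sub₀ hd0, zpow_one,
        zpow_natCast]
      push_cast
      rw [mul_pow]
      field_simp
  · refine Finset.sum_eq_zero (fun d hd => ?_)
    rw [if_neg, mul_zero]
    exact fun h' => h (h'.trans (Nat.dvd_of_mem_divisors hd))

/-- The bracket of `f_{m,t}` is a divisor sum series. -/
lemma hookBracket_eq {t : ℕ} (ht : 0 < t) (m : ℕ) (z : ℍ) :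
    hookBracket m t z = sigmaSeries (1 - m) 0 (t * z) := by
  rw [hookBracket, qBracket_hooks _ _ (fun n p => hookWeight_eq m t n p)]
  simp only [PowerSeries.coeff_mk, sum_divisors_hookWeight ht]
  have hinj : Function.Injective (fun n : ℕ => t * n) :=
    fun a b h => Nat.eq_of_mul_eq_mul_left ht h
  rw [← hinj.tsum_eq]
  · refine tsum_congr (fun n => ?_)
    simp only [dvd_mul_right, if_true, Nat.mul_div_cancel_left _ ht, pow_zero, mul_one]
    rw [← expN_mul, expN_eq_pow, qParam]
  · intro n hn
    by_cases h : t ∣ n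
    · obtain ⟨e, rfl⟩ := h
      exact ⟨e, rfl⟩
    · simp [h] at hn

end HookMaass

/-! ### Lattice sums of negative weight and their Fourier expansion -/

namespace HookMaass

open Complex
open scoped ComplexConjugate

/-! ### Sums over translates -/

lemma add_intCast_ne_zero {w : ℂ} (hw : 0 < w.im) (d : ℤ) : w + d ≠ 0 := by
  intro h
  have := congrArg im h
  simp at this
  exact hw.ne' this

lemma summable_norm_add_int_pow (w : ℂ) {k : ℕ} (hk : 2 ≤ k) :
    Summable fun d : ℤ => (‖w + d‖ ^ k)⁻¹ := by
  have := (EisensteinSeries.linear_right_summable w 1 (k := k) (by exact_mod_cast hk)).norm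
  simpa using this

lemma summable_rowSum (w : ℂ) {n : ℕ} (hn : 1 ≤ n) :
    Summable fun d : ℤ => 1 / ((w + d) * conj (w + d) ^ n) := by
  refine Summable.of_norm ((summable_norm_add_int_pow w (k := n + 1) (by omega)).congr ?_)
  intro d
  rw [norm_div, norm_one, norm_mul, norm_pow, norm_conj, pow_succ', one_div]

/-- The series `∑ r^j e(rw)` over positive integers `r`. -/
noncomputable def expSeries (j : ℕ) (w : ℂ) : ℂ := ∑' r : ℕ+, ((r : ℕ) : ℂ) ^ j * expN r w

/-- The Lambert series grouped by n = cr with c fixed: this is the shape in which the rows cz + d of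
a lattice sum contribute. -/
lemma hasSum_expSeries {l : ℤ} (hl : l ≤ 0) (j : ℕ) {w : ℂ} (hw : 0 < w.im) :
    HasSum (fun c : ℕ+ => ((c : ℕ) : ℂ) ^ l * ((c : ℕ) : ℂ) ^ j * expSeries j ((c : ℕ) * w))
      (sigmaSeries l j w) := by
  have h := hasSum_lambert hl j hw
  convert! h.prod_fiberwise (fun c => (h.summable.prod_factor c).hasSum) using 2 with c
  rw [expSeries, ← tsum_mul_left]
  refine tsum_congr (fun r => ?_)
  rw [PNat.mul_coe, expN_mul]
  push_cast
  ring

lemma tsum_geometric_eq_one_add {ξ : ℂ} (hξ : ‖ξ‖ < 1) :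
    ∑' n : ℕ, ξ ^ n = 1 + ∑' n : ℕ+, ξ ^ (n : ℕ) := by
  have h : Summable fun n : ℕ => ξ ^ n := summable_geometric_of_norm_lt_one hξ
  rw [← tsum_zero_pnat_eq_tsum_nat h, pow_zero]

/-- Partial fractions turn 1/|w+d|² into a difference of 1/(conj w + d) and 1/(w + d), so the sum is
a difference of two cotangents. Separately these series converge only when d and -d are paired,
hence the passage through sums over positive integers. -/
lemma cot_sum {w : ℂ} (hw : 0 < w.im) :
    ∑' d : ℤ, 1 / ((w + d) * conj (w + d) ^ 1) =
      2 * Real.pi * I / (2 * I * w.im) * (1 + expSeries 0 w + conj (expSeries 0 w)) := by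
  have hy : (w.im : ℂ) ≠ 0 := by exact_mod_cast hw.ne'
  have hww : w - conj w = 2 * I * w.im := by
    rw [sub_conj]; push_cast; ring
  have hconj0 : ∀ d : ℤ, conj w + d ≠ 0 := fun d h => add_intCast_ne_zero hw d (by
    have := congrArg conj h; simpa using this)
  have hterm : ∀ d : ℤ, 1 / ((w + d) * conj (w + d) ^ 1) =
      (1 / (2 * I * w.im)) * (1 / (conj w + d) - 1 / (w + d)) := by
    intro d
    have h1 := add_intCast_ne_zero hw d
    have h2 := hconj0 d
    rw [← hww] 
    have h3 : w - conj w ≠ 0 := by rw [hww]; simp [hy]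
    simp only [map_add, map_intCast, pow_one]
    field_simp
    ring
  have hs : Summable fun d : ℤ => (1 / (conj w + d) - 1 / (w + d)) := by
    have := (summable_rowSum w le_rfl).mul_left (2 * I * w.im)
    refine this.congr (fun d => ?_)
    rw [hterm]
    field_simp
  have hmem : w ∈ Complex.integerComplement :=
    UpperHalfPlane.coe_mem_integerComplement (⟨w, hw⟩ : ℍ)
  have hcot := cot_series_rep hmem
  have hq := pi_mul_cot_pi_q_exp ⟨w, hw⟩
  have hlt : ‖cexp (2 * Real.pi * I * w)‖ < 1 :=
    UpperHalfPlane.norm_exp_two_pi_I_lt_one (⟨w, hw⟩ : ℍ)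
  have hgeom : ∑' n : ℕ, cexp (2 * Real.pi * I * w) ^ n = 1 + expSeries 0 w := by
    rw [tsum_geometric_eq_one_add hlt, expSeries]
    simp only [expN_eq_pow, pow_zero, one_mul]
  have hcs : Summable fun n : ℕ+ => (1 / (w - (n : ℕ)) + 1 / (w + (n : ℕ))) := by
    have h := summable_cotTerm hmem
    rw [← Equiv.pnatEquivNat.summable_iff] at h
    refine h.congr (fun n => ?_)
    simp only [Function.comp_apply, cotTerm, Equiv.pnatEquivNat_apply]
    have : ((n.natPred : ℕ) : ℂ) + 1 = ((n : ℕ) : ℂ) := by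
      exact_mod_cast n.natPred_add_one
    rw [this]
  have hcs' : Summable fun n : ℕ+ => (1 / (conj w - (n : ℕ)) + 1 / (conj w + (n : ℕ))) := by
    have := (hcs.hasSum.map (starRingEnd ℂ) continuous_conj).summable
    refine this.congr (fun n => ?_)
    simp
  have hcot' := congrArg conj hcot
  have e1 : conj (∑' n : ℕ+, (1 / (w - (n : ℕ)) + 1 / (w + (n : ℕ)))) =
      ∑' n : ℕ+, (1 / (conj w - (n : ℕ)) + 1 / (conj w + (n : ℕ))) := by
    rw [conj_tsum]
    exact tsum_congr (fun n => by simp)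
  rw [map_add, e1] at hcot'
  have hdiff : ∑' d : ℤ, (1 / (conj w + d) - 1 / (w + d)) =
      conj (Real.pi * cot (Real.pi * w)) - Real.pi * cot (Real.pi * w) := by
    rw [tsum_int_eq_zero_add_tsum_pnat hs, hcot', hcot, add_assoc, ← Summable.tsum_add]
    · rw [show ∀ a b c d : ℂ, a + b - (c + d) = (a - c) + (b - d) by intros; ring,
        ← Summable.tsum_sub hcs' hcs]
      congr 1
      · simp
      · refine tsum_congr (fun n => ?_)
        push_cast
        ring
    · exact (hs.comp_injective (Nat.cast_injective (R := ℤ))).comp_injective PNat.coe_injective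
    · exact (hs.comp_injective (neg_injective.comp (Nat.cast_injective (R := ℤ)))).comp_injective
        PNat.coe_injective
  rw [tsum_congr hterm, tsum_mul_left, hdiff]
  have hq' : (Real.pi : ℂ) * cot (Real.pi * w) =
      Real.pi * I - 2 * Real.pi * I * (1 + expSeries 0 w) := by
    rw [← hgeom]; exact hq
  rw [hq']
  simp only [map_sub, map_mul, map_add, conj_I, conj_ofReal, map_one, map_ofNat]
  field_simp
  ring

lemma lipschitz_sum {w : ℂ} (hw : 0 < w.im) {k : ℕ} (hk : 1 ≤ k) :
    ∑' d : ℤ, 1 / (w + d) ^ (k + 1) =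
      (-2 * Real.pi * I) ^ (k + 1) / k.factorial * expSeries k w := by
  have h := EisensteinSeries.qExpansion_identity_pnat hk ⟨w, hw⟩
  simp only at h
  rw [h, expSeries]
  simp only [expN_eq_pow]

/-- Induction on m by partial fractions: with a = w + d, the difference a - conj a = 2i Im w does
not depend on d, and 1/(a conj(a)^(m+2)) is (a - conj a)⁻¹ times 1/conj(a)^(m+2) - 1/(a
conj(a)^(m+1)). The first term sums to a conjugated Lipschitz formula, which supplies the new
summand i = m + 1. -/
lemma rowSum_eq {w : ℂ} (hw : 0 < w.im) (m : ℕ) :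
    ∑' d : ℤ, 1 / ((w + d) * conj (w + d) ^ (m + 1)) =
      2 * Real.pi * I * (-1) ^ m / (2 * I * w.im) ^ (m + 1) * (1 + expSeries 0 w +
        ∑ i ∈ Finset.range (m + 1),
          (4 * Real.pi * w.im) ^ i / i.factorial * conj (expSeries i w)) := by
  have hy : (w.im : ℂ) ≠ 0 := by exact_mod_cast hw.ne'
  have hww : w - conj w = 2 * I * w.im := by
    rw [sub_conj]; push_cast; ring
  induction m with
  | zero =>
    rw [cot_sum hw]
    simp
  | succ m ih =>
    have hterm : ∀ d : ℤ, 1 / ((w + d) * conj (w + d) ^ (m + 1 + 1)) =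
        (1 / (2 * I * w.im)) * (conj (1 / (w + d) ^ (m + 1 + 1)) -
          1 / ((w + d) * conj (w + d) ^ (m + 1))) := by
      intro d
      have h1 := add_intCast_ne_zero hw d
      have h2 : conj (w + d) ≠ 0 := (map_ne_zero _).2 h1
      have h4 : w - conj w = (w + d) - conj (w + d) := by simp
      have h3 : (w + d) - conj (w + d) ≠ 0 := by rw [← h4, hww]; simp [hy]
      rw [← hww, h4, map_div₀, map_pow, map_one]
      field_simp
      ring
    have hs1 : Summable fun d : ℤ => conj (1 / (w + d) ^ (m + 1 + 1)) := by
      refine Summable.of_norm ((summable_norm_add_int_pow w (k := m + 2) (by omega)).congr ?_)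
      intro d
      rw [norm_conj, norm_div, norm_one, norm_pow, one_div]
    rw [tsum_congr hterm, tsum_mul_left, Summable.tsum_sub hs1 (summable_rowSum w (by omega)), ih,
      ← conj_tsum, lipschitz_sum hw (by omega), Finset.sum_range_succ _ (m + 1)]
    simp only [map_mul, map_div₀, map_pow, map_neg, conj_ofReal, conj_I, map_ofNat, map_natCast]
    have hfac : ((m + 1).factorial : ℂ) ≠ 0 := by exact_mod_cast (m + 1).factorial_ne_zero
    set A := ∑ i ∈ Finset.range (m + 1),
          (4 * (Real.pi : ℂ) * w.im) ^ i / i.factorial * conj (expSeries i w)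
    have key : (-2 * (Real.pi : ℂ) * -I) ^ (m + 1 + 1) =
        2 * Real.pi * I * (-1) ^ (m + 1) * (4 * Real.pi * w.im) ^ (m + 1) /
          (2 * I * w.im) ^ (m + 1) := by
      rw [eq_div_iff (by simp [hy]), pow_succ _ (m + 1)]
      have : (4 * (Real.pi : ℂ) * w.im) = -1 * ((-2 * (Real.pi : ℂ) * -I) * (2 * I * w.im)) := by
        linear_combination (4 * Real.pi * w.im : ℂ) * I_mul_I
      rw [this, mul_pow (-1 : ℂ), mul_pow (-2 * (Real.pi : ℂ) * -I)]
      have e : ((-1 : ℂ) ^ (m + 1)) * (-1) ^ (m + 1) = 1 := by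
        rw [← mul_pow]; norm_num
      linear_combination (-(2 * (Real.pi : ℂ) * I) * (-2 * (Real.pi : ℂ) * -I) ^ (m + 1) *
        (2 * I * w.im) ^ (m + 1)) * e
    rw [key]
    field_simp
    ring

/-! ### Lattice sums -/

/-- The linear form `cz + d`. -/
def lin (p : ℤ × ℤ) (z : ℂ) : ℂ := p.1 * z + p.2

lemma lin_neg (p : ℤ × ℤ) (z : ℂ) : lin (-p) z = -lin p z := by simp [lin]; ring

lemma summable_norm_lin_rpow (z : ℍ) {σ : ℝ} (hσ : 2 < σ) :
    Summable fun p : ℤ × ℤ => ‖lin p z‖ ^ (-σ) := by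
  rw [← (finTwoArrowEquiv ℤ).summable_iff]
  refine Summable.of_nonneg_of_le (fun _ => Real.rpow_nonneg (norm_nonneg _) _) (fun x => ?_)
    ((EisensteinSeries.summable_one_div_norm_rpow hσ).mul_left (EisensteinSeries.r z ^ (-σ)))
  exact EisensteinSeries.summand_bound z (by linarith) x

/-- The right action of `SL₂(ℤ)` on row vectors. -/
def rowEquiv (γ : SL(2, ℤ)) : ℤ × ℤ ≃ ℤ × ℤ where
  toFun p := (p.1 * γ 0 0 + p.2 * γ 1 0, p.1 * γ 0 1 + p.2 * γ 1 1)
  invFun p := (p.1 * γ 1 1 - p.2 * γ 1 0, -p.1 * γ 0 1 + p.2 * γ 0 0)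
  left_inv p := by
    have h := γ.det_coe
    rw [Matrix.det_fin_two] at h
    ext
    · simp only; linear_combination p.1 * h
    · simp only; linear_combination p.2 * h
  right_inv p := by
    have h := γ.det_coe
    rw [Matrix.det_fin_two] at h
    ext
    · simp only; linear_combination p.1 * h
    · simp only; linear_combination p.2 * h

lemma lin_smul (γ : SL(2, ℤ)) (p : ℤ × ℤ) (z : ℍ) :
    lin p (γ • z : ℍ) = lin (rowEquiv γ p) z / UpperHalfPlane.denom γ z := by
  have h0 : UpperHalfPlane.denom γ z ≠ 0 := UpperHalfPlane.denom_ne_zero _ _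
  rw [eq_div_iff h0]
  rw [ModularGroup.denom_apply] at h0 ⊢
  have h1 : ((γ • z : ℍ) : ℂ) = ((γ 0 0 : ℂ) * z + γ 0 1) / ((γ 1 0 : ℂ) * z + γ 1 1) := by
    rw [UpperHalfPlane.coe_specialLinearGroup_apply]; simp
  rw [h1]
  simp only [lin, rowEquiv, Equiv.coe_fn_mk]
  push_cast
  rw [add_mul, mul_assoc, div_mul_cancel₀ _ h0]
  ring

/-- The lattice sum `∑ 1 / ((cz + d) conj(cz + d)^n)`. -/
noncomputable def latticeSum (n : ℕ) (z : ℍ) : ℂ :=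
  ∑' p : ℤ × ℤ, 1 / (lin p z * conj (lin p z) ^ n)

lemma summable_latticeSum (z : ℍ) {n : ℕ} (hn : 2 ≤ n) :
    Summable fun p : ℤ × ℤ => 1 / (lin p z * conj (lin p z) ^ n) := by
  refine Summable.of_norm ((summable_norm_lin_rpow z (σ := n + 1) ?_).congr (fun p => ?_))
  · have : (2 : ℝ) ≤ n := by exact_mod_cast hn
    linarith
  · rw [norm_div, norm_one, norm_mul, norm_pow, norm_conj, ← pow_succ', one_div,
      Real.rpow_neg (norm_nonneg _)]
    congr 1
    exact_mod_cast Real.rpow_natCast ‖lin p z‖ (n + 1)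

lemma latticeSum_smul (n : ℕ) (γ : SL(2, ℤ)) (z : ℍ) :
    latticeSum n (γ • z) =
      UpperHalfPlane.denom γ z * conj (UpperHalfPlane.denom γ z) ^ n * latticeSum n z := by
  have h0 : UpperHalfPlane.denom γ z ≠ 0 := UpperHalfPlane.denom_ne_zero _ _
  rw [latticeSum, latticeSum, ← (rowEquiv γ).tsum_eq (fun p : ℤ × ℤ => 1 / (lin p z * _)),
    ← tsum_mul_left]
  refine tsum_congr (fun p => ?_)
  rw [lin_smul, map_div₀]
  have h1 : conj (UpperHalfPlane.denom γ z) ≠ 0 := (map_ne_zero _).2 h0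
  generalize lin (rowEquiv γ p) z = a
  rw [div_pow, div_mul_div_comm, one_div_div]
  ring

/-- With j = cz + d and n = 2k - 1, the factors j conj(j)^n of the sum and (j conj j)^(-n) of the
power of y combine to j^(1-n) = j^(2-2k). -/
lemma latticeSum_slash (k : ℕ) (hk : 1 ≤ k) (γ : SL(2, ℤ)) :
    (fun z : ℍ => (z.im : ℂ) ^ (2 * k - 1) * latticeSum (2 * k - 1) z) ∣[2 - 2 * (k : ℤ)] γ =
      fun z : ℍ => (z.im : ℂ) ^ (2 * k - 1) * latticeSum (2 * k - 1) z := by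
  ext z
  rw [ModularForm.SL_slash_apply, latticeSum_smul, ModularGroup.im_smul_eq_div_normSq]
  have h0 : UpperHalfPlane.denom γ z ≠ 0 := UpperHalfPlane.denom_ne_zero _ _
  set j := UpperHalfPlane.denom γ z
  have h1 : conj j ≠ 0 := (map_ne_zero _).2 h0
  rw [ofReal_div, ← mul_conj, div_pow, mul_pow]
  have h2 : j ^ (-(2 - 2 * (k : ℤ))) * j = j ^ (2 * k - 1) := by
    rw [← zpow_add_one₀ h0, ← zpow_natCast]
    congr 1
    omega
  field_simp
  linear_combination ((z.im : ℂ) ^ (2 * k - 1) * latticeSum (2 * k - 1) z) * h2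

/-- The Fourier expansion of the lattice sum. -/
lemma latticeSum_eq (k : ℕ) (hk : 2 ≤ k) (z : ℍ) :
    (z.im : ℂ) ^ (2 * k - 1) * latticeSum (2 * k - 1) z =
      2 * riemannZeta (2 * k) * (z.im : ℂ) ^ (2 * k - 1) +
      4 * Real.pi * I / (2 * I) ^ (2 * k - 1) * (riemannZeta (2 * k - 1) +
        sigmaSeries (1 - 2 * k) 0 z + ∑ i ∈ Finset.range (2 * k - 1),
          (4 * Real.pi * z.im) ^ i / i.factorial * conj (sigmaSeries (1 - 2 * k) i z)) := by
  obtain ⟨m, hm⟩ : ∃ m, 2 * k - 1 = m + 1 := ⟨2 * k - 2, by omega⟩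
  have hmeven : (-1 : ℂ) ^ m = 1 := Even.neg_one_pow ⟨k - 1, by omega⟩
  have hl : (1 - 2 * k : ℤ) ≤ 0 := by omega
  have hlm : (1 - 2 * k : ℤ) = -((m + 1 : ℕ) : ℤ) := by omega
  have hy : (z.im : ℂ) ≠ 0 := by exact_mod_cast z.im_pos.ne'
  have hsum := summable_latticeSum z (n := m + 1) (by omega)
  -- The rows c and -c agree because the total degree m + 2 = 2k is even.
  rw [hm, latticeSum, Summable.tsum_prod hsum, tsum_int_eq_zero_add_two_mul_tsum_pnat _ hsum.prod]
  swap
  · intro c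
    simp only
    rw [← (Equiv.neg ℤ).tsum_eq]
    refine tsum_congr (fun d => ?_)
    have : lin (-c, (Equiv.neg ℤ) d) z = -lin (c, d) z := lin_neg (c, d) z
    rw [this, map_neg]
    congr 1
    rw [neg_pow, show (-1 : ℂ) ^ (m + 1) = -1 by rw [pow_succ, hmeven]; ring]
    ring
  -- In the row c = 0 the zero vector contributes 1/0 = 0, as does the term 0 of the series for
  -- ζ(2k).
  have h0 : ∑' d : ℤ, 1 / (lin (0, d) z * conj (lin (0, d) z) ^ (m + 1)) =
      2 * riemannZeta (2 * k) := by
    have h := two_mul_riemannZeta_eq_tsum_int_inv_pow_of_even (k := 2 * k) (by omega)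
      (even_two_mul k)
    push_cast at h
    rw [h]
    refine tsum_congr (fun d => ?_)
    simp only [lin, Int.cast_zero, zero_mul, zero_add]
    rw [map_intCast, ← pow_succ', one_div]
    congr 2
    omega
  -- `rowSum_eq` at w = cz: the factor c^(-(m+1)) comes from the power of Im w in the denominator,
  -- and c^i from the one inside the sum over i.
  have hc : ∀ c : ℕ+, ∑' d : ℤ, 1 / (lin ((c : ℕ), d) z * conj (lin ((c : ℕ), d) z) ^ (m + 1)) =
      2 * Real.pi * I / (2 * I * z.im) ^ (m + 1) * (1 / ((c : ℕ) : ℂ) ^ (m + 1) +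
        1 / ((c : ℕ) : ℂ) ^ (m + 1) * expSeries 0 ((c : ℕ) * z) +
        ∑ i ∈ Finset.range (m + 1), (4 * Real.pi * z.im) ^ i / i.factorial *
          conj (1 / ((c : ℕ) : ℂ) ^ (m + 1) * ((c : ℕ) : ℂ) ^ i *
            expSeries i ((c : ℕ) * z))) := by
    intro c
    have hcpos : (0 : ℝ) < (c : ℕ) := by exact_mod_cast c.pos
    have hc0 : ((c : ℕ) : ℂ) ≠ 0 := by exact_mod_cast c.pos.ne'
    have him : (((c : ℕ) : ℂ) * (z : ℂ)).im = (c : ℕ) * z.im := by simp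
    have h := rowSum_eq (w := (c : ℕ) * z) (by rw [him]; exact mul_pos hcpos z.im_pos) m
    rw [him, hmeven] at h
    simp only [lin, Int.cast_natCast]
    rw [h, mul_one, add_assoc, add_assoc, mul_add, mul_add, mul_add, mul_add]
    have e : (2 * I * ((((c : ℕ) : ℝ) * z.im : ℝ) : ℂ)) ^ (m + 1) =
        (2 * I * z.im) ^ (m + 1) * ((c : ℕ) : ℂ) ^ (m + 1) := by
      rw [← mul_pow]; push_cast; ring
    rw [e]
    push_cast
    congr 1
    · field_simp
    congr 1
    · field_simp
    rw [Finset.mul_sum, Finset.mul_sum]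
    refine Finset.sum_congr rfl (fun i _ => ?_)
    simp only [map_mul, map_div₀, map_one, map_pow, map_natCast]
    rw [mul_pow (4 * (Real.pi : ℂ)), mul_pow (4 * (Real.pi : ℂ)), mul_pow ((c : ℕ) : ℂ)]
    field_simp
  have hlamb : ∀ i : ℕ, HasSum (fun c : ℕ+ => 1 / ((c : ℕ) : ℂ) ^ (m + 1) * ((c : ℕ) : ℂ) ^ i *
      expSeries i ((c : ℕ) * z)) (sigmaSeries (1 - 2 * k) i z) := by
    intro i
    have h := hasSum_expSeries hl i (w := z) z.im_pos
    simpa only [hlm, zpow_neg, zpow_natCast, one_div] using h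
  have hzeta : HasSum (fun c : ℕ+ => 1 / ((c : ℕ) : ℂ) ^ (m + 1)) (riemannZeta (2 * k - 1)) := by
    have e : (2 * (k : ℂ) - 1) = ((m + 1 : ℕ) : ℂ) := by
      rw [← hm, Nat.cast_sub (by omega)]
      push_cast
      ring
    have hsm : Summable fun c : ℕ => 1 / (c : ℂ) ^ (m + 1) := by
      have := (Complex.summable_one_div_nat_cpow (p := (m + 1 : ℕ))).2 (by
        rw [natCast_re]; exact_mod_cast (by omega : 1 < m + 1))
      refine this.congr (fun c => ?_)
      rw [cpow_natCast]
    rw [e, zeta_nat_eq_tsum_of_gt_one (by omega)]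
    have := hsm.hasSum
    rw [← PNat.coe_injective.hasSum_iff] at this
    · exact this
    · intro n hn
      have : n = 0 := by
        by_contra h
        exact hn ⟨⟨n, Nat.pos_of_ne_zero h⟩, rfl⟩
      simp [this]
  have htot : HasSum (fun c : ℕ+ => ∑' d : ℤ,
      1 / (lin ((c : ℕ), d) z * conj (lin ((c : ℕ), d) z) ^ (m + 1)))
      (2 * Real.pi * I / (2 * I * z.im) ^ (m + 1) * (riemannZeta (2 * k - 1) +
        sigmaSeries (1 - 2 * k) 0 z + ∑ i ∈ Finset.range (m + 1),
          (4 * Real.pi * z.im) ^ i / i.factorial * conj (sigmaSeries (1 - 2 * k) i z))) := by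
    simp only [hc]
    refine HasSum.mul_left _ ((hzeta.add ?_).add (hasSum_sum (fun i _ => HasSum.mul_left _ ?_)))
    · simpa using hlamb 0
    · exact (hlamb i).map (starRingEnd ℂ) continuous_conj
  rw [h0]
  have := htot.tsum_eq
  simp only [nsmul_eq_mul, Nat.cast_ofNat]
  rw [this, mul_pow (2 * I)]
  field_simp
  ring

end HookMaass

/-! ### Rows of the Epstein zeta function compared with integrals -/

namespace HookMaass

open Complex MeasureTheory
open scoped ComplexConjugate

/-! ### The integral of `(1 + u²)^(-s)` -/

/-- The function `√π Γ(s - 1/2) / Γ(s)`. -/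
noncomputable def betaFactor (s : ℂ) : ℂ := (√Real.pi : ℝ) * Gamma (s - 1 / 2) / Gamma s

lemma cexp_neg_mul_log (s : ℂ) {A : ℝ} (hA : 0 < A) :
    cexp (-s * Real.log A) = (1 / (A : ℂ)) ^ s := by
  have hA' : (1 / (A : ℂ)) ≠ 0 := by
    simp [hA.ne']
  rw [cpow_def_of_ne_zero hA', ← ofReal_one, ← ofReal_div, ← ofReal_log (by positivity), one_div,
    Real.log_inv]
  congr 1
  push_cast
  ring

lemma integrable_one_add_sq {s : ℂ} (hs : 1 / 2 < s.re) :
    Integrable (fun u : ℝ => cexp (-s * Real.log (1 + u ^ 2))) := by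
  have h := integrable_rpow_neg_one_add_norm_sq (E := ℝ) (μ := volume) (r := 2 * s.re)
    (by simp; linarith)
  refine h.mono' ?_ (Filter.Eventually.of_forall (fun u => ?_))
  · apply Continuous.aestronglyMeasurable
    have : Continuous (fun u : ℝ => Real.log (1 + u ^ 2)) :=
      (by fun_prop : Continuous fun u : ℝ => 1 + u ^ 2).log (fun u => by positivity)
    fun_prop
  · rw [norm_exp, Real.norm_eq_abs, sq_abs, Real.rpow_def_of_pos (by positivity)]
    simp only [mul_re, neg_re, ofReal_re, ofReal_im, mul_zero, sub_zero]
    apply le_of_eq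
    congr 1
    ring

/-- Γ(s)(1+u²)^(-s) is the integral of t^(s-1) exp(-(1+u²)t) over t > 0; exchanging the integrals
leaves a Gaussian in u and the Gamma integral at s - 1/2. -/
lemma integral_one_add_sq {s : ℂ} (hs : 1 / 2 < s.re) :
    ∫ u : ℝ, cexp (-s * Real.log (1 + u ^ 2)) = betaFactor s := by
  have hs0 : 0 < s.re := by linarith
  have hΓ : Gamma s ≠ 0 := Gamma_ne_zero_of_re_pos hs0
  let f : ℝ × ℝ → ℂ := fun x => (x.2 : ℂ) ^ (s - 1) * cexp (-(((1 + x.1 ^ 2 : ℝ) : ℂ) * x.2))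
  have hmeas : AEStronglyMeasurable f (volume.prod (volume.restrict (Set.Ioi 0))) := by
    apply Measurable.aestronglyMeasurable
    fun_prop
  have hsplit : ∀ u t : ℝ, cexp (-(((1 + u ^ 2 : ℝ) : ℂ) * t)) =
      cexp (-t) * (Real.exp (-t * u ^ 2) : ℂ) := by
    intro u t
    rw [ofReal_exp, ← Complex.exp_add]
    congr 1
    push_cast
    ring
  have hint : Integrable f (volume.prod (volume.restrict (Set.Ioi 0))) := by
    rw [integrable_prod_iff' hmeas]
    constructor
    · refine (ae_restrict_iff' measurableSet_Ioi).2 (Filter.Eventually.of_forall (fun t ht => ?_))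
      simp only [f, hsplit]
      exact ((integrable_exp_neg_mul_sq ht).ofReal.const_mul _).const_mul _
    · have h1 : IntegrableOn (fun t : ℝ => √Real.pi * (Real.exp (-t) * t ^ ((s.re - 1 / 2) - 1)))
          (Set.Ioi 0) :=
        (Real.GammaIntegral_convergent (s := s.re - 1 / 2) (by linarith)).const_mul _
      refine h1.congr_fun (fun t ht => ?_) measurableSet_Ioi
      have ht' : (0 : ℝ) < t := ht
      have e : ∀ u : ℝ, ‖f (u, t)‖ = t ^ (s.re - 1) * Real.exp (-t) * Real.exp (-t * u ^ 2) := by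
        intro u
        simp only [f, hsplit]
        rw [norm_mul, norm_mul, norm_cpow_eq_rpow_re_of_pos ht', norm_exp, norm_real,
          Real.norm_of_nonneg (Real.exp_pos _).le]
        simp [mul_assoc]
      simp only [e]
      rw [integral_const_mul, integral_gaussian, Real.sqrt_div Real.pi_pos.le,
        show s.re - 1 / 2 - 1 = (s.re - 1) - 1 / 2 by ring, Real.rpow_sub ht', ← Real.sqrt_eq_rpow]
      ring
  have hswap := integral_integral_swap (f := fun u t => f (u, t)) hint
  have hL : ∀ u : ℝ, ∫ t in Set.Ioi (0 : ℝ), f (u, t) =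
      cexp (-s * Real.log (1 + u ^ 2)) * Gamma s := by
    intro u
    have h1 : (0 : ℝ) < 1 + u ^ 2 := by positivity
    simp only [f]
    rw [cexp_neg_mul_log s h1, integral_cpow_mul_exp_neg_mul_Ioi hs0 h1]
  have hR : ∀ t ∈ Set.Ioi (0 : ℝ), ∫ u : ℝ, f (u, t) =
      (√Real.pi : ℝ) * ((t : ℂ) ^ ((s - 1 / 2) - 1) * cexp (-(((1 : ℝ) : ℂ) * t))) := by
    intro t ht
    have ht' : (0 : ℝ) < t := ht
    have ht0 : (t : ℂ) ≠ 0 := by exact_mod_cast ht'.ne'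
    simp only [f, hsplit]
    rw [integral_const_mul, integral_const_mul, integral_complex_ofReal, integral_gaussian,
      Real.sqrt_div Real.pi_pos.le, show s - 1 / 2 - 1 = (s - 1) - 1 / 2 by ring,
      cpow_sub (s - 1) _ ht0]
    have : (t : ℂ) ^ (1 / 2 : ℂ) = (√t : ℝ) := by
      rw [Real.sqrt_eq_rpow, ofReal_cpow ht'.le]
      norm_num
    rw [this]
    push_cast
    rw [one_mul]
    ring
  simp only [hL] at hswap
  rw [setIntegral_congr_fun measurableSet_Ioi hR, integral_const_mul, integral_mul_const,
    integral_cpow_mul_exp_neg_mul_Ioi (by simp; linarith) one_pos] at hswap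
  rw [betaFactor, eq_div_iff hΓ, hswap]
  simp

/-! ### The kernel `|w + u|^(-2s)` -/

/-- The function `|w + u|^(-2s)`. -/
noncomputable def kern (s w : ℂ) (u : ℝ) : ℂ := cexp (-s * Real.log (normSq (w + u)))

lemma normSq_add_ofReal (w : ℂ) (u : ℝ) : normSq (w + u) = (w.re + u) ^ 2 + w.im ^ 2 := by
  rw [normSq_apply]
  simp
  ring

lemma normSq_add_ofReal_pos {w : ℂ} (hw : 0 < w.im) (u : ℝ) : 0 < normSq (w + u) := by
  rw [normSq_add_ofReal]
  positivity

lemma norm_kern {w : ℂ} (hw : 0 < w.im) (s : ℂ) (u : ℝ) :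
    ‖kern s w u‖ = ‖w + u‖ ^ (-(2 * s.re)) := by
  have h := normSq_add_ofReal_pos hw u
  have h' : 0 < ‖w + u‖ := by rw [norm_pos_iff]; exact normSq_pos.1 h
  rw [kern, norm_exp, Real.rpow_def_of_pos h', normSq_eq_norm_sq, Real.log_pow]
  simp only [mul_re, neg_re, ofReal_re, ofReal_im, mul_zero, sub_zero]
  congr 1
  push_cast
  ring

lemma kern_eq_scaled {w : ℂ} (hw : 0 < w.im) (s : ℂ) (u : ℝ) :
    kern s w u = cexp (-(2 * s) * Real.log w.im) *
      cexp (-s * Real.log (1 + (w.im⁻¹ * (u + w.re)) ^ 2)) := by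
  have h1 : normSq (w + u) = w.im ^ 2 * (1 + (w.im⁻¹ * (u + w.re)) ^ 2) := by
    rw [normSq_add_ofReal]
    field_simp
    ring
  rw [kern, h1, Real.log_mul (by positivity) (by positivity), Real.log_pow, ← Complex.exp_add]
  congr 1
  push_cast
  ring

lemma integrable_kern {w : ℂ} (hw : 0 < w.im) {s : ℂ} (hs : 1 / 2 < s.re) :
    Integrable (kern s w) := by
  rw [funext (kern_eq_scaled hw s)]
  exact (((integrable_one_add_sq hs).comp_mul_left' (inv_ne_zero hw.ne')).comp_add_right
    w.re).const_mul _

lemma integral_kern {w : ℂ} (hw : 0 < w.im) {s : ℂ} (hs : 1 / 2 < s.re) :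
    ∫ u : ℝ, kern s w u = cexp ((1 - 2 * s) * Real.log w.im) * betaFactor s := by
  rw [funext (kern_eq_scaled hw s), integral_const_mul,
    integral_add_right_eq_self (fun u : ℝ => cexp (-s * Real.log (1 + (w.im⁻¹ * u) ^ 2))),
    Measure.integral_comp_mul_left (fun u : ℝ => cexp (-s * Real.log (1 + u ^ 2))),
    integral_one_add_sq hs, inv_inv, abs_of_pos hw, real_smul, ← mul_assoc]
  congr 1
  have : (w.im : ℂ) = cexp (Real.log w.im) := by
    rw [← ofReal_exp, Real.exp_log hw]
  rw [show (1 - 2 * s) * (Real.log w.im : ℂ) = -(2 * s) * Real.log w.im + Real.log w.im by ring,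
    Complex.exp_add, ← this]

lemma continuous_log_normSq {w : ℂ} (hw : 0 < w.im) :
    Continuous (fun u : ℝ => Real.log (normSq (w + u))) :=
  (by fun_prop : Continuous fun u : ℝ => normSq (w + u)).log
    (fun u => (normSq_add_ofReal_pos hw u).ne')

lemma continuous_kern {w : ℂ} (hw : 0 < w.im) (s : ℂ) : Continuous (kern s w) := by
  have := continuous_log_normSq hw
  unfold kern
  fun_prop

lemma hasDerivAt_kern_left (s w : ℂ) (u : ℝ) :
    HasDerivAt (fun s => kern s w u)
      (-(Real.log (normSq (w + u)) : ℂ) * kern s w u) s := by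
  have h : HasDerivAt (fun s : ℂ => -s * (Real.log (normSq (w + u)) : ℂ))
      (-1 * (Real.log (normSq (w + u)) : ℂ)) s :=
    (hasDerivAt_neg s).mul_const _
  exact h.cexp.congr_deriv (by simp only [kern]; ring)

lemma hasDerivAt_kern_right {w : ℂ} (hw : 0 < w.im) (s : ℂ) (u : ℝ) :
    HasDerivAt (kern s w) (kern s w u *
      (-s * (((2 * (w.re + u)) / normSq (w + u) : ℝ) : ℂ))) u := by
  have h0 := normSq_add_ofReal_pos hw u
  have h1 : HasDerivAt (fun u : ℝ => normSq (w + u)) (2 * (w.re + u)) u := by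
    have : (fun u : ℝ => normSq (w + u)) = fun u : ℝ => (w.re + u) ^ 2 + w.im ^ 2 :=
      funext (normSq_add_ofReal w)
    rw [this]
    have := (((hasDerivAt_id u).const_add w.re).pow 2).add_const (w.im ^ 2)
    refine this.congr_deriv ?_
    simp
  exact (((h1.log h0.ne').ofReal_comp).const_mul (-s)).cexp

/-- Differentiation in u gains one power of decay. This gain is what makes the remainder series
converge around s = 1. -/
lemma norm_kern_deriv_le {w : ℂ} (hw : 0 < w.im) (s : ℂ) (u : ℝ) :
    ‖kern s w u * (-s * (((2 * (w.re + u)) / normSq (w + u) : ℝ) : ℂ))‖ ≤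
      2 * ‖s‖ * ‖w + u‖ ^ (-(2 * s.re + 1)) := by
  have h := normSq_add_ofReal_pos hw u
  have h' : 0 < ‖w + u‖ := by rw [norm_pos_iff]; exact normSq_pos.1 h
  rw [norm_mul, norm_mul, norm_neg, norm_kern hw, norm_real, norm_div, normSq_eq_norm_sq, norm_mul,
    norm_pow, norm_norm, Real.norm_ofNat, neg_add, Real.rpow_add h', Real.rpow_neg_one]
  have h2 : ‖w.re + u‖ ≤ ‖w + u‖ := by
    have := abs_re_le_norm (w + u)
    simpa using this
  have h3 : 2 * ‖w.re + u‖ / ‖w + u‖ ^ 2 ≤ 2 * ‖w + u‖⁻¹ := by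
    rw [div_le_iff₀ (by positivity)]
    calc 2 * ‖w.re + u‖ ≤ 2 * ‖w + u‖ := by gcongr
      _ = 2 * ‖w + u‖⁻¹ * ‖w + u‖ ^ 2 := by field_simp
  calc _ ≤ ‖w + u‖ ^ (-(2 * s.re)) * (‖s‖ * (2 * ‖w + u‖⁻¹)) := by gcongr
    _ = _ := by ring

end HookMaass

namespace HookMaass

open Complex MeasureTheory
open scoped ComplexConjugate

/-! ### Comparison of the sum over translates with the integral -/

/-- The difference of a value of the kernel and its mean over the next unit interval. -/
noncomputable def kernDiff (s w : ℂ) (d : ℤ) : ℂ :=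
  kern s w d - ∫ u in (0 : ℝ)..1, kern s w (u + d)

/-- The mean value inequality on [d, d+1], where m bounds |w + u| from below and so the derivative
from above. -/
lemma norm_kernDiff_le {w : ℂ} (hw : 0 < w.im) {s : ℂ} (hs : 0 ≤ s.re) (d : ℤ) {m : ℝ}
    (hm : 0 < m) (h : ∀ v ∈ Set.Icc (0 : ℝ) 1, m ≤ ‖w + ((v + d : ℝ) : ℂ)‖) :
    ‖kernDiff s w d‖ ≤ 2 * ‖s‖ * m ^ (-(2 * s.re + 1)) := by
  have hc := continuous_kern hw s
  have e : kernDiff s w d = ∫ u in (0 : ℝ)..1, (kern s w d - kern s w (u + d)) := by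
    rw [intervalIntegral.integral_sub, kernDiff]
    · simp
    · exact continuous_const.intervalIntegrable _ _
    · exact (hc.comp (by fun_prop)).intervalIntegrable _ _
  rw [e]
  have hb : ∀ u ∈ Set.uIoc (0 : ℝ) 1, ‖kern s w d - kern s w (u + d)‖ ≤
      2 * ‖s‖ * m ^ (-(2 * s.re + 1)) := by
    intro u hu
    rw [Set.uIoc_of_le zero_le_one] at hu
    have hdiff : ∀ v ∈ Set.Icc (0 : ℝ) 1, HasDerivWithinAt (fun v : ℝ => kern s w (v + d))
        (kern s w (v + d) * (-s * (((2 * (w.re + (v + d))) / normSq (w + ((v + d : ℝ) : ℂ)) : ℝ) :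
          ℂ))) (Set.Icc 0 1) v := by
      intro v _
      exact ((hasDerivAt_kern_right hw s (v + d)).comp_add_const v (d : ℝ)).hasDerivWithinAt
    have hbd : ∀ v ∈ Set.Icc (0 : ℝ) 1, ‖kern s w (v + d) * (-s * (((2 * (w.re + (v + d))) /
        normSq (w + ((v + d : ℝ) : ℂ)) : ℝ) : ℂ))‖ ≤ 2 * ‖s‖ * m ^ (-(2 * s.re + 1)) := by
      intro v hv
      refine (norm_kern_deriv_le hw s (v + d)).trans ?_
      exact mul_le_mul_of_nonneg_left
        (Real.rpow_le_rpow_of_nonpos hm (h v hv) (by linarith)) (by positivity)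
    have := (convex_Icc (0 : ℝ) 1).norm_image_sub_le_of_norm_hasDerivWithin_le hdiff hbd
      (x := u) (y := 0) ⟨hu.1.le, hu.2⟩ ⟨le_rfl, zero_le_one⟩
    simp only [zero_add] at this
    refine this.trans ?_
    have h1 : ‖(0 : ℝ) - u‖ ≤ 1 := by
      rw [zero_sub, norm_neg, Real.norm_of_nonneg hu.1.le]; exact hu.2
    exact mul_le_of_le_one_right (by positivity) h1
  have := intervalIntegral.norm_integral_le_of_norm_le_const hb
  simpa using this

lemma differentiable_kernDiff {w : ℂ} (hw : 0 < w.im) (d : ℤ) :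
    Differentiable ℂ (fun s => kernDiff s w d) := by
  intro s₀
  refine DifferentiableAt.sub (hasDerivAt_kern_left s₀ w d).differentiableAt ?_
  have hl : Continuous (fun u : ℝ => Real.log (normSq (w + ((u + d : ℝ) : ℂ)))) :=
    (continuous_log_normSq hw).comp (by fun_prop : Continuous fun u : ℝ => u + (d : ℝ))
  have hF' : Continuous (fun x : ℂ × ℝ =>
      -(Real.log (normSq (w + ((x.2 + d : ℝ) : ℂ))) : ℂ) * kern x.1 w (x.2 + d)) := by
    have : Continuous (fun x : ℂ × ℝ => Real.log (normSq (w + ((x.2 + d : ℝ) : ℂ)))) :=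
      hl.comp continuous_snd
    unfold kern
    fun_prop
  obtain ⟨C, hC⟩ := ((isCompact_closedBall s₀ 1).prod (isCompact_Icc (a := (0 : ℝ)) (b := 1))
    ).exists_bound_of_continuousOn hF'.continuousOn
  have hc : ∀ s, Continuous (fun u : ℝ => kern s w (u + d)) := fun s =>
    (continuous_kern hw s).comp (by fun_prop)
  refine (intervalIntegral.hasDerivAt_integral_of_dominated_loc_of_deriv_le
    (F := fun s u => kern s w (u + d))
    (F' := fun s u => -(Real.log (normSq (w + ((u + d : ℝ) : ℂ))) : ℂ) * kern s w (u + d))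
    (bound := fun _ => C) (Metric.closedBall_mem_nhds s₀ one_pos)
    (Filter.Eventually.of_forall (fun s => (hc s).aestronglyMeasurable))
    ((hc s₀).intervalIntegrable _ _)
    (hF'.comp (Continuous.prodMk continuous_const continuous_id)).aestronglyMeasurable
    (Filter.Eventually.of_forall (fun u hu s hs => ?_))
    (continuous_const.intervalIntegrable _ _)
    (Filter.Eventually.of_forall (fun u hu s hs => hasDerivAt_kern_left s w _))).2.differentiableAt
  rw [Set.uIoc_of_le zero_le_one] at hu
  exact hC (s, u) ⟨hs, hu.1.le, hu.2⟩

/-- By homogeneity the bound for integral pairs (c, d) extends to real pairs, giving both rc and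
r|v+d| as lower bounds, hence half of r(c + |v+d|). Since c ≥ 1, the shift v ∈ [0, 1] is absorbed.
The cap ρ ≤ 1 lets powers of ρ be compared in `exists_bound_kernDiff`. -/
lemma exists_lin_lower_bound (z : ℍ) : ∃ ρ : ℝ, 0 < ρ ∧ ρ ≤ 1 ∧ ∀ (c : ℕ+) (d : ℤ),
    ∀ v ∈ Set.Icc (0 : ℝ) 1,
      ρ * ‖![((c : ℕ) : ℤ), d]‖ ≤ ‖((c : ℕ) : ℂ) * z + ((v + d : ℝ) : ℂ)‖ := by
  set r := EisensteinSeries.r z with hr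
  have hr0 : 0 < r := EisensteinSeries.r_pos z
  have hscale : ∀ (x y a : ℝ), 0 < a → (1 ≤ (x / a) ^ 2 ∨ 1 ≤ (y / a) ^ 2) →
      r * a ≤ ‖(x : ℂ) * z + y‖ := by
    intro x y a ha h
    have e : (x : ℂ) * z + y = (((x / a : ℝ) : ℂ) * z + ((y / a : ℝ) : ℂ)) * a := by
      have : (a : ℂ) ≠ 0 := by exact_mod_cast ha.ne'
      push_cast
      field_simp
    rw [e, norm_mul, norm_real, Real.norm_of_nonneg ha.le]
    gcongr
    rcases h with h | h
    · exact EisensteinSeries.auxbound1 z _ h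
    · exact EisensteinSeries.auxbound2 z _ h
  refine ⟨min (r / 2) 1, by positivity, min_le_right _ _, fun c d v hv => ?_⟩
  have hc : (1 : ℝ) ≤ (c : ℕ) := by exact_mod_cast c.pos
  have h1 : r * (c : ℕ) ≤ ‖((c : ℕ) : ℂ) * z + ((v + d : ℝ) : ℂ)‖ := by
    have := hscale (c : ℕ) (v + d) (c : ℕ) (by linarith)
      (Or.inl (by rw [div_self (by linarith)]; norm_num))
    simpa using this
  have h2 : r * |v + d| ≤ ‖((c : ℕ) : ℂ) * z + ((v + d : ℝ) : ℂ)‖ := by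
    rcases eq_or_ne (v + d : ℝ) 0 with h | h
    · rw [h, abs_zero, mul_zero]; positivity
    · have := hscale (c : ℕ) (v + d) |v + d| (abs_pos.2 h)
        (Or.inr (by rw [div_pow, sq_abs, div_self (pow_ne_zero 2 h)]))
      simpa using this
  have h3 : |(d : ℝ)| ≤ |v + d| + 1 := by
    have := abs_sub (v + d) v
    rw [add_sub_cancel_left, abs_of_nonneg hv.1] at this
    linarith [hv.2]
  have h4 : ‖![((c : ℕ) : ℤ), d]‖ ≤ max ((c : ℕ) : ℝ) |(d : ℝ)| := by
    rw [EisensteinSeries.norm_eq_max_natAbs]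
    simp [Nat.cast_natAbs]
  have h5 : max ((c : ℕ) : ℝ) |(d : ℝ)| ≤ (c : ℕ) + |v + d| := by
    apply max_le
    · linarith [abs_nonneg (v + d : ℝ)]
    · linarith
  calc min (r / 2) 1 * ‖![((c : ℕ) : ℤ), d]‖ ≤ (r / 2) * ((c : ℕ) + |v + d|) := by
        gcongr
        · exact min_le_left _ _
        · exact h4.trans h5
    _ ≤ _ := by linarith

/-- The region where the remainder series is studied. -/
def remainderRegion : Set ℂ := {s | 3 / 4 < s.re ∧ ‖s‖ < 2}

lemma isOpen_remainderRegion : IsOpen remainderRegion :=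
  (isOpen_lt continuous_const continuous_re).inter (isOpen_lt continuous_norm continuous_const)

lemma one_mem_remainderRegion : (1 : ℂ) ∈ remainderRegion := by
  constructor <;> norm_num

/-- On `remainderRegion` the exponent 2 Re s + 1 lies between 5/2 and 5: the lower bound exceeds 2,
the rank of the lattice, and gives summability; the upper one controls the power of ρ. The factor 4
bounds 2‖s‖. -/
lemma exists_bound_kernDiff (z : ℍ) : ∃ b : ℕ+ × ℤ → ℝ, Summable b ∧
    ∀ x, ∀ s ∈ remainderRegion, ‖kernDiff s (((x.1 : ℕ) : ℂ) * z) x.2‖ ≤ b x := by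
  obtain ⟨ρ, hρ, hρ1, h⟩ := exists_lin_lower_bound z
  let e : ℕ+ × ℤ → Fin 2 → ℤ := fun x => ![((x.1 : ℕ) : ℤ), x.2]
  have he : Function.Injective e := by
    rintro ⟨c, d⟩ ⟨c', d'⟩ hcd
    have h0 := congrFun hcd 0
    have h1 := congrFun hcd 1
    simp only [e, Matrix.cons_val_zero, Matrix.cons_val_one, Nat.cast_inj, PNat.coe_inj] at h0 h1
    rw [h0, h1]
  refine ⟨fun x => 4 * (ρ ^ (-5 : ℝ) * ‖e x‖ ^ (-(5 / 2) : ℝ)),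
    ((((EisensteinSeries.summable_one_div_norm_rpow (k := 5 / 2) (by norm_num)).comp_injective
      he).mul_left _).mul_left _), fun x s hs => ?_⟩
  have hx1 : 1 ≤ ‖e x‖ := by
    have h1 := EisensteinSeries.abs_le_left_of_norm x.2 ((x.1 : ℕ) : ℤ)
    have h2 : (1 : ℝ) ≤ ((|((x.1 : ℕ) : ℤ)| : ℤ) : ℝ) := by
      rw [abs_of_nonneg (by positivity)]
      exact_mod_cast x.1.pos
    exact h2.trans h1
  have him : 0 < ((((x.1 : ℕ) : ℂ) * z)).im := by
    have : (0 : ℝ) < (x.1 : ℕ) := by exact_mod_cast x.1.pos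
    simpa using mul_pos this z.im_pos
  have hsre : s.re ≤ 2 := (re_le_norm s).trans hs.2.le
  refine (norm_kernDiff_le him (by linarith [hs.1]) x.2 (m := ρ * ‖e x‖) (by positivity)
    (h x.1 x.2)).trans ?_
  rw [Real.mul_rpow hρ.le (norm_nonneg _)]
  have h1 : ρ ^ (-(2 * s.re + 1)) ≤ ρ ^ (-5 : ℝ) :=
    Real.rpow_le_rpow_of_exponent_ge hρ hρ1 (by linarith)
  have h2 : ‖e x‖ ^ (-(2 * s.re + 1)) ≤ ‖e x‖ ^ (-(5 / 2) : ℝ) :=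
    Real.rpow_le_rpow_of_exponent_le hx1 (by linarith [hs.1])
  have h3 := hs.2.le
  calc _ ≤ 2 * 2 * (ρ ^ (-5 : ℝ) * ‖e x‖ ^ (-(5 / 2) : ℝ)) := by gcongr
    _ = _ := by ring

/-- The remainder series. -/
noncomputable def remainder (z : ℍ) (s : ℂ) : ℂ :=
  ∑' x : ℕ+ × ℤ, kernDiff s (((x.1 : ℕ) : ℂ) * z) x.2

lemma im_natCast_mul_pos (z : ℍ) (c : ℕ+) : 0 < (((c : ℕ) : ℂ) * (z : ℂ)).im := by
  have : (0 : ℝ) < (c : ℕ) := by exact_mod_cast c.pos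
  simpa using mul_pos this z.im_pos

lemma analyticAt_remainder (z : ℍ) : AnalyticAt ℂ (remainder z) 1 := by
  obtain ⟨b, hb, h⟩ := exists_bound_kernDiff z
  have := differentiableOn_tsum_of_summable_norm hb
    (fun x => (differentiable_kernDiff (im_natCast_mul_pos z x.1) x.2).differentiableOn)
    isOpen_remainderRegion (fun x s hs => h x s hs)
  exact this.analyticAt (isOpen_remainderRegion.mem_nhds one_mem_remainderRegion)

lemma hasSum_kernDiff_integral {w : ℂ} (hw : 0 < w.im) {s : ℂ} (hs : 1 / 2 < s.re) :
    HasSum (fun d : ℤ => ∫ u in (0 : ℝ)..1, kern s w (u + d))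
      (cexp ((1 - 2 * s) * Real.log w.im) * betaFactor s) := by
  rw [← integral_kern hw hs]
  exact (integrable_kern hw hs).hasSum_intervalIntegral_comp_add_int

/-- In each row the means over unit intervals add up to the integral over the line. The identity
holds at s = 1 too, where the row sums and the integrals are not separately summable over c. -/
lemma hasSum_remainder (z : ℍ) {s : ℂ} (hs : s ∈ remainderRegion) :
    HasSum (fun c : ℕ+ => ∑' d : ℤ, kern s (((c : ℕ) : ℂ) * z) d -
      cexp ((1 - 2 * s) * Real.log ((c : ℕ) * z.im)) * betaFactor s) (remainder z s) := by
  obtain ⟨b, hb, h⟩ := exists_bound_kernDiff z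
  have hsum : Summable fun x : ℕ+ × ℤ => kernDiff s (((x.1 : ℕ) : ℂ) * z) x.2 :=
    Summable.of_norm_bounded hb (fun x => h x s hs)
  convert! hsum.hasSum.prod_fiberwise (fun c => (hsum.prod_factor c).hasSum) using 2 with c
  have hI := hasSum_kernDiff_integral (im_natCast_mul_pos z c) (s := s) (by linarith [hs.1])
  have hk : Summable fun d : ℤ => kern s (((c : ℕ) : ℂ) * z) d := by
    refine ((hsum.prod_factor c).add hI.summable).congr (fun d => ?_)
    simp [kernDiff]
  have him : (((c : ℕ) : ℂ) * (z : ℂ)).im = (c : ℕ) * z.im := by simp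
  rw [him] at hI
  rw [← hI.tsum_eq, ← Summable.tsum_sub hk hI.summable]
  rfl

lemma betaFactor_one : betaFactor 1 = Real.pi := by
  rw [betaFactor, show (1 : ℂ) - 1 / 2 = 1 / 2 by norm_num, Gamma_one_half_eq, Gamma_one, div_one]
  rw [show (Real.pi : ℂ) ^ (1 / 2 : ℂ) = (√Real.pi : ℝ) by
    rw [Real.sqrt_eq_rpow, ofReal_cpow Real.pi_pos.le]; norm_num]
  rw [← ofReal_mul, Real.mul_self_sqrt Real.pi_pos.le]

/-- At s = 1 the row sum is `cot_sum` at cz, and the subtracted integral π/(cy) is exactly its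
constant term. -/
lemma remainder_one (z : ℍ) : remainder z 1 = Real.pi / z.im *
    (sigmaSeries (-1) 0 z + conj (sigmaSeries (-1) 0 z)) := by
  have h := hasSum_remainder z one_mem_remainderRegion
  have hy : (z.im : ℂ) ≠ 0 := by exact_mod_cast z.im_pos.ne'
  have hE := hasSum_expSeries (l := -1) (by norm_num) 0 (w := z) z.im_pos
  refine h.unique ?_
  convert! (hE.add (hE.map (starRingEnd ℂ) continuous_conj)).mul_left (Real.pi / z.im : ℂ)
    using 2 with c
  have hc0 : ((c : ℕ) : ℂ) ≠ 0 := by exact_mod_cast c.pos.ne'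
  have hcpos : (0 : ℝ) < (c : ℕ) := by exact_mod_cast c.pos
  have hterm : ∀ d : ℤ, kern 1 (((c : ℕ) : ℂ) * z) d =
      1 / ((((c : ℕ) : ℂ) * z + d) * conj (((c : ℕ) : ℂ) * z + d) ^ 1) := by
    intro d
    have h0 := normSq_add_ofReal_pos (im_natCast_mul_pos z c) d
    rw [kern, cexp_neg_mul_log _ h0, cpow_one, pow_one, mul_conj]
    simp
  rw [tsum_congr hterm, cot_sum (im_natCast_mul_pos z c), betaFactor_one]
  have him : (((c : ℕ) : ℂ) * (z : ℂ)).im = (c : ℕ) * z.im := by simp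
  have hexp : cexp ((1 - 2 * 1) * Real.log ((c : ℕ) * z.im)) = 1 / (((c : ℕ) : ℂ) * z.im) := by
    rw [show (1 - 2 * 1 : ℂ) = -1 by norm_num, cexp_neg_mul_log _ (mul_pos hcpos z.im_pos),
      cpow_one]
    push_cast
    rfl
  rw [hexp, him]
  simp only [Function.comp_apply, map_mul, zpow_neg_one, map_inv₀, map_natCast, pow_zero, map_one]
  push_cast
  field_simp
  ring

end HookMaass

/-! ### The Kronecker limit formula -/

namespace HookMaass

open Complex MeasureTheory
open scoped ComplexConjugate

/-! ### The Epstein zeta function and the Eisenstein series -/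

lemma lin_ne_zero (z : ℍ) {p : ℤ × ℤ} (hp : p ≠ 0) : lin p z ≠ 0 := by
  intro h
  have h1 := congrArg im h
  simp only [lin, add_im, mul_im, intCast_re, intCast_im, zero_mul, add_zero, zero_im,
    mul_eq_zero, Int.cast_eq_zero] at h1
  have h2 : p.1 = 0 := h1.resolve_right z.im_pos.ne'
  rw [lin, h2, Int.cast_zero, zero_mul, zero_add, Int.cast_eq_zero] at h
  exact hp (Prod.ext h2 h)

/-- The function `(y / |cz + d|²)^s`. -/
noncomputable def epsteinTerm (z : ℍ) (s : ℂ) (p : ℤ × ℤ) : ℂ :=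
  if p = 0 then 0 else cexp (s * Real.log (z.im / normSq (lin p z)))

/-- The Epstein zeta function. -/
noncomputable def epstein (z : ℍ) (s : ℂ) : ℂ := ∑' p : ℤ × ℤ, epsteinTerm z s p

lemma epsteinTerm_eq (z : ℍ) (s : ℂ) {p : ℤ × ℤ} (hp : p ≠ 0) :
    epsteinTerm z s p =
      cexp (s * Real.log z.im) * cexp (-s * Real.log (normSq (lin p z))) := by
  have h := normSq_pos.2 (lin_ne_zero z hp)
  rw [epsteinTerm, if_neg hp, Real.log_div z.im_pos.ne' h.ne', ← Complex.exp_add]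
  congr 1
  push_cast
  ring

lemma summable_norm_epsteinTerm (z : ℍ) {s : ℂ} (hs : 1 < s.re) :
    Summable fun p : ℤ × ℤ => ‖epsteinTerm z s p‖ := by
  refine Summable.of_nonneg_of_le (fun _ => norm_nonneg _) (fun p => ?_)
    ((summable_norm_lin_rpow z (σ := 2 * s.re) (by linarith)).mul_left
      ‖cexp (s * Real.log z.im)‖)
  by_cases hp : p = 0
  · rw [epsteinTerm, if_pos hp, norm_zero]
    positivity
  · have h' := norm_pos_iff.2 (lin_ne_zero z hp)
    rw [epsteinTerm_eq z s hp, norm_mul]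
    apply le_of_eq
    congr 1
    rw [norm_exp, Real.rpow_def_of_pos h', normSq_eq_norm_sq, Real.log_pow]
    simp only [mul_re, neg_re, ofReal_re, ofReal_im, mul_zero, sub_zero]
    congr 1
    push_cast
    ring

lemma epstein_smul (γ : SL(2, ℤ)) (z : ℍ) (s : ℂ) : epstein (γ • z) s = epstein z s := by
  rw [epstein, epstein, ← (rowEquiv γ).tsum_eq (epsteinTerm z s)]
  refine tsum_congr (fun p => ?_)
  have h0 : UpperHalfPlane.denom γ z ≠ 0 := UpperHalfPlane.denom_ne_zero _ _
  have hz : rowEquiv γ p = 0 ↔ p = 0 := by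
    constructor
    · intro h
      apply (rowEquiv γ).injective
      rw [h]
      simp only [rowEquiv, Equiv.coe_fn_mk, Prod.fst_zero, Prod.snd_zero, zero_mul, add_zero]
      rfl
    · rintro rfl
      simp [rowEquiv]
  have h1 : (γ • z).im / normSq (lin p (γ • z : ℍ)) = z.im / normSq (lin (rowEquiv γ p) z) := by
    rw [lin_smul, ModularGroup.im_smul_eq_div_normSq, normSq_div]
    have : normSq (UpperHalfPlane.denom γ z) ≠ 0 := normSq_eq_zero.not.2 h0
    field_simp
  rw [epsteinTerm, epsteinTerm, h1]
  simp only [hz]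

lemma hasSum_zeta {s : ℂ} (hs : 1 < s.re) :
    HasSum (fun n : ℕ+ => 1 / ((n : ℕ) : ℂ) ^ s) (riemannZeta s) := by
  rw [zeta_eq_tsum_one_div_nat_cpow hs]
  have := (Complex.summable_one_div_nat_cpow.2 hs).hasSum
  rw [← PNat.coe_injective.hasSum_iff] at this
  · exact this
  · intro n hn
    have h0 : n = 0 := by
      by_contra h
      exact hn ⟨⟨n, Nat.pos_of_ne_zero h⟩, rfl⟩
    have hs0 : s ≠ 0 := by rintro rfl; norm_num at hs
    simp [h0, zero_cpow hs0]

lemma cexp_neg_mul_log_sq {n : ℕ} (hn : 0 < n) (s : ℂ) :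
    cexp (-s * Real.log ((n : ℝ) ^ 2)) = 1 / (n : ℂ) ^ (2 * s) := by
  have h : (0 : ℝ) < n := by exact_mod_cast hn
  rw [Real.log_pow, cpow_def_of_ne_zero (by exact_mod_cast hn.ne'), one_div, ← Complex.exp_neg,
    ← natCast_log]
  congr 1
  push_cast
  ring

lemma epsteinTerm_smul (z : ℍ) (s : ℂ) (n : ℕ+) (p : ℤ × ℤ) :
    epsteinTerm z s ((n : ℕ) • p) = 1 / ((n : ℕ) : ℂ) ^ (2 * s) * epsteinTerm z s p := by
  by_cases hp : p = 0
  · simp [epsteinTerm, hp]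
  have hn : (0 : ℝ) < (n : ℕ) := by exact_mod_cast n.pos
  have hp' : (n : ℕ) • p ≠ 0 := smul_ne_zero n.ne_zero hp
  have e : lin ((n : ℕ) • p) z = ((n : ℕ) : ℝ) * lin p z := by
    simp [lin]
    ring
  have h := normSq_pos.2 (lin_ne_zero z hp)
  rw [epsteinTerm_eq z s hp', epsteinTerm_eq z s hp, e, normSq_mul, normSq_ofReal, ← sq,
    Real.log_mul (by positivity) h.ne', ← cexp_neg_mul_log_sq n.pos s, ofReal_add, mul_add,
    Complex.exp_add]
  ring

lemma eisenstein_eq_tsum (z : ℍ) (s : ℂ) : eisenstein z s =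
    1 / 2 * ∑' p : {p : ℤ × ℤ // IsCoprime p.1 p.2}, epsteinTerm z s p := by
  rw [eisenstein]
  congr 1
  refine tsum_congr (fun p => ?_)
  have hp : (p : ℤ × ℤ) ≠ 0 := by
    intro h
    have := p.2
    rw [h, Prod.fst_zero, Prod.snd_zero, isCoprime_zero_left] at this
    exact not_isUnit_zero this
  have h0 := lin_ne_zero z hp
  have h := norm_pos_iff.2 h0
  rw [epsteinTerm_eq z s hp, cpow_def_of_ne_zero (by exact_mod_cast z.im_pos.ne'),
    cpow_def_of_ne_zero (by exact_mod_cast h.ne'), div_eq_mul_inv, ← Complex.exp_neg,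
    normSq_eq_norm_sq, Real.log_pow]
  change cexp (Complex.log (z.im : ℂ) * s) *
    cexp (-(Complex.log ((‖lin (p : ℤ × ℤ) z‖ : ℝ) : ℂ) * (2 * s))) = _
  rw [← ofReal_log z.im_pos.le, ← ofReal_log h.le]
  congr 2
  · ring
  · push_cast; ring

/-- Every nonzero integer vector is in exactly one way a positive integer, its gcd, times a coprime
vector; the factor n contributes n^(-2s). -/
lemma epstein_eq (z : ℍ) {s : ℂ} (hs : 1 < s.re) :
    epstein z s = 2 * riemannZeta (2 * s) * eisenstein z s := by
  have hs2 : 1 < (2 * s).re := by simp; linarith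
  let ψ : ℕ+ × {p : ℤ × ℤ // IsCoprime p.1 p.2} → ℤ × ℤ := fun x => (x.1 : ℕ) • (x.2 : ℤ × ℤ)
  have hψ : Function.Injective ψ := by
    rintro ⟨n, ⟨⟨a, b⟩, hab⟩⟩ ⟨m, ⟨⟨c, d⟩, hcd⟩⟩ h
    simp only [ψ, Prod.smul_mk, Prod.mk.injEq] at h
    simp only [nsmul_eq_mul] at h hab hcd
    have hn : Int.gcd ((n : ℕ) * a) ((n : ℕ) * b) = n := by
      rw [Int.gcd_mul_left, Int.isCoprime_iff_gcd_eq_one.1 hab]; simp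
    have hm : Int.gcd ((m : ℕ) * c) ((m : ℕ) * d) = m := by
      rw [Int.gcd_mul_left, Int.isCoprime_iff_gcd_eq_one.1 hcd]; simp
    have hnm : n = m := by
      apply PNat.coe_injective
      rw [← hn, ← hm, h.1, h.2]
    subst hnm
    have hn0 : ((n : ℕ) : ℤ) ≠ 0 := by exact_mod_cast n.ne_zero
    have h1 := mul_left_cancel₀ hn0 h.1
    have h2 := mul_left_cancel₀ hn0 h.2
    subst h1 h2
    rfl
  have hsupp : Function.support (epsteinTerm z s) ⊆ Set.range ψ := by
    rintro ⟨a, b⟩ hp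
    have hp0 : ((a, b) : ℤ × ℤ) ≠ 0 := by
      intro h
      apply hp
      simp [epsteinTerm, h]
    have hg : 0 < Int.gcd a b := by
      rw [Int.gcd_pos_iff]
      by_contra! h
      exact hp0 (Prod.ext h.1 h.2)
    refine ⟨⟨⟨Int.gcd a b, hg⟩, ⟨(a / Int.gcd a b, b / Int.gcd a b), ?_⟩⟩, ?_⟩
    · rw [Int.isCoprime_iff_gcd_eq_one]
      exact Int.gcd_div_gcd_div_gcd hg
    · simp only [ψ, PNat.mk_coe, Prod.smul_mk]
      rw [nsmul_eq_mul, nsmul_eq_mul, Int.mul_ediv_cancel' (Int.gcd_dvd_left a b), Int.mul_ediv_cancel' (Int.gcd_dvd_right a b)]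
  have hz := hasSum_zeta hs2
  have hsn : Summable fun p : {p : ℤ × ℤ // IsCoprime p.1 p.2} => ‖epsteinTerm z s p‖ :=
    (summable_norm_epsteinTerm z hs).subtype _
  rw [eisenstein_eq_tsum, epstein, ← hψ.tsum_eq hsupp]
  simp only [ψ, epsteinTerm_smul]
  rw [← tsum_mul_tsum_of_summable_norm hz.summable.norm hsn, hz.tsum_eq]
  ring

/-- The row c = 0 gives ζ(2s). In the rows ±c the integrals carry the factor c^(1-2s) and add up to
ζ(2s-1), the only source of the pole. -/
lemma epstein_eq_remainder (z : ℍ) {s : ℂ} (hs : 1 < s.re) (hs' : s ∈ remainderRegion) :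
    epstein z s = 2 * cexp (s * Real.log z.im) * (riemannZeta (2 * s) +
      cexp ((1 - 2 * s) * Real.log z.im) * betaFactor s * riemannZeta (2 * s - 1) +
        remainder z s) := by
  have hsum := (summable_norm_epsteinTerm z hs).of_norm
  rw [epstein, Summable.tsum_prod hsum, tsum_int_eq_zero_add_two_mul_tsum_pnat _ hsum.prod]
  swap
  · intro c
    simp only
    rw [← (Equiv.neg ℤ).tsum_eq]
    refine tsum_congr (fun d => ?_)
    have : (-c, (Equiv.neg ℤ) d) = -(c, d) := rfl
    rw [this, epsteinTerm, epsteinTerm, lin_neg, normSq_neg]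
    simp only [neg_eq_zero]
  have hz2 := hasSum_zeta (s := 2 * s) (by simp; linarith)
  have hz1 := hasSum_zeta (s := 2 * s - 1) (by simp; linarith)
  have h0 : ∑' d : ℤ, epsteinTerm z s (0, d) =
      2 * cexp (s * Real.log z.im) * riemannZeta (2 * s) := by
    rw [tsum_int_eq_zero_add_two_mul_tsum_pnat _ (hsum.prod_factor 0)]
    · have e : ∀ n : ℕ+, epsteinTerm z s (0, ((n : ℕ) : ℤ)) =
          cexp (s * Real.log z.im) * (1 / ((n : ℕ) : ℂ) ^ (2 * s)) := by
        intro n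
        have := epsteinTerm_smul z s n (0, 1)
        rw [Prod.smul_mk, smul_zero, nsmul_one] at this
        rw [this, epsteinTerm_eq z s (by simp)]
        simp [lin, mul_comm]
      have h00 : epsteinTerm z s (0, 0) = 0 := if_pos rfl
      rw [tsum_congr e, tsum_mul_left, hz2.tsum_eq, h00]
      simp only [nsmul_eq_mul, Nat.cast_ofNat]
      ring
    · intro d
      simp only
      have : ((0, -d) : ℤ × ℤ) = -(0, d) := by simp
      rw [this, epsteinTerm, epsteinTerm, lin_neg, normSq_neg]
      simp only [neg_eq_zero]
  have hterm : ∀ (c : ℕ+) (d : ℤ), epsteinTerm z s (((c : ℕ) : ℤ), d) =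
      cexp (s * Real.log z.im) * kern s (((c : ℕ) : ℂ) * z) d := by
    intro c d
    rw [epsteinTerm_eq z s (by simp), kern, lin]
    simp
  have hc : HasSum (fun c : ℕ+ => ∑' d : ℤ, kern s (((c : ℕ) : ℂ) * z) d)
      (remainder z s +
        cexp ((1 - 2 * s) * Real.log z.im) * betaFactor s * riemannZeta (2 * s - 1)) := by
    convert! (hasSum_remainder z hs').add
      (hz1.mul_left (cexp ((1 - 2 * s) * Real.log z.im) * betaFactor s)) using 2 with c
    have hcpos : (0 : ℝ) < (c : ℕ) := by exact_mod_cast c.pos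
    have e : cexp ((1 - 2 * s) * Real.log ((c : ℕ) * z.im)) =
        cexp ((1 - 2 * s) * Real.log z.im) * (1 / ((c : ℕ) : ℂ) ^ (2 * s - 1)) := by
      rw [Real.log_mul hcpos.ne' z.im_pos.ne', cpow_def_of_ne_zero (by exact_mod_cast c.ne_zero),
        one_div, ← Complex.exp_neg, ← natCast_log, ← Complex.exp_add]
      congr 1
      push_cast
      ring
    rw [e]
    ring
  simp only [hterm, tsum_mul_left]
  rw [h0, hc.tsum_eq]
  simp only [nsmul_eq_mul, Nat.cast_ofNat]
  ring

/-! ### The Kronecker limit formula -/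

/-- The regular part of the Riemann zeta function at `1`. -/
noncomputable def zetaRegular : ℂ → ℂ :=
  Function.update (fun s => riemannZeta s - 1 / (s - 1)) 1 Real.eulerMascheroniConstant

/-- The singularity is removable, since Euler's constant is the limit of the punctured function. -/
lemma analyticAt_zetaRegular : AnalyticAt ℂ zetaRegular 1 := by
  apply Complex.analyticAt_of_differentiable_on_punctured_nhds_of_continuousAt
  · filter_upwards [self_mem_nhdsWithin] with s hs
    have hs1 : s ≠ 1 := hs
    have h1 : DifferentiableAt ℂ (fun s => riemannZeta s - 1 / (s - 1)) s := by
      refine (differentiableAt_riemannZeta hs1).sub (DifferentiableAt.div ?_ ?_ (sub_ne_zero.2 hs1))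
      · fun_prop
      · fun_prop
    refine h1.congr_of_eventuallyEq ?_
    filter_upwards [isOpen_ne.mem_nhds hs1] with x hx
    exact Function.update_of_ne hx _ _
  · rw [zetaRegular, continuousAt_update_same]
    exact tendsto_riemannZeta_sub_one_div

lemma riemannZeta_eq_zetaRegular {s : ℂ} (hs : s ≠ 1) :
    riemannZeta s = 1 / (s - 1) + zetaRegular s := by
  rw [zetaRegular, Function.update_of_ne hs]
  ring

lemma analyticAt_Gamma_of_re_pos {s : ℂ} (hs : 0 < s.re) : AnalyticAt ℂ Gamma s := by
  have hopen : IsOpen {s : ℂ | 0 < s.re} := isOpen_lt continuous_const continuous_re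
  refine DifferentiableOn.analyticAt (s := {s : ℂ | 0 < s.re}) (fun x hx => ?_)
    (hopen.mem_nhds hs)
  refine (differentiableAt_Gamma x (fun m h => ?_)).differentiableWithinAt
  have : x.re = -m := by rw [h]; simp
  have hx' : 0 < x.re := hx
  have : (0 : ℝ) ≤ m := m.cast_nonneg
  linarith

lemma analyticAt_betaFactor : AnalyticAt ℂ betaFactor 1 := by
  unfold betaFactor
  refine AnalyticAt.div (AnalyticAt.mul analyticAt_const ?_)
    (analyticAt_Gamma_of_re_pos (by simp)) (by simp)
  exact (analyticAt_Gamma_of_re_pos (s := 1 - 1 / 2) (by norm_num)).comp_of_eq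
    (f := fun s : ℂ => s - 1 / 2) (analyticAt_id.sub analyticAt_const) rfl

/-- Euler's constant occurs in the logarithmic derivatives of Γ at 1/2 and at 1 and cancels in the
quotient; only -2 log 2 remains. -/
lemma hasDerivAt_betaFactor : HasDerivAt betaFactor (-2 * Real.pi * Real.log 2) 1 := by
  have h1 : HasDerivAt (fun s : ℂ => Gamma (s - 1 / 2))
      (-(√Real.pi : ℝ) * (Real.eulerMascheroniConstant + 2 * Complex.log 2)) 1 := by
    have h := Complex.hasDerivAt_Gamma_one_half
    rw [show (1 / 2 : ℂ) = 1 - 1 / 2 by norm_num] at h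
    simpa using h.comp_sub_const (1 : ℂ) (1 / 2)
  have h2 := (h1.const_mul ((√Real.pi : ℝ) : ℂ)).div Complex.hasDerivAt_Gamma_one (by simp)
  refine h2.congr_deriv ?_
  have hsq : ((√Real.pi : ℝ) : ℂ) * ((√Real.pi : ℝ) : ℂ) = Real.pi := by
    rw [← ofReal_mul, Real.mul_self_sqrt Real.pi_pos.le]
  have hhalf : Gamma (1 - 1 / 2 : ℂ) = (√Real.pi : ℝ) := by
    rw [show (1 : ℂ) - 1 / 2 = 1 / 2 by norm_num, Gamma_one_half_eq, Real.sqrt_eq_rpow,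
      ofReal_cpow Real.pi_pos.le]
    norm_num
  have hlog : Complex.log 2 = (Real.log 2 : ℝ) := by
    rw [ofReal_log (by norm_num)]; norm_num
  rw [hhalf, hlog, Gamma_one]
  linear_combination (-2 * (Real.log 2 : ℂ)) * hsq

lemma riemannZeta_two_ne_zero : riemannZeta 2 ≠ 0 :=
  riemannZeta_ne_zero_of_one_lt_re (by norm_num)

lemma analyticAt_riemannZeta {s : ℂ} (hs : s ≠ 1) : AnalyticAt ℂ riemannZeta s := by
  refine DifferentiableOn.analyticAt (s := {1}ᶜ) (fun x hx => ?_) (isOpen_ne.mem_nhds hs)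
  exact (differentiableAt_riemannZeta hx).differentiableWithinAt

lemma analyticAt_cexp_mul (f : ℂ → ℂ) (hf : AnalyticAt ℂ f 1) (a : ℂ) :
    AnalyticAt ℂ (fun s => cexp (f s * a)) 1 :=
  (hf.mul analyticAt_const).cexp

/-- The coefficient of `ζ(2s - 1)` in the Eisenstein series. -/
noncomputable def polarFactor (z : ℍ) (s : ℂ) : ℂ :=
  cexp ((1 - s) * Real.log z.im) * betaFactor s / riemannZeta (2 * s)

lemma analyticAt_zeta_two_mul : AnalyticAt ℂ (fun s => riemannZeta (2 * s)) 1 :=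
  (analyticAt_riemannZeta (s := 2) (by norm_num)).comp_of_eq
    (analyticAt_const.mul analyticAt_id) (by norm_num)

lemma analyticAt_polarFactor (z : ℍ) : AnalyticAt ℂ (polarFactor z) 1 := by
  unfold polarFactor
  refine AnalyticAt.div (AnalyticAt.mul ?_ analyticAt_betaFactor) analyticAt_zeta_two_mul
    (by simpa using riemannZeta_two_ne_zero)
  exact analyticAt_cexp_mul _ (analyticAt_const.sub analyticAt_id) _

lemma polarFactor_one (z : ℍ) : polarFactor z 1 = 6 / Real.pi := by
  have hpi : (Real.pi : ℂ) ≠ 0 := by exact_mod_cast Real.pi_ne_zero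
  rw [polarFactor, betaFactor_one, mul_one, riemannZeta_two]
  simp
  field_simp

/-- The value 6/π times the logarithmic derivative, in which -2ζ'(2)/ζ(2) becomes -12ζ'(2)/π². -/
lemma hasDerivAt_polarFactor (z : ℍ) : HasDerivAt (polarFactor z)
    (6 / Real.pi * (-(Real.log z.im : ℂ) - 2 * Real.log 2 -
      12 * deriv riemannZeta 2 / (Real.pi : ℂ) ^ 2)) 1 := by
  have hpi : (Real.pi : ℂ) ≠ 0 := by exact_mod_cast Real.pi_ne_zero
  have h1 : HasDerivAt (fun s : ℂ => cexp ((1 - s) * Real.log z.im))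
      (cexp ((1 - 1) * Real.log z.im) * (-1 * Real.log z.im)) 1 :=
    (((hasDerivAt_id (1 : ℂ)).const_sub 1).mul_const _).cexp
  have h2 : HasDerivAt (fun s : ℂ => riemannZeta (2 * s)) (deriv riemannZeta 2 * 2) 1 := by
    have h : HasDerivAt riemannZeta (deriv riemannZeta 2) (2 * 1) := by
      rw [mul_one]
      exact (differentiableAt_riemannZeta (by norm_num)).hasDerivAt
    have h3 : HasDerivAt (fun s : ℂ => 2 * s) 2 1 := by
      simpa using (hasDerivAt_id (1 : ℂ)).const_mul 2
    exact h.comp (1 : ℂ) h3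
  have h := (h1.mul hasDerivAt_betaFactor).div h2 (by simpa using riemannZeta_two_ne_zero)
  refine h.congr_deriv ?_
  simp only [Pi.mul_apply, betaFactor_one, sub_self, zero_mul, Complex.exp_zero, mul_one,
    riemannZeta_two, one_mul]
  field_simp
  ring

/-- The analytic continuation of `E(z, s) - 3 / (π (s - 1))` near `s = 1`. -/
noncomputable def kroneckerExt (z : ℍ) (s : ℂ) : ℂ :=
  cexp (s * Real.log z.im) + dslope (polarFactor z) 1 s / 2 +
    polarFactor z s * zetaRegular (2 * s - 1) +
    cexp (s * Real.log z.im) * remainder z s / riemannZeta (2 * s)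

lemma analyticAt_dslope {f : ℂ → ℂ} {c : ℂ} (hf : AnalyticAt ℂ f c) :
    AnalyticAt ℂ (dslope f c) c := by
  obtain ⟨p, hp⟩ := hf
  exact ⟨_, hp.has_fpower_series_dslope_fslope⟩

lemma analyticAt_kroneckerExt (z : ℍ) : AnalyticAt ℂ (kroneckerExt z) 1 := by
  have he := analyticAt_cexp_mul (fun s => s) analyticAt_id (Real.log z.im)
  unfold kroneckerExt
  refine AnalyticAt.add (AnalyticAt.add (AnalyticAt.add he ?_) ?_) ?_
  · exact (analyticAt_dslope (analyticAt_polarFactor z)).div analyticAt_const two_ne_zero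
  · refine (analyticAt_polarFactor z).mul (analyticAt_zetaRegular.comp_of_eq ?_ (by norm_num))
    exact (analyticAt_const.mul analyticAt_id).sub analyticAt_const
  · exact (he.mul (analyticAt_remainder z)).div analyticAt_zeta_two_mul
      (by simpa using riemannZeta_two_ne_zero)

/-- The principal part 1/(2(s-1)) of ζ(2s-1) multiplies `polarFactor`. Its value 6/π at 1 yields the
pole 3/(π(s-1)), and the rest is half the divided difference `dslope`, which is analytic. -/
lemma eisenstein_eq_kroneckerExt (z : ℍ) {s : ℂ} (hs : 1 < s.re) (hs' : s ∈ remainderRegion) :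
    eisenstein z s = 3 / ((Real.pi : ℂ) * (s - 1)) + kroneckerExt z s := by
  have hpi : (Real.pi : ℂ) ≠ 0 := by exact_mod_cast Real.pi_ne_zero
  have hs1 : s ≠ 1 := by rintro rfl; simp at hs
  have hs1' : s - 1 ≠ 0 := sub_ne_zero.2 hs1
  have hζ : riemannZeta (2 * s) ≠ 0 := riemannZeta_ne_zero_of_one_lt_re (by simp; linarith)
  have h1 := epstein_eq z hs
  rw [epstein_eq_remainder z hs hs'] at h1
  have h2 : riemannZeta (2 * s - 1) = 1 / (2 * (s - 1)) + zetaRegular (2 * s - 1) := by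
    rw [riemannZeta_eq_zetaRegular]
    · congr 2
      ring
    · intro h
      apply hs1'
      linear_combination h / 2
  have h3 : cexp ((1 - s) * Real.log z.im) =
      cexp (s * Real.log z.im) * cexp ((1 - 2 * s) * Real.log z.im) := by
    rw [← Complex.exp_add]
    congr 1
    ring
  have h4 : eisenstein z s = cexp (s * Real.log z.im) + polarFactor z s * riemannZeta (2 * s - 1) +
      cexp (s * Real.log z.im) * remainder z s / riemannZeta (2 * s) := by
    rw [polarFactor, h3]
    generalize riemannZeta (2 * s) = a at *
    generalize riemannZeta (2 * s - 1) = b at *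
    generalize cexp ((1 - 2 * s) * Real.log z.im) = e at *
    field_simp
    linear_combination -h1 / 2
  rw [h4, h2, kroneckerExt, dslope_of_ne _ hs1, slope_def_field, polarFactor_one]
  field_simp
  ring

lemma kroneckerExt_one (z : ℍ) : kroneckerExt z 1 =
    z.im + 6 / (Real.pi : ℂ) * (Real.eulerMascheroniConstant - Real.log 2 -
      (Real.log z.im : ℂ) / 2 - 6 * deriv riemannZeta 2 / (Real.pi : ℂ) ^ 2 +
      sigmaSeries (-1) 0 z + conj (sigmaSeries (-1) 0 z)) := by
  have hpi : (Real.pi : ℂ) ≠ 0 := by exact_mod_cast Real.pi_ne_zero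
  have hy : (z.im : ℂ) ≠ 0 := by exact_mod_cast z.im_pos.ne'
  have h1 : cexp (1 * (Real.log z.im : ℂ)) = z.im := by
    rw [one_mul, ← ofReal_exp, Real.exp_log z.im_pos]
  have h2 : zetaRegular (2 * 1 - 1) = Real.eulerMascheroniConstant := by
    rw [show (2 * 1 - 1 : ℂ) = 1 by norm_num, zetaRegular, Function.update_self]
  rw [kroneckerExt, h1, h2, dslope_same, (hasDerivAt_polarFactor z).deriv, polarFactor_one,
    remainder_one, mul_one, riemannZeta_two]
  field_simp
  ring

/-- The points 1 + 1/(n+2) tend to 1 inside the half-plane of convergence and, being at most 3/2,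
inside `remainderRegion`. -/
lemma tendsto_eisenstein (z : ℍ) : Filter.Tendsto
    (fun n : ℕ => eisenstein z ((1 + 1 / (n + 2) : ℝ) : ℂ) -
      3 / ((Real.pi : ℂ) * (((1 + 1 / (n + 2) : ℝ) : ℂ) - 1))) Filter.atTop
    (nhds (kroneckerExt z 1)) := by
  have h1 : Filter.Tendsto (fun n : ℕ => ((1 + 1 / ((n : ℝ) + 2) : ℝ) : ℂ)) Filter.atTop
      (nhds 1) := by
    have : Filter.Tendsto (fun n : ℕ => 1 + 1 / ((n : ℝ) + 2)) Filter.atTop (nhds (1 + 0)) := by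
      refine tendsto_const_nhds.add (Filter.Tendsto.div_atTop tendsto_const_nhds ?_)
      exact Filter.tendsto_atTop_add_const_right _ _ tendsto_natCast_atTop_atTop
    rw [add_zero] at this
    exact (continuous_ofReal.tendsto' 1 1 ofReal_one).comp this
  refine ((analyticAt_kroneckerExt z).continuousAt.tendsto.comp h1).congr (fun n => ?_)
  have hpos : (0 : ℝ) < 1 / ((n : ℝ) + 2) := by positivity
  have hle : 1 / ((n : ℝ) + 2) ≤ 1 / 2 := by
    apply one_div_le_one_div_of_le (by norm_num)
    linarith [(n.cast_nonneg : (0 : ℝ) ≤ n)]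
  have hre : 1 < (((1 + 1 / ((n : ℝ) + 2) : ℝ) : ℂ)).re := by
    rw [ofReal_re]; linarith
  rw [eisenstein_eq_kroneckerExt z hre, Function.comp_apply, add_sub_cancel_left]
  refine ⟨by linarith, ?_⟩
  rw [norm_real, Real.norm_of_nonneg (by linarith)]
  linarith

/-- Only invariance for Re s > 1 is needed: the polar term does not depend on z, and limits are
unique. -/
lemma kroneckerExt_one_smul (γ : SL(2, ℤ)) (z : ℍ) :
    kroneckerExt (γ • z) 1 = kroneckerExt z 1 := by
  refine tendsto_nhds_unique (tendsto_eisenstein (γ • z)) ((tendsto_eisenstein z).congr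
    (fun n => ?_))
  have hpos : (0 : ℝ) < 1 / ((n : ℝ) + 2) := by positivity
  have hre : 1 < (((1 + 1 / ((n : ℝ) + 2) : ℝ) : ℂ)).re := by
    rw [ofReal_re]; linarith
  have hζ : riemannZeta (2 * ((1 + 1 / ((n : ℝ) + 2) : ℝ) : ℂ)) ≠ 0 :=
    riemannZeta_ne_zero_of_one_lt_re (by
      rw [mul_re, re_ofNat, im_ofNat, zero_mul, sub_zero]; linarith)
  have h := epstein_smul γ z ((1 + 1 / ((n : ℝ) + 2) : ℝ) : ℂ)
  rw [epstein_eq _ hre, epstein_eq _ hre] at h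
  rw [mul_left_cancel₀ (mul_ne_zero two_ne_zero hζ) h]

end HookMaass

/-! ### From level one to level t -/

namespace HookMaass

open Complex

/-! ### Rescaling the variable -/

/-- Multiplication by a positive integer on the upper half-plane. -/
def scale {t : ℕ} (ht : 0 < t) (z : ℍ) : ℍ :=
  ⟨(t : ℂ) * z, by
    have : (0 : ℝ) < t := by exact_mod_cast ht
    simpa using mul_pos this z.im_pos⟩

lemma coe_scale {t : ℕ} (ht : 0 < t) (z : ℍ) : (scale ht z : ℂ) = t * z := rfl

lemma coe_smul_eq (γ : SL(2, ℤ)) (z : ℍ) :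
    ((γ • z : ℍ) : ℂ) = ((γ 0 0 : ℂ) * z + γ 0 1) / UpperHalfPlane.denom γ z := by
  rw [UpperHalfPlane.coe_specialLinearGroup_apply, ModularGroup.denom_apply]
  simp

/-- The image of `z` under `(az + b) / d`. -/
noncomputable def affine {a d : ℤ} (ha : 0 < a) (hd : 0 < d) (b : ℤ) (z : ℍ) : ℍ :=
  ⟨(((a / d : ℝ) : ℂ) * z + ((b / d : ℝ) : ℂ)), by
    have : (0 : ℝ) < a / d := div_pos (by exact_mod_cast ha) (by exact_mod_cast hd)
    rw [add_im, ofReal_im, add_zero, im_ofReal_mul]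
    exact mul_pos this z.im_pos⟩

lemma coe_affine {a d : ℤ} (ha : 0 < a) (hd : 0 < d) (b : ℤ) (z : ℍ) :
    (affine ha hd b z : ℂ) = ((a : ℂ) * z + b) / d := by
  change (((a / d : ℝ) : ℂ) * z + ((b / d : ℝ) : ℂ)) = _
  push_cast
  ring

lemma im_affine {a d : ℤ} (ha : 0 < a) (hd : 0 < d) (b : ℤ) (z : ℍ) :
    (affine ha hd b z).im = a / d * z.im := by
  change (((a / d : ℝ) : ℂ) * z + ((b / d : ℝ) : ℂ)).im = _
  rw [add_im, ofReal_im, add_zero, im_ofReal_mul]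
  rfl

/-- The Hermite normal form diag(t, 1) γ = γ' (a b; 0 d). The gcd of the first column of the left
side is a, the quotients are the first column of γ', and (b, d) is the second column of the left
side multiplied by the inverse of γ'. -/
lemma exists_scale_smul_eq {t : ℕ} (ht : 0 < t) (γ : SL(2, ℤ)) :
    ∃ (γ' : SL(2, ℤ)) (a d b : ℤ) (ha : 0 < a) (hd : 0 < d), ∀ z : ℍ,
      scale ht (γ • z) = γ' • affine ha hd b z ∧
      UpperHalfPlane.denom γ z = UpperHalfPlane.denom γ' (affine ha hd b z) * d := by
  have hdet := γ.det_coe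
  rw [Matrix.det_fin_two] at hdet
  have ht' : (t : ℤ) ≠ 0 := by exact_mod_cast ht.ne'
  have hg : 0 < Int.gcd (t * γ 0 0) (γ 1 0) := by
    rw [Int.gcd_pos_iff]
    by_contra! h
    have h1 : γ 0 0 = 0 := (mul_eq_zero.1 h.1).resolve_left ht'
    rw [h1, h.2] at hdet
    simp at hdet
  set a : ℤ := ((Int.gcd (t * γ 0 0) (γ 1 0) : ℕ) : ℤ) with ha_def
  have ha : 0 < a := Int.natCast_pos.2 hg
  obtain ⟨p, hp⟩ : a ∣ t * γ 0 0 := Int.gcd_dvd_left _ _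
  obtain ⟨r, hr⟩ : a ∣ γ 1 0 := Int.gcd_dvd_right _ _
  have hcop : IsCoprime p r := by
    rw [Int.isCoprime_iff_gcd_eq_one]
    have := Int.gcd_div_gcd_div_gcd hg
    rwa [← ha_def, hp, hr, Int.mul_ediv_cancel_left _ ha.ne',
      Int.mul_ediv_cancel_left _ ha.ne'] at this
  obtain ⟨γ', h0, h1⟩ := hcop.exists_SL2_col 0
  have hdet' := γ'.det_coe
  rw [Matrix.det_fin_two, h0, h1] at hdet'
  set d : ℤ := p * γ 1 1 - r * (t * γ 0 1) with hd_def
  set b : ℤ := γ' 1 1 * (t * γ 0 1) - γ' 0 1 * γ 1 1 with hb_def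
  have had : a * d = t := by
    rw [hd_def]
    linear_combination (-γ 1 1) * hp + t * γ 0 1 * hr + t * hdet
  have hd : 0 < d := by
    have : 0 < a * d := by rw [had]; exact_mod_cast ht
    exact pos_of_mul_pos_right this ha.le |> fun h => by
      rcases lt_trichotomy d 0 with h' | h' | h'
      · nlinarith
      · rw [h', mul_zero] at this; exact absurd this (lt_irrefl _)
      · exact h'
  have e1 : p * b + γ' 0 1 * d = t * γ 0 1 := by
    rw [hb_def, hd_def]
    linear_combination (t * γ 0 1) * hdet'
  have e2 : r * b + γ' 1 1 * d = γ 1 1 := by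
    rw [hb_def, hd_def]
    linear_combination γ 1 1 * hdet'
  refine ⟨γ', a, d, b, ha, hd, fun z => ?_⟩
  have hd0 : (d : ℂ) ≠ 0 := by exact_mod_cast hd.ne'
  have hden : UpperHalfPlane.denom γ z = UpperHalfPlane.denom γ' (affine ha hd b z) * d := by
    rw [ModularGroup.denom_apply, ModularGroup.denom_apply, coe_affine, h1, ← e2, hr]
    push_cast
    field_simp
    ring
  refine ⟨?_, hden⟩
  apply UpperHalfPlane.ext
  have hd1 : UpperHalfPlane.denom γ' (affine ha hd b z) ≠ 0 := UpperHalfPlane.denom_ne_zero _ _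
  rw [coe_scale, coe_smul_eq, coe_smul_eq, hden]
  generalize UpperHalfPlane.denom γ' (affine ha hd b z) = D at hd1
  rw [coe_affine, h0]
  have hp' : (t : ℂ) * γ 0 0 = a * p := by exact_mod_cast hp
  have e1' : (p : ℂ) * b + γ' 0 1 * d = t * γ 0 1 := by exact_mod_cast e1
  rw [← mul_div_assoc, mul_add, ← mul_assoc, hp', ← e1', div_eq_div_iff (mul_ne_zero hd1 hd0) hd1]
  field_simp
  ring

lemma slash_scale_apply {k : ℤ} {G : ℍ → ℂ} (hG : ∀ γ : SL(2, ℤ), G ∣[k] γ = G)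
    {t : ℕ} (ht : 0 < t) {γ γ' : SL(2, ℤ)} {z w : ℍ} {d : ℂ} (h : scale ht (γ • z) = γ' • w)
    (hd : UpperHalfPlane.denom γ z = UpperHalfPlane.denom γ' w * d) :
    ((fun z => G (scale ht z)) ∣[k] γ) z = d ^ (-k) * G w := by
  have h1 := congrFun (hG γ') w
  rw [ModularForm.SL_slash_apply] at h1
  rw [ModularForm.SL_slash_apply, h, hd, mul_zpow, ← h1]
  ring

/-- For t ∣ γ₁₀ the conjugate of γ by diag(t, 1) is again integral; it is the matrix γ' below. -/
lemma scale_modular {k : ℤ} {G : ℍ → ℂ} (hG : ∀ γ : SL(2, ℤ), G ∣[k] γ = G)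
    {t : ℕ} (ht : 0 < t) {γ : SL(2, ℤ)} (hγ : γ ∈ CongruenceSubgroup.Gamma0 t) :
    (fun z => G (scale ht z)) ∣[k] γ = fun z => G (scale ht z) := by
  rw [CongruenceSubgroup.Gamma0_mem, ZMod.intCast_zmod_eq_zero_iff_dvd] at hγ
  obtain ⟨c, hc⟩ := hγ
  have hdet := γ.det_coe
  rw [Matrix.det_fin_two] at hdet
  let γ' : SL(2, ℤ) := ⟨!![γ 0 0, t * γ 0 1; c, γ 1 1], by
    rw [Matrix.det_fin_two_of]
    linear_combination hdet + γ 0 1 * hc⟩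
  ext z
  have hden : UpperHalfPlane.denom γ z = UpperHalfPlane.denom γ' (scale ht z) * 1 := by
    rw [ModularGroup.denom_apply, ModularGroup.denom_apply, coe_scale, hc]
    simp [γ']
    ring
  rw [slash_scale_apply hG ht (γ' := γ') (w := scale ht z) (d := 1) ?_ hden]
  · simp
  · apply UpperHalfPlane.ext
    rw [coe_scale, coe_smul_eq, coe_smul_eq, hden, mul_one, coe_scale]
    simp [γ']
    ring

/-- By the normal form the function slashed with γ is d^(-k) G((az+b)/d), so the exponent C is only
rescaled by a/d. -/
lemma scale_growth {k : ℤ} {G : ℍ → ℂ} (hG : ∀ γ : SL(2, ℤ), G ∣[k] γ = G)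
    {C : ℝ} (hgr : G =O[UpperHalfPlane.atImInfty] fun z : ℍ => Real.exp (C * z.im))
    {t : ℕ} (ht : 0 < t) (γ : SL(2, ℤ)) :
    ∃ C : ℝ, ((fun z => G (scale ht z)) ∣[k] γ) =O[UpperHalfPlane.atImInfty]
      fun z : ℍ => Real.exp (C * z.im) := by
  obtain ⟨γ', a, d, b, ha, hd, h⟩ := exists_scale_smul_eq ht γ
  have hpos : (0 : ℝ) < a / d := div_pos (by exact_mod_cast ha) (by exact_mod_cast hd)
  have e : (fun z => G (scale ht z)) ∣[k] γ =
      fun z => (d : ℂ) ^ (-k) * G (affine ha hd b z) := by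
    ext z
    exact slash_scale_apply hG ht (h z).1 (h z).2
  refine ⟨C * (a / d), ?_⟩
  rw [e]
  have htend : Filter.Tendsto (affine ha hd b) UpperHalfPlane.atImInfty
      UpperHalfPlane.atImInfty := by
    rw [UpperHalfPlane.atImInfty, Filter.tendsto_comap_iff]
    have : UpperHalfPlane.im ∘ affine ha hd b = fun z : ℍ => a / d * z.im := by
      ext z
      exact im_affine ha hd b z
    rw [this]
    exact Filter.tendsto_comap.const_mul_atTop hpos
  have := (hgr.comp_tendsto htend).const_mul_left ((d : ℂ) ^ (-k))
  refine this.congr (fun _ => rfl) (fun z => ?_)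
  simp only [Function.comp_apply, im_affine]
  congr 1
  ring

end HookMaass

/-! ### Identification with level one Eisenstein series -/

namespace HookMaass

open Complex
open scoped ComplexConjugate

/-! ### The incomplete Gamma function at positive integers -/

/-- The derivative telescopes, so the integral of exp(-u) u^m / m! from x to ∞ is a finite sum. -/
lemma hasDerivAt_exp_neg_mul_sum (m : ℕ) (u : ℝ) :
    HasDerivAt (fun u : ℝ => -(Real.exp (-u) * ∑ i ∈ Finset.range (m + 1), u ^ i / i.factorial))
      (Real.exp (-u) * (u ^ m / m.factorial)) u := by
  induction m with
  | zero =>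
    refine ((hasDerivAt_neg u).exp.neg.congr_deriv (by simp)).congr_of_eventuallyEq ?_
    exact Filter.Eventually.of_forall (fun u => by simp)
  | succ m ih =>
    have h1 : HasDerivAt (fun u : ℝ => Real.exp (-u) * (u ^ (m + 1) / (m + 1).factorial))
        (-Real.exp (-u) * (u ^ (m + 1) / (m + 1).factorial) +
          Real.exp (-u) * (u ^ m / m.factorial)) u := by
      have h2 : HasDerivAt (fun u : ℝ => Real.exp (-u)) (-Real.exp (-u)) u := by
        simpa using (hasDerivAt_neg u).exp
      have h3 : HasDerivAt (fun u : ℝ => u ^ (m + 1) / (m + 1).factorial) (u ^ m / m.factorial) u := by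
        refine ((hasDerivAt_pow (m + 1) u).div_const _).congr_deriv ?_
        rw [Nat.factorial_succ]
        have : (m.factorial : ℝ) ≠ 0 := by exact_mod_cast m.factorial_ne_zero
        have : ((m : ℝ) + 1) ≠ 0 := by positivity
        push_cast
        field_simp
      exact h2.mul h3
    refine ((ih.sub h1).congr_deriv (by ring)).congr_of_eventuallyEq ?_
    refine Filter.Eventually.of_forall (fun u => ?_)
    simp only [Pi.sub_apply]
    rw [Finset.sum_range_succ _ (m + 1)]
    ring

lemma incGammaStar_natCast (m : ℕ) {s x : ℝ} (hs : s = m + 1) (hx : 0 ≤ x) :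
    incGammaStar s x = Real.exp (-x) * ∑ i ∈ Finset.range (m + 1), x ^ i / i.factorial := by
  have hm : (m.factorial : ℝ) ≠ 0 := by exact_mod_cast m.factorial_ne_zero
  have hlim : Filter.Tendsto
      (fun u : ℝ => -(Real.exp (-u) * ∑ i ∈ Finset.range (m + 1), u ^ i / i.factorial))
      Filter.atTop (nhds 0) := by
    rw [← neg_zero]
    refine Filter.Tendsto.neg ?_
    simp only [Finset.mul_sum]
    rw [← Finset.sum_const_zero (s := Finset.range (m + 1))]
    refine tendsto_finsetSum _ (fun i _ => ?_)
    have := (Real.tendsto_pow_mul_exp_neg_atTop_nhds_zero i).div_const (i.factorial : ℝ)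
    rw [zero_div] at this
    refine this.congr (fun u => by ring)
  have hint := MeasureTheory.integral_Ioi_of_hasDerivAt_of_nonneg'
    (a := x) (fun u _ => hasDerivAt_exp_neg_mul_sum m u)
    (fun u hu => by
      have : 0 ≤ u := hx.trans (le_of_lt hu)
      positivity) hlim
  have e : incGamma s x = m.factorial *
      ∫ u in Set.Ioi x, Real.exp (-u) * (u ^ m / m.factorial) := by
    rw [incGamma, ← MeasureTheory.integral_const_mul]
    refine MeasureTheory.setIntegral_congr_fun measurableSet_Ioi (fun u _ => ?_)
    rw [hs, add_sub_cancel_right, Real.rpow_natCast]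
    field_simp
  rw [incGammaStar, e, hint, hs, Real.Gamma_nat_eq_factorial]
  field_simp
  ring

/-! ### The Eisenstein series of negative weight -/

/-- The constant `2 (2k)! / (B_{2k} (4π)^(2k-1))`. -/
noncomputable def eisConst (k : ℕ) : ℂ :=
  2 * ((2 * k).factorial : ℂ) /
    (((bernoulli (2 * k) : ℚ) : ℂ) * (4 * (Real.pi : ℂ)) ^ (2 * k - 1))

/-- The nonholomorphic Eisenstein series of weight `2 - 2k`, as a function on `ℂ`. -/
noncomputable def negEis (k : ℕ) (w : ℂ) : ℂ :=
  (w.im : ℂ) ^ (2 * k - 1) + eisConst k * (riemannZeta (2 * k - 1) +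
    sigmaSeries (1 - 2 * k) 0 w + ∑ i ∈ Finset.range (2 * k - 1),
      (4 * Real.pi * w.im) ^ i / i.factorial * conj (sigmaSeries (1 - 2 * k) i w))

lemma conj_sigma (l : ℤ) (n : ℕ) : conj (sigma l n) = sigma l n := by
  simp [sigma, map_zpow₀]

lemma qParam_pow (t n : ℕ) (z : ℍ) : qParam z ^ (t * n) = expN n (t * z) := by
  rw [← expN_mul, expN_eq_pow, qParam]

lemma hasSum_conj_sigmaSeries {l : ℤ} (hl : l ≤ 0) (j : ℕ) {w : ℂ} (hw : 0 < w.im) :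
    HasSum (fun n : ℕ+ => sigma l n * ((n : ℕ) : ℂ) ^ j * conj (expN n w))
      (conj (sigmaSeries l j w)) := by
  have h := (summable_sigmaSeries hl j hw).hasSum
  rw [← PNat.coe_injective.hasSum_iff] at h
  · convert! h.map (starRingEnd ℂ) continuous_conj using 2 with n
    simp [conj_sigma]
  · intro n hn
    have : n = 0 := by
      by_contra h
      exact hn ⟨⟨n, Nat.pos_of_ne_zero h⟩, rfl⟩
    simp [this]

/-- This turns the factor q^(-n), large at the cusp, into the conjugate of q^n once the exponential
of the incomplete Gamma function is taken into account. -/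
lemma exp_mul_expN_inv (n : ℕ) (w : ℂ) :
    ((Real.exp (-(4 * Real.pi * n * w.im)) : ℝ) : ℂ) * (expN n w)⁻¹ = conj (expN n w) := by
  rw [expN, ← Complex.exp_neg, ← Complex.exp_conj, ofReal_exp, ← Complex.exp_add]
  congr 1
  simp only [map_mul, conj_I, conj_ofReal, map_ofNat, map_natCast]
  have h : w - conj w = 2 * I * w.im := by rw [sub_conj]; push_cast; ring
  push_cast
  linear_combination (-2 * (Real.pi : ℂ) * I * n) * h - (4 * (Real.pi : ℂ) * n * w.im) * I_mul_I

lemma EE_eq {k t : ℕ} (hk : 2 ≤ k) (ht : 0 < t) (z : ℍ) : EE k t z = negEis k (t * z) := by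
  obtain ⟨m, hm⟩ : ∃ m, 2 * k - 1 = m + 1 := ⟨2 * k - 2, by omega⟩
  have hl : (1 - 2 * k : ℤ) ≤ 0 := by omega
  have ht' : (0 : ℝ) < t := by exact_mod_cast ht
  have him : ((t : ℂ) * (z : ℂ)).im = t * z.im := by simp
  have hpos : 0 < ((t : ℂ) * (z : ℂ)).im := by rw [him]; exact mul_pos ht' z.im_pos
  have hb : hookBracket (2 * k) t z = sigmaSeries (1 - 2 * k) 0 (t * z) := by
    have := hookBracket_eq ht (2 * k) z
    push_cast at this
    exact this
  have hsum : HasSum (fun n : ℕ+ => sigma (1 - 2 * k) n *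
      (incGammaStar (2 * k - 1) (4 * Real.pi * t * n * z.im) : ℂ) * qParam z ^ (-(t * n : ℤ)))
      (∑ i ∈ Finset.range (2 * k - 1), (4 * Real.pi * ((t : ℂ) * z).im) ^ i / i.factorial *
        conj (sigmaSeries (1 - 2 * k) i (t * z))) := by
    have h := hasSum_sum (s := Finset.range (2 * k - 1)) (fun i _ =>
      (hasSum_conj_sigmaSeries hl i hpos).mul_left
        ((4 * Real.pi * ((t : ℂ) * z).im) ^ i / i.factorial : ℂ))
    convert! h using 2 with n
    have hs : (2 * (k : ℝ) - 1) = m + 1 := by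
      have : ((2 * k - 1 : ℕ) : ℝ) = ((m + 1 : ℕ) : ℝ) := by rw [hm]
      rw [Nat.cast_sub (by omega)] at this
      push_cast at this
      linarith
    have hz : qParam z ^ (-((t : ℤ) * (n : ℕ))) = (expN n (t * z))⁻¹ := by
      rw [zpow_neg, ← qParam_pow]
      congr 1
    have hx : 4 * Real.pi * t * (n : ℕ) * z.im = 4 * Real.pi * (n : ℕ) * ((t : ℂ) * z).im := by
      rw [him]; ring
    have hx0 : 0 ≤ 4 * Real.pi * (n : ℕ) * ((t : ℂ) * z).im := by
      have := Real.pi_pos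
      positivity
    rw [hz, hx, incGammaStar_natCast m hs hx0, hm]
    have h3 := exp_mul_expN_inv n ((t : ℂ) * z)
    rw [ofReal_mul]
    calc _ = sigma (1 - 2 * k) n * ((∑ i ∈ Finset.range (m + 1),
          (4 * Real.pi * (n : ℕ) * ((t : ℂ) * z).im) ^ i / i.factorial : ℝ) : ℂ) *
          (((Real.exp (-(4 * Real.pi * (n : ℕ) * ((t : ℂ) * z).im)) : ℝ) : ℂ) *
            (expN n (t * z))⁻¹) := by ring
      _ = _ := by
          rw [h3]
          push_cast
          rw [Finset.mul_sum, Finset.sum_mul]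
          refine Finset.sum_congr rfl (fun i _ => ?_)
          ring
  rw [EE, hb, hsum.tsum_eq, negEis, eisConst, him]

/-- Euler's formula for ζ(2k) together with the powers of i; that B_{2k} is nonzero is read off from
ζ(2k) ≠ 0. -/
lemma eisConst_eq {k : ℕ} (hk : 2 ≤ k) :
    4 * Real.pi * I / (2 * I) ^ (2 * k - 1) = 2 * riemannZeta (2 * k) * eisConst k := by
  have hpi : (Real.pi : ℂ) ≠ 0 := by exact_mod_cast Real.pi_ne_zero
  have hζ : riemannZeta (2 * k) ≠ 0 := riemannZeta_ne_zero_of_one_lt_re (by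
    have : (2 : ℝ) ≤ k := by exact_mod_cast hk
    simp
    linarith)
  have hζ' := riemannZeta_two_mul_nat (k := k) (by omega)
  have hB : ((bernoulli (2 * k) : ℚ) : ℂ) ≠ 0 := by
    intro h
    rw [h] at hζ'
    simp at hζ'
    exact hζ hζ'
  have hf : ((2 * k).factorial : ℂ) ≠ 0 := by exact_mod_cast (2 * k).factorial_ne_zero
  obtain ⟨m, hm⟩ : ∃ m, 2 * k - 1 = m + 1 := ⟨2 * k - 2, by omega⟩
  have hm2 : 2 * k = m + 2 := by omega
  have hI : (I : ℂ) ^ (m + 1) * I = (-1) ^ k := by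
    rw [← pow_succ, show m + 1 + 1 = 2 * k by omega, pow_mul, I_sq]
  have hI2 : (I : ℂ) ^ (m + 1) * (-1) ^ (k + 1) = I := by
    have h1 : ((-1 : ℂ) ^ k) * (-1) ^ k = 1 := by rw [← mul_pow]; norm_num
    have h2 : (I : ℂ) ^ (m + 1) = -((-1) ^ k * I) := by
      rw [← hI]
      linear_combination (I ^ (m + 1)) * I_mul_I
    rw [h2, pow_succ]
    linear_combination I * h1
  have hI0 : (I : ℂ) ^ (m + 1) ≠ 0 := pow_ne_zero _ I_ne_zero
  have hpi2 : (Real.pi : ℂ) ^ (2 * k) = Real.pi * Real.pi ^ (m + 1) := by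
    rw [hm2]; ring
  rw [eisConst, hζ', hm, hpi2, mul_pow, mul_pow, show (4 : ℂ) = 2 * 2 by norm_num,
    mul_pow (2 : ℂ) 2, div_eq_iff (mul_ne_zero (by simp) hI0)]
  field_simp
  linear_combination -hI2

lemma latticeSum_eq_negEis {k : ℕ} (hk : 2 ≤ k) (z : ℍ) :
    (z.im : ℂ) ^ (2 * k - 1) * latticeSum (2 * k - 1) z =
      2 * riemannZeta (2 * k) * negEis k z := by
  rw [latticeSum_eq k hk, eisConst_eq hk, negEis, UpperHalfPlane.coe_im]
  ring

lemma negEis_slash {k : ℕ} (hk : 2 ≤ k) (γ : SL(2, ℤ)) :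
    (fun z : ℍ => negEis k z) ∣[2 - 2 * (k : ℤ)] γ = fun z : ℍ => negEis k z := by
  have hζ : (2 * riemannZeta (2 * k)) ≠ 0 := mul_ne_zero two_ne_zero
    (riemannZeta_ne_zero_of_one_lt_re (by
      have : (2 : ℝ) ≤ k := by exact_mod_cast hk
      simp
      linarith))
  ext z
  have h := congrFun (latticeSum_slash k (by omega) γ) z
  rw [ModularForm.SL_slash_apply] at h ⊢
  rw [latticeSum_eq_negEis hk, latticeSum_eq_negEis hk, mul_assoc] at h
  exact mul_left_cancel₀ hζ h

/-! ### The weight zero Eisenstein series -/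

/-- The constant term of the Eisenstein series, as a function on `ℂ`. -/
noncomputable def zeroEis (w : ℂ) : ℂ :=
  w.im + 6 / (Real.pi : ℂ) * (Real.eulerMascheroniConstant - Real.log 2 -
    (Real.log w.im : ℂ) / 2 - 6 * deriv riemannZeta 2 / (Real.pi : ℂ) ^ 2 +
    sigmaSeries (-1) 0 w + conj (sigmaSeries (-1) 0 w))

lemma kroneckerExt_one_eq (z : ℍ) : kroneckerExt z 1 = zeroEis z := by
  rw [kroneckerExt_one, zeroEis, UpperHalfPlane.coe_im]

lemma EE₀_eq {t : ℕ} (ht : 0 < t) (z : ℍ) : EE₀ t z = zeroEis (t * z) := by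
  have ht' : (0 : ℝ) < t := by exact_mod_cast ht
  have him : ((t : ℂ) * (z : ℂ)).im = t * z.im := by simp
  have hpos : 0 < ((t : ℂ) * (z : ℂ)).im := by rw [him]; exact mul_pos ht' z.im_pos
  have hb : hookBracket 2 t z = sigmaSeries (-1) 0 (t * z) := by
    have := hookBracket_eq ht 2 z
    norm_num at this
    exact this
  have hsum : HasSum (fun n : ℕ+ => sigma (-1) n * conj (qParam z) ^ (t * n : ℕ))
      (conj (sigmaSeries (-1) 0 (t * z))) := by
    convert! hasSum_conj_sigmaSeries (l := -1) (by norm_num) 0 hpos using 2 with n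
    rw [pow_zero, mul_one, ← map_pow, qParam_pow]
  rw [EE₀, hb, hsum.tsum_eq, zeroEis, him]

lemma zeroEis_slash (γ : SL(2, ℤ)) :
    (fun z : ℍ => zeroEis z) ∣[(0 : ℤ)] γ = fun z : ℍ => zeroEis z := by
  ext z
  rw [ModularForm.SL_slash_apply, neg_zero, zpow_zero, mul_one, ← kroneckerExt_one_eq,
    kroneckerExt_one_smul, kroneckerExt_one_eq]

end HookMaass

/-! ### Analyticity, growth and the differential equations -/

namespace HookMaass

open Complex Filter
open scoped ComplexConjugate Topology

/-! ### Wirtinger derivatives -/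

/-- `F` is real differentiable at `w` with antiholomorphic derivative `D`. -/
def HasDbarAt (F : ℂ → ℂ) (D w : ℂ) : Prop :=
  ∃ L : ℂ →L[ℝ] ℂ, HasFDerivAt F L w ∧ (L 1 + I * L I) / 2 = D

namespace HasDbarAt

variable {F G : ℂ → ℂ} {D E w : ℂ}

lemma congr_deriv (h : HasDbarAt F D w) (e : D = E) : HasDbarAt F E w := e ▸ h

lemma congr_of_eventuallyEq (h : HasDbarAt F D w) (e : G =ᶠ[𝓝 w] F) : HasDbarAt G D w := by
  obtain ⟨L, hL, h⟩ := h
  exact ⟨L, hL.congr_of_eventuallyEq e, h⟩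

lemma add (hF : HasDbarAt F D w) (hG : HasDbarAt G E w) :
    HasDbarAt (fun w => F w + G w) (D + E) w := by
  obtain ⟨L, hL, rfl⟩ := hF
  obtain ⟨M, hM, rfl⟩ := hG
  refine ⟨L + M, hL.add hM, ?_⟩
  simp only [add_apply]
  ring

lemma mul (hF : HasDbarAt F D w) (hG : HasDbarAt G E w) :
    HasDbarAt (fun w => F w * G w) (D * G w + F w * E) w := by
  obtain ⟨L, hL, rfl⟩ := hF
  obtain ⟨M, hM, rfl⟩ := hG
  refine ⟨_, hL.mul hM, ?_⟩
  simp only [add_apply, smul_apply, smul_eq_mul]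
  ring

lemma const (c w : ℂ) : HasDbarAt (fun _ => c) 0 w :=
  ⟨0, hasFDerivAt_const c w, by simp⟩

lemma const_mul (c : ℂ) (hF : HasDbarAt F D w) : HasDbarAt (fun w => c * F w) (c * D) w :=
  ((const c w).mul hF).congr_deriv (by ring)

lemma of_hasDerivAt {f' : ℂ} (h : HasDerivAt F f' w) : HasDbarAt F 0 w := by
  refine ⟨_, h.hasFDerivAt.restrictScalars ℝ, ?_⟩
  simp only [ContinuousLinearMap.coe_restrictScalars', ContinuousLinearMap.toSpanSingleton_apply,
    smul_eq_mul]
  linear_combination f' / 2 * I_mul_I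

lemma conj_of_hasDerivAt {f' : ℂ} (h : HasDerivAt F f' w) :
    HasDbarAt (fun w => conj (F w)) (conj f') w := by
  refine ⟨_, conjCLE.toContinuousLinearMap.hasFDerivAt.comp w
    (h.hasFDerivAt.restrictScalars ℝ), ?_⟩
  simp
  linear_combination -conj f' / 2 * I_mul_I

lemma of_im {g : ℝ → ℝ} {g' : ℝ} (h : HasDerivAt g g' w.im) :
    HasDbarAt (fun w => (g w.im : ℂ)) (g' * I / 2) w := by
  have h1 : HasFDerivAt (fun w : ℂ => g w.im) (g' • imCLM) w :=
    h.comp_hasFDerivAt w imCLM.hasFDerivAt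
  refine ⟨_, ofRealCLM.hasFDerivAt.comp w h1, ?_⟩
  simp
  ring

end HasDbarAt

lemma dbar_eq {f : ℍ → ℂ} {F : ℂ → ℂ} (hf : ∀ z : ℍ, f z = F z) {D : ℂ} {z : ℍ}
    (h : HasDbarAt F D z) : dbar f z = D := by
  have e : f ∘ UpperHalfPlane.ofComplex =ᶠ[𝓝 (z : ℂ)] F := by
    filter_upwards [UpperHalfPlane.isOpen_upperHalfPlaneSet.mem_nhds z.im_pos] with w hw
    simp only [Function.comp_apply, hf]
    rw [UpperHalfPlane.ofComplex_apply_of_im_pos hw]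
  obtain ⟨L, hL, rfl⟩ := h.congr_of_eventuallyEq e
  rw [dbar, hL.fderiv]

/-! ### Analyticity -/

lemma analyticAt_ofReal_im (w : ℂ) : AnalyticAt ℝ (fun w : ℂ => (w.im : ℂ)) w :=
  (ofRealCLM.analyticAt _).comp (imCLM.analyticAt w)

lemma analyticAt_sigmaSeries {l : ℤ} (hl : l ≤ 0) (j : ℕ) {w : ℂ} (hw : 0 < w.im) :
    AnalyticAt ℝ (sigmaSeries l j) w := by
  refine AnalyticAt.restrictScalars (𝕜' := ℂ) ?_
  refine DifferentiableOn.analyticAt (s := {z : ℂ | 0 < z.im}) (fun z hz => ?_)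
    (UpperHalfPlane.isOpen_upperHalfPlaneSet.mem_nhds hw)
  exact (hasDerivAt_sigmaSeries hl j hz).differentiableAt.differentiableWithinAt

lemma analyticAt_conj_comp {f : ℂ → ℂ} {w : ℂ} (h : AnalyticAt ℝ f w) :
    AnalyticAt ℝ (fun w => conj (f w)) w :=
  (conjCLE.toContinuousLinearMap.analyticAt _).comp h

lemma analyticOnNhd_of_forall {f : ℍ → ℂ} {F : ℂ → ℂ} {t : ℕ} (ht : 0 < t)
    (hf : ∀ z : ℍ, f z = F (t * z)) (hF : ∀ w : ℂ, 0 < w.im → AnalyticAt ℝ F w) :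
    AnalyticOnNhd ℝ (f ∘ UpperHalfPlane.ofComplex) {z : ℂ | 0 < z.im} := by
  intro z hz
  have ht' : (0 : ℝ) < t := by exact_mod_cast ht
  have h1 : AnalyticAt ℝ (fun w : ℂ => (t : ℂ) * w) z := analyticAt_const.mul analyticAt_id
  have h2 : AnalyticAt ℝ (fun w => F (t * w)) z :=
    (hF (t * z) (by simpa using mul_pos ht' hz)).comp h1
  refine h2.congr ?_
  filter_upwards [UpperHalfPlane.isOpen_upperHalfPlaneSet.mem_nhds hz] with w hw
  simp only [Function.comp_apply, hf]
  rw [UpperHalfPlane.ofComplex_apply_of_im_pos hw]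

lemma analyticAt_negEis {k : ℕ} (hk : 2 ≤ k) {w : ℂ} (hw : 0 < w.im) :
    AnalyticAt ℝ (negEis k) w := by
  have hl : (1 - 2 * k : ℤ) ≤ 0 := by omega
  have hy := analyticAt_ofReal_im w
  refine (hy.pow _).add (analyticAt_const.mul ((analyticAt_const.add
    (analyticAt_sigmaSeries hl 0 hw)).add (Finset.analyticAt_fun_sum _ (fun i _ => ?_))))
  exact (((analyticAt_const.mul hy).pow i).div_const).mul
    (analyticAt_conj_comp (analyticAt_sigmaSeries hl i hw))

lemma analyticAt_zeroEis {w : ℂ} (hw : 0 < w.im) : AnalyticAt ℝ zeroEis w := by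
  have hy := analyticAt_ofReal_im w
  have hs := analyticAt_sigmaSeries (l := -1) (by norm_num) 0 hw
  have hlog : AnalyticAt ℝ (fun w : ℂ => (Real.log w.im : ℂ)) w :=
    (ofRealCLM.analyticAt (Real.log w.im)).comp (f := fun w : ℂ => Real.log w.im)
      (AnalyticAt.comp (g := Real.log) (f := im) (analyticAt_log hw) (imCLM.analyticAt w))
  exact hy.add (analyticAt_const.mul ((((analyticAt_const.sub hlog.div_const).sub
    analyticAt_const).add hs).add (analyticAt_conj_comp hs)))

/-! ### Growth at level one -/

lemma im_pow_isBigO (n : ℕ) :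
    (fun z : ℍ => (z.im : ℂ) ^ n) =O[UpperHalfPlane.atImInfty]
      fun z : ℍ => Real.exp (1 * z.im) := by
  have h : (fun y : ℝ => y ^ n) =O[atTop] fun y => Real.exp (1 * y) :=
    (isLittleO_pow_exp_pos_mul_atTop n one_pos).isBigO
  refine Asymptotics.IsBigO.of_norm_left ?_
  refine (h.comp_tendsto (tendsto_comap : Tendsto UpperHalfPlane.im _ _)).norm_left.congr_left
    (fun z => ?_)
  simp

lemma const_isBigO (c : ℂ) :
    (fun _ : ℍ => c) =O[UpperHalfPlane.atImInfty] fun z : ℍ => Real.exp (1 * z.im) := by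
  simpa using (im_pow_isBigO 0).const_mul_left c

lemma sigmaSeries_isBigO_one {l : ℤ} (hl : l ≤ 0) (j : ℕ) :
    (fun z : ℍ => sigmaSeries l j z) =O[UpperHalfPlane.atImInfty] fun _ => (1 : ℝ) := by
  obtain ⟨C, hC⟩ := exists_norm_sigmaSeries_le hl j
  refine Asymptotics.IsBigO.of_bound C ?_
  have : ∀ᶠ z : ℍ in UpperHalfPlane.atImInfty, 1 ≤ z.im :=
    (tendsto_comap : Tendsto UpperHalfPlane.im _ _).eventually (eventually_ge_atTop 1)
  filter_upwards [this] with z hz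
  simpa using hC z hz

lemma sigmaSeries_isBigO {l : ℤ} (hl : l ≤ 0) (j : ℕ) :
    (fun z : ℍ => sigmaSeries l j z) =O[UpperHalfPlane.atImInfty]
      fun z : ℍ => Real.exp (1 * z.im) := by
  refine (sigmaSeries_isBigO_one hl j).trans ?_
  simpa using (const_isBigO 1).norm_left

lemma negEis_isBigO {k : ℕ} (hk : 2 ≤ k) :
    (fun z : ℍ => negEis k z) =O[UpperHalfPlane.atImInfty]
      fun z : ℍ => Real.exp (1 * z.im) := by
  have hl : (1 - 2 * k : ℤ) ≤ 0 := by omega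
  refine (im_pow_isBigO _).add (Asymptotics.IsBigO.const_mul_left (((const_isBigO _).add
    (sigmaSeries_isBigO hl 0)).add (Asymptotics.IsBigO.fun_sum (fun i _ => ?_))) _)
  -- The sharper bound O(1) is used here, so that the product with y^i stays within exp(y).
  have h1 : (fun z : ℍ => conj (sigmaSeries (1 - 2 * k) i z)) =O[UpperHalfPlane.atImInfty]
      fun _ => (1 : ℝ) := by
    refine Asymptotics.IsBigO.of_norm_left ?_
    simpa using (sigmaSeries_isBigO_one hl i).norm_left
  have h2 := ((im_pow_isBigO i).const_mul_left ((4 * Real.pi) ^ i / i.factorial : ℂ)).mul h1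
  refine h2.congr (fun z => ?_) (fun z => by ring)
  rw [UpperHalfPlane.coe_im]
  ring

lemma zeroEis_isBigO :
    (fun z : ℍ => zeroEis z) =O[UpperHalfPlane.atImInfty]
      fun z : ℍ => Real.exp (1 * z.im) := by
  have hs := sigmaSeries_isBigO (l := -1) (by norm_num) 0
  have hy : (fun z : ℍ => ((z : ℂ).im : ℂ)) =O[UpperHalfPlane.atImInfty]
      fun z : ℍ => Real.exp (1 * z.im) := by
    simpa using im_pow_isBigO 1
  have hlog : (fun z : ℍ => (Real.log (z : ℂ).im : ℂ)) =O[UpperHalfPlane.atImInfty]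
      fun z : ℍ => Real.exp (1 * z.im) := by
    have h := (Real.isLittleO_log_id_atTop.isBigO.trans
      ((isLittleO_pow_exp_pos_mul_atTop 1 one_pos).isBigO.congr_left pow_one)).comp_tendsto
      (tendsto_comap : Tendsto UpperHalfPlane.im _ _)
    refine Asymptotics.IsBigO.of_norm_left ?_
    refine h.norm_left.congr_left (fun z => ?_)
    simp
  have hconj : (fun z : ℍ => conj (sigmaSeries (-1) 0 z)) =O[UpperHalfPlane.atImInfty]
      fun z : ℍ => Real.exp (1 * z.im) := by
    refine Asymptotics.IsBigO.of_norm_left ?_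
    simpa using hs.norm_left
  have hlog2 : (fun z : ℍ => (Real.log (z : ℂ).im : ℂ) / 2) =O[UpperHalfPlane.atImInfty]
      fun z : ℍ => Real.exp (1 * z.im) := by
    simpa [div_eq_inv_mul] using hlog.const_mul_left (2⁻¹ : ℂ)
  exact hy.add (Asymptotics.IsBigO.const_mul_left (((((const_isBigO _).sub hlog2).sub
    (const_isBigO _)).add hs).add hconj) _)

/-- A level one function of moderate growth gives a real analytic modular form of level `t`. -/
lemma isRealAnalyticModular_scale {m : ℤ} {F : ℂ → ℂ} (hF : ∀ w : ℂ, 0 < w.im → AnalyticAt ℝ F w)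
    (hmod : ∀ γ : SL(2, ℤ), (fun z : ℍ => F z) ∣[m] γ = fun z : ℍ => F z)
    (hgr : (fun z : ℍ => F z) =O[UpperHalfPlane.atImInfty] fun z : ℍ => Real.exp (1 * z.im))
    {t : ℕ} (ht : 0 < t) {f : ℍ → ℂ} (hf : ∀ z : ℍ, f z = F (t * z)) :
    IsRealAnalyticModular m (CongruenceSubgroup.Gamma0 t) f := by
  have e : f = fun z => (fun z : ℍ => F z) (scale ht z) := by
    ext z
    rw [hf]
    rfl
  refine ⟨analyticOnNhd_of_forall ht hf hF, fun γ hγ => ?_, fun γ => ?_⟩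
  · rw [e]
    exact scale_modular hmod ht hγ
  · rw [e]
    exact scale_growth hmod hgr ht γ


/-! ### Harmonicity -/

lemma HasDbarAt.comp_natCast_mul {F : ℂ → ℂ} {D w : ℂ} (t : ℕ) (h : HasDbarAt F D (t * w)) :
    HasDbarAt (fun w => F (t * w)) (t * D) w := by
  obtain ⟨L, hL, rfl⟩ := h
  have h1 : HasFDerivAt (fun w : ℂ => (t : ℂ) * w) ((t : ℂ) • ContinuousLinearMap.id ℝ ℂ) w :=
    (hasFDerivAt_id w).const_mul (t : ℂ)
  refine ⟨_, hL.comp w h1, ?_⟩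
  have e (v : ℂ) : L ((t : ℂ) * v) = t * L v := by
    rw [← nsmul_eq_mul, map_nsmul, nsmul_eq_mul]
  simp only [ContinuousLinearMap.comp_apply, smul_apply, ContinuousLinearMap.id_apply, smul_eq_mul,
    e]
  ring

/-- The sum telescopes: the derivative of the power of y in the summand i + 1 cancels that of the
conjugated series in the summand i, and only the last series derivative survives. -/
lemma hasDbarAt_sum_conj_sigmaSeries {l : ℤ} (hl : l ≤ 0) (N : ℕ) {w : ℂ} (hw : 0 < w.im) :
    HasDbarAt (fun w : ℂ => ∑ i ∈ Finset.range (N + 1),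
        (4 * Real.pi * w.im) ^ i / i.factorial * conj (sigmaSeries l i w))
      (-(2 * Real.pi * I) * ((4 * Real.pi * w.im) ^ N / N.factorial *
        conj (sigmaSeries l (N + 1) w))) w := by
  induction N with
  | zero =>
    simp only [zero_add, Finset.sum_range_one, pow_zero, Nat.factorial_zero, Nat.cast_one, div_one,
      one_mul]
    refine (HasDbarAt.conj_of_hasDerivAt (hasDerivAt_sigmaSeries hl 0 hw)).congr_deriv ?_
    rw [map_mul, map_mul, map_mul, conj_ofReal, conj_I, Complex.conj_ofNat]
    ring
  | succ N ih =>
    have h1 : HasDerivAt (fun y : ℝ => (4 * Real.pi * y) ^ (N + 1) / (N + 1).factorial)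
        (4 * Real.pi * ((4 * Real.pi * w.im) ^ N / N.factorial)) w.im := by
      have := (((hasDerivAt_id w.im).const_mul (4 * Real.pi)).pow (N + 1)).div_const
        ((N + 1).factorial : ℝ)
      refine this.congr_deriv ?_
      rw [Nat.factorial_succ]
      have : (N.factorial : ℝ) ≠ 0 := by exact_mod_cast N.factorial_ne_zero
      have : ((N : ℝ) + 1) ≠ 0 := by positivity
      push_cast
      simp only [id_eq]
      field_simp
    have h2 := ih.add ((HasDbarAt.of_im h1).mul
      (HasDbarAt.conj_of_hasDerivAt (hasDerivAt_sigmaSeries hl (N + 1) hw)))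
    refine (h2.congr_of_eventuallyEq (Eventually.of_forall (fun v => ?_))).congr_deriv ?_
    · simp only
      rw [Finset.sum_range_succ _ (N + 1)]
      push_cast
      rfl
    · simp only [map_mul, map_ofNat, conj_ofReal, conj_I]
      push_cast
      ring

/-- The derivative is y^(2k-2) times the conjugate of a holomorphic function, which is the form that
ξ_{2-2k} makes holomorphic. -/
lemma hasDbarAt_negEis {k m : ℕ} (hm : 2 * k = m + 2) {w : ℂ} (hw : 0 < w.im) :
    HasDbarAt (negEis k) ((w.im : ℂ) ^ m * conj (-((m + 1) * I / 2) +
      conj (eisConst k) * (2 * Real.pi * I * (4 * Real.pi) ^ m / m.factorial *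
        sigmaSeries (1 - 2 * k) (m + 1) w))) w := by
  have hl : (1 - 2 * k : ℤ) ≤ 0 := by omega
  have hm' : 2 * k - 1 = m + 1 := by omega
  have h1 : HasDbarAt (fun w : ℂ => ((w.im ^ (m + 1) : ℝ) : ℂ)) _ w :=
    HasDbarAt.of_im (hasDerivAt_pow (m + 1) w.im)
  have h2 := h1.add ((((HasDbarAt.const (riemannZeta (2 * k - 1)) w).add
    (HasDbarAt.of_hasDerivAt (hasDerivAt_sigmaSeries hl 0 hw))).add
    (hasDbarAt_sum_conj_sigmaSeries hl m hw)).const_mul (eisConst k))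
  refine (h2.congr_of_eventuallyEq (Eventually.of_forall (fun v => ?_))).congr_deriv ?_
  · simp only [negEis, hm']
    push_cast
    rfl
  · simp [Complex.conj_ofNat]
    ring

lemma hasDbarAt_zeroEis {w : ℂ} (hw : 0 < w.im) :
    HasDbarAt zeroEis (I / 2 + 6 / Real.pi * (-(I / (4 * w.im)) -
      2 * Real.pi * I * conj (sigmaSeries (-1) 1 w))) w := by
  have hS := hasDerivAt_sigmaSeries (l := -1) (by norm_num) 0 hw
  have h1 : HasDbarAt (fun w : ℂ => (w.im : ℂ)) _ w := HasDbarAt.of_im (hasDerivAt_id w.im)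
  have h2 : HasDbarAt (fun w : ℂ => (Real.log w.im : ℂ)) _ w :=
    HasDbarAt.of_im (Real.hasDerivAt_log hw.ne')
  have h3 := h1.add (((((HasDbarAt.const (Real.eulerMascheroniConstant - Real.log 2 -
    6 * deriv riemannZeta 2 / (Real.pi : ℂ) ^ 2) w).add (h2.const_mul (-1 / 2))).add
    (HasDbarAt.of_hasDerivAt hS)).add
    (HasDbarAt.conj_of_hasDerivAt hS)).const_mul (6 / Real.pi))
  refine (h3.congr_of_eventuallyEq (Eventually.of_forall (fun v => ?_))).congr_deriv ?_
  · simp only [zeroEis]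
    ring
  · simp [Complex.conj_ofNat]
    ring

lemma xi_eq_zero (m : ℤ) {f : ℍ → ℂ} {F : ℂ → ℂ} (hf : ∀ z : ℍ, f z = F z)
    (hF : ∀ w : ℂ, 0 < w.im → HasDbarAt F 0 w) : xi m f = 0 := by
  ext z
  rw [xi, dbar_eq hf (hF z z.im_pos)]
  simp

lemma hasDbarAt_sigmaSeries {l : ℤ} (hl : l ≤ 0) (j : ℕ) {t : ℕ} (ht : 0 < t) {w : ℂ}
    (hw : 0 < w.im) (A B : ℂ) : HasDbarAt (fun w => A + B * sigmaSeries l j (t * w)) 0 w := by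
  have ht' : (0 : ℝ) < t := by exact_mod_cast ht
  have h1 : HasDbarAt (sigmaSeries l j) 0 (t * w) :=
    HasDbarAt.of_hasDerivAt (hasDerivAt_sigmaSeries hl j (by simpa using mul_pos ht' hw))
  exact ((HasDbarAt.const A w).add ((h1.comp_natCast_mul t).const_mul B)).congr_deriv (by simp)

lemma laplacian_negEis {k t : ℕ} (hk : 2 ≤ k) (ht : 0 < t) {f : ℍ → ℂ}
    (hf : ∀ z : ℍ, f z = negEis k (t * z)) : laplacian (2 - 2 * k) f = 0 := by
  obtain ⟨m, hm⟩ : ∃ m, 2 * k = m + 2 := ⟨2 * k - 2, by omega⟩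
  have hl : (1 - 2 * k : ℤ) ≤ 0 := by omega
  have ht' : (0 : ℝ) < t := by exact_mod_cast ht
  have hw : (2 - 2 * k : ℤ) = -(m : ℤ) := by omega
  -- Since n^(2k-1) σ_{1-2k}(n) = σ_{2k-1}(n), this is a multiple of the holomorphic Eisenstein
  -- series of weight 2k at tz.
  have key (z : ℍ) : xi (2 - 2 * k) f z = 2 * I * t ^ (m + 1) * (-((m + 1) * I / 2)) +
      2 * I * t ^ (m + 1) * (conj (eisConst k) * (2 * Real.pi * I * (4 * Real.pi) ^ m /
        m.factorial)) * sigmaSeries (1 - 2 * k) (m + 1) (t * z) := by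
    have him : ((t : ℂ) * (z : ℂ)).im = t * z.im := by simp
    have hpos : 0 < ((t : ℂ) * (z : ℂ)).im := by rw [him]; exact mul_pos ht' z.im_pos
    have hy : (z.im : ℂ) ≠ 0 := by exact_mod_cast z.im_pos.ne'
    rw [xi, dbar_eq (F := fun w => negEis k (t * w)) hf
      ((hasDbarAt_negEis hm hpos).comp_natCast_mul t), him, hw, zpow_neg, zpow_natCast, map_mul,
      map_mul, map_natCast, conj_conj, map_pow, conj_ofReal]
    push_cast
    field_simp
    ring
  rw [laplacian, xi_eq_zero _ key (fun w hw => hasDbarAt_sigmaSeries hl _ ht hw _ _), neg_zero]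

lemma laplacian₂_zeroEis {t : ℕ} (ht : 0 < t) {f : ℍ → ℂ}
    (hf : ∀ z : ℍ, f z = zeroEis (t * z)) : laplacian₂ 0 f = 0 := by
  have ht' : (0 : ℝ) < t := by exact_mod_cast ht
  have hpi : (Real.pi : ℂ) ≠ 0 := by exact_mod_cast Real.pi_ne_zero
  -- This is t times the completed Eisenstein series E₂ - 3/(π Im) at tz, since n σ_{-1}(n) =
  -- σ_1(n).
  have key (z : ℍ) : xi 0 f z = ((-3 / Real.pi * z.im⁻¹ : ℝ) : ℂ) +
      (t + -24 * t * sigmaSeries (-1) 1 (t * z)) := by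
    have him : ((t : ℂ) * (z : ℂ)).im = t * z.im := by simp
    have hpos : 0 < ((t : ℂ) * (z : ℂ)).im := by rw [him]; exact mul_pos ht' z.im_pos
    have hy : (z.im : ℂ) ≠ 0 := by exact_mod_cast z.im_pos.ne'
    have ht0 : (t : ℂ) ≠ 0 := by exact_mod_cast ht.ne'
    rw [xi, dbar_eq (F := fun w => zeroEis (t * w)) hf
      ((hasDbarAt_zeroEis hpos).comp_natCast_mul t), him]
    simp only [map_mul, map_add, map_sub, map_neg, map_div₀, conj_I, conj_conj, conj_ofReal,
      map_natCast, map_ofNat, zpow_zero]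
    push_cast
    field_simp
    ring_nf
    simp only [I_sq]
    ring
  -- Only the term in 1/y is not holomorphic; the y² in ξ_2 cancels the 1/y² of its derivative.
  have key2 (z : ℍ) : xi (2 - 0) (xi 0 f) z = 3 / Real.pi := by
    have hy : (z.im : ℂ) ≠ 0 := by exact_mod_cast z.im_pos.ne'
    have h1 : HasDbarAt (fun w : ℂ => ((-3 / Real.pi * w.im⁻¹ : ℝ) : ℂ)) _ z :=
      HasDbarAt.of_im ((hasDerivAt_inv z.im_pos.ne').const_mul (-3 / Real.pi))
    have h2 := h1.add (hasDbarAt_sigmaSeries (l := -1) (by norm_num) 1 ht z.im_pos t (-24 * t))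
    rw [xi, dbar_eq key h2, sub_zero]
    simp only [map_mul, map_add, map_zero, map_div₀, conj_I, conj_ofReal, map_ofNat]
    push_cast
    rw [show ((z.im : ℂ) ^ (2 : ℤ)) = (z.im : ℂ) ^ 2 from zpow_natCast _ 2]
    field_simp
    linear_combination (-3) * I_sq
  rw [laplacian₂, xi_eq_zero 0 (F := fun _ => 3 / Real.pi) key2 (fun w _ => HasDbarAt.const _ w),
    neg_zero]

/-! ### The constant term of the Eisenstein series -/

/-- `kroneckerExt` is known to agree with the Eisenstein series only inside `remainderRegion`. The
witness is therefore defined by the series itself on all of Re s > 1, and coincides with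
`kroneckerExt` near 1. -/
lemma exists_analyticAt_eisenstein (z : ℍ) :
    ∃ F : ℂ → ℂ, AnalyticAt ℂ F 1 ∧ F 1 = zeroEis z ∧ ∀ s : ℂ, 1 < s.re →
      eisenstein z s = 3 / ((Real.pi : ℂ) * (s - 1)) + F s := by
  classical
  refine ⟨fun s => if 1 < s.re then eisenstein z s - 3 / (Real.pi * (s - 1))
    else kroneckerExt z s, ?_, ?_, fun s hs => ?_⟩
  · refine (analyticAt_kroneckerExt z).congr ?_
    filter_upwards [isOpen_remainderRegion.mem_nhds one_mem_remainderRegion] with s hs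
    split_ifs with h
    · rw [eisenstein_eq_kroneckerExt z h hs]
      ring
    · rfl
  · simp [kroneckerExt_one_eq]
  · simp only [if_pos hs]
    ring

end HookMaass

/-! ### Both parts of the theorem from the level one functions -/

theorem theorem1p2 (t : ℕ) (ht : 0 < t) :
    (HookMaass.IsSesquiharmonicMaassForm 0 (CongruenceSubgroup.Gamma0 t) (HookMaass.EE₀ t) ∧
      ∀ z w : ℍ, (w : ℂ) = (t : ℂ) * (z : ℂ) →
        HookMaass.EE₀ t z = HookMaass.EE₀ 1 w ∧
        ∃ F : ℂ → ℂ, AnalyticAt ℂ F 1 ∧ F 1 = HookMaass.EE₀ t z ∧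
          ∀ s : ℂ, 1 < s.re →
            HookMaass.eisenstein w s = 3 / ((Real.pi : ℂ) * (s - 1)) + F s) ∧
    ∀ k : ℕ, 2 ≤ k →
      HookMaass.IsHarmonicMaassForm (2 - 2 * (k : ℤ)) (CongruenceSubgroup.Gamma0 t)
        (HookMaass.EE k t) ∧
      ∀ z w : ℍ, (w : ℂ) = (t : ℂ) * (z : ℂ) →
        HookMaass.EE k t z = HookMaass.EE k 1 w := by
  refine ⟨⟨⟨HookMaass.isRealAnalyticModular_scale (fun _ => HookMaass.analyticAt_zeroEis)
    HookMaass.zeroEis_slash HookMaass.zeroEis_isBigO ht (HookMaass.EE₀_eq ht),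
    HookMaass.laplacian₂_zeroEis ht (HookMaass.EE₀_eq ht)⟩, fun z w h => ⟨?_, ?_⟩⟩,
    fun k hk => ⟨⟨HookMaass.isRealAnalyticModular_scale (fun _ => HookMaass.analyticAt_negEis hk)
    (HookMaass.negEis_slash hk) (HookMaass.negEis_isBigO hk) ht (HookMaass.EE_eq hk ht),
    HookMaass.laplacian_negEis hk ht (HookMaass.EE_eq hk ht)⟩, fun z w h => ?_⟩⟩
  · rw [HookMaass.EE₀_eq ht, HookMaass.EE₀_eq one_pos, Nat.cast_one, one_mul, h]
  · rw [HookMaass.EE₀_eq ht, ← h]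
    exact HookMaass.exists_analyticAt_eisenstein w
  · rw [HookMaass.EE_eq hk ht, HookMaass.EE_eq hk one_pos, Nat.cast_one, one_mul, h]
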